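/- Let $\Gamma$ be a bipartite distance-regular graph with vertex set $X$, path-length distance $\partial$, diameter $D\ge 4$, valency $k\ge 3$ and intersection numbers $p^h_{ij}=|\{z\in X:\partial(x,z)=i,\ \partial(z,y)=j\}|$ (where $\partial(x,y)=h$). Write $b_i=p^i_{1,i+1}$ and $k_2=p^0_{22}$. Let $\theta_0>\theta_1>\cdots>\theta_D$ be the distinct eigenvalues of the adjacency matrix $A$, and let $d=\lfloor D/2\rfloor$. Fix $x\in X$. Let $V=\mathbb C^X$ be the standard module with its Hermitian inner product, let $E_i^*$ $(0\le i\le D)$ be the diagonal matrix whose $(y,y)$ entry is $1$ if $\partial(x,y)=i$ and $0$ otherwise, let $A_2$ be the $0/1$ matrix whose $(y,z)$ entry is $1$ exactly when $\partial(y,z)=2$, and let $T=T(x)$ be the algebra of complex matrices generated by $A,E_0^*,\ldots,E_D^*$. A $T$-module is a subspace $W\subseteq V$ with $TW\subseteq W$. The endpoint of an irreducible $T$-module $W$ is $\min\{i: E_i^*W\ne 0\}$, and $W$ is thin if $\dim E_i^*W\le 1$ for all $i$. If $W$ is a thin irreducible $T$-module with endpoint $2$, its local eigenvalue is the eigenvalue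 of $E_2^*A_2E_2^*$ on the one-dimensional space $E_2^*W$. The local eigenvalues $\eta_1,\ldots,\eta_{k_2}$ of $\Gamma$ with respect to $x$ are the eigenvalues, with multiplicity, of the graph on $\{y:\partial(x,y)=2\}$ in which $y,z$ are adjacent when $\partial(y,z)=2$; they can be, and are, ordered so that $\eta_1=p^2_{22}$ and $\eta_i=b_3-1$ for $2\le i\le k$. Let $V_0$ be the unique irreducible $T$-module with endpoint $0$, let $Y$ be the span of the irreducible $T$-modules with endpoint $1$, let $U$ be the orthogonal complement of $E_2^*V_0+E_2^*Y$ in $E_2^*V$, and for real $\eta$ let $U_\eta=\{v\in U: E_2^*A_2E_2^*v=\eta v\}$. Let $n\in\{1,d\}$ if $D$ is odd and $n=1$ if $D$ is even, and put $$\eta=\tilde\theta_n=-1-\frac{b_2b_3}{\theta_n^2-b_2}$$ (the denominator is nonzero). Then the following three numbers are equal: (i) $\mu_\eta$, the multiplicity with which a thin irreducible $T$-module $W$ with endpoint $2$ and local eigenvalue $\eta$ appears in $V$, that is, the number of summands isomorphic to $W$ in an orthogonal direct sum decomposition of $V$ into irreducible $T$-modules (with $\mu_\eta=0$ if no such $W$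 exists); (ii) $\dim U_\eta$; (iii) $\mathrm{mult}_\eta$, the number of times $\eta$ appears among $\eta_{k+1},\ldots,\eta_{k_2}$. -/

import Mathlib

noncomputable section

namespace Subconstituent

open Matrix

variable {X : Type*} [Fintype X] [DecidableEq X]

/-- `G` is distance-regular with intersection numbers `p h i j` (usually written `p^h_{ij}`), for
`0 ≤ h, i, j ≤ D`, where `D` is the diameter: it is connected, and for all vertices `x, y` at
distance `h` there are exactly `p h i j` vertices `z` with `∂(x,z) = i` and `∂(z,y) = j`. -/
structure IsDistanceRegularWith (G : SimpleGraph X) (p : ℕ → ℕ → ℕ → ℕ) : Prop where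
  connected : G.Connected
  card_eq : ∀ h i j : ℕ, h ≤ G.diam → i ≤ G.diam → j ≤ G.diam → ∀ x y : X, G.dist x y = h →
    (Finset.univ.filter fun z : X => G.dist x z = i ∧ G.dist z y = j).card = p h i j

/-- The distance matrix `A_i`, with entries in `R`. -/
def distMatrix (R : Type*) [Zero R] [One R] (G : SimpleGraph X) (i : ℕ) : Matrix X X R :=
  Matrix.of fun y z => if G.dist y z = i then 1 else 0

/-- The distinct eigenvalues of the adjacency matrix `A = A_1`, in decreasing order:
`eigenvalue G i` is `θ_i`, where `θ_0 > θ_1 > ⋯`. The value `0` is used for `i` out of range. -/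
def eigenvalue (G : SimpleGraph X) (i : ℕ) : ℝ :=
  ((distMatrix ℝ G 1).charpoly.roots.toFinset.sort (· ≥ ·)).getD i 0

/-- The scalar `-1 - b₂ b₃ / (z² - b₂)`, where `b_i = p^i_{1,i+1}`, for `z² ≠ b₂`. -/
def tilde (p : ℕ → ℕ → ℕ → ℕ) (z : ℝ) : ℝ :=
  -1 - (p 2 1 3 : ℝ) * (p 3 1 4 : ℝ) / (z ^ 2 - (p 2 1 3 : ℝ))

/-- The dual idempotent `E*_i` with respect to `x`. -/
def dualIdempotent (G : SimpleGraph X) (x : X) (i : ℕ) : Matrix X X ℂ :=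
  Matrix.diagonal fun y => if G.dist x y = i then 1 else 0

/-- The Bose-Mesner algebra `M`, generated by the adjacency matrix. -/
def boseMesner (G : SimpleGraph X) : Subalgebra ℂ (Matrix X X ℂ) :=
  Algebra.adjoin ℂ {distMatrix ℂ G 1}

/-- The dual Bose-Mesner algebra `M*`, generated by `E*_0, …, E*_D`. -/
def dualBoseMesner (G : SimpleGraph X) (x : X) : Subalgebra ℂ (Matrix X X ℂ) :=
  Algebra.adjoin ℂ {B | ∃ i ≤ G.diam, B = dualIdempotent G x i}

/-- The subconstituent (Terwilliger) algebra `T(x)`, generated by `M` and `M*`. -/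
def subconstituentAlgebra (G : SimpleGraph X) (x : X) : Subalgebra ℂ (Matrix X X ℂ) :=
  boseMesner G ⊔ dualBoseMesner G x

/-- The image `B W` of a subspace `W` of the standard module `ℂ^X` under a matrix `B`. -/
def image (B : Matrix X X ℂ) (W : Submodule ℂ (X → ℂ)) : Submodule ℂ (X → ℂ) :=
  W.map B.mulVecLin

/-- A `T`-module is a subspace `W` of the standard module with `B W ⊆ W` for all `B ∈ T`. -/
def IsTModule (G : SimpleGraph X) (x : X) (W : Submodule ℂ (X → ℂ)) : Prop :=
  ∀ B ∈ subconstituentAlgebra G x, ∀ w ∈ W, B *ᵥ w ∈ W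

/-- Irreducible `T`-modules. -/
def IsIrreducibleTModule (G : SimpleGraph X) (x : X) (W : Submodule ℂ (X → ℂ)) : Prop :=
  IsTModule G x W ∧ W ≠ ⊥ ∧ ∀ W' ≤ W, IsTModule G x W' → W' = ⊥ ∨ W' = W

/-- Isomorphism of `T`-modules: an isomorphism of vector spaces `σ : W → W'` such that
`σ (B w) = B (σ w)` for all `B ∈ T` and `w ∈ W`. -/
def TIsomorphic (G : SimpleGraph X) (x : X) (W W' : Submodule ℂ (X → ℂ)) : Prop :=
  ∃ σ : W ≃ₗ[ℂ] W', ∀ B ∈ subconstituentAlgebra G x, ∀ w w₁ : W,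
    (w₁ : X → ℂ) = B *ᵥ (w : X → ℂ) → (σ w₁ : X → ℂ) = B *ᵥ (σ w : X → ℂ)

/-- The endpoint of `W`: the least `i` with `0 ≤ i ≤ D` and `E*_i W ≠ 0`. -/
def endpoint (G : SimpleGraph X) (x : X) (W : Submodule ℂ (X → ℂ)) : ℕ :=
  sInf {i | i ≤ G.diam ∧ image (dualIdempotent G x i) W ≠ ⊥}

/-- `W` is thin: `dim E*_i W ≤ 1` for `0 ≤ i ≤ D`. -/
def IsThin (G : SimpleGraph X) (x : X) (W : Submodule ℂ (X → ℂ)) : Prop :=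
  ∀ i ≤ G.diam, Module.finrank ℂ (image (dualIdempotent G x i) W) ≤ 1

/-- The matrix `E*_2 A_2 E*_2`. -/
def localMatrix (G : SimpleGraph X) (x : X) : Matrix X X ℂ :=
  dualIdempotent G x 2 * distMatrix ℂ G 2 * dualIdempotent G x 2

/-- `W` is a thin irreducible `T`-module with endpoint 2 and local eigenvalue `η`, that is,
`E*_2 A_2 E*_2` acts on the one-dimensional space `E*_2 W` as the scalar `η`. -/
structure IsThinWithLocalEigenvalue (G : SimpleGraph X) (x : X) (η : ℝ)
    (W : Submodule ℂ (X → ℂ)) : Prop where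
  irreducible : IsIrreducibleTModule G x W
  thin : IsThin G x W
  endpoint_eq : endpoint G x W = 2
  local_eigenvalue : ∀ w ∈ image (dualIdempotent G x 2) W, localMatrix G x *ᵥ w = (η : ℂ) • w

/-- The Hermitian inner product on the standard module. -/
def hermitian (u v : X → ℂ) : ℂ := u ⬝ᵥ star v

/-- `W_1, …, W_m` are irreducible `T`-modules whose orthogonal direct sum is the standard
module. -/
structure IsOrthogonalDecomposition (G : SimpleGraph X) (x : X) {m : ℕ}
    (W : Fin m → Submodule ℂ (X → ℂ)) : Prop where
  irreducible : ∀ i, IsIrreducibleTModule G x (W i)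
  orthogonal : ∀ i j, i ≠ j → ∀ u ∈ W i, ∀ v ∈ W j, hermitian u v = 0
  direct_sum : DirectSum.IsInternal W

open Classical in
/-- `μ` is the multiplicity with which `W` appears in the standard module: the standard module is
an orthogonal direct sum of irreducible `T`-modules, and in every such decomposition exactly `μ`
of the summands are isomorphic to `W`. -/
def IsMultiplicity (G : SimpleGraph X) (x : X) (W : Submodule ℂ (X → ℂ)) (μ : ℕ) : Prop :=
  (∃ (m : ℕ) (Z : Fin m → Submodule ℂ (X → ℂ)), IsOrthogonalDecomposition G x Z) ∧
  ∀ (m : ℕ) (Z : Fin m → Submodule ℂ (X → ℂ)), IsOrthogonalDecomposition G x Z →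
    (Finset.univ.filter fun i => TIsomorphic G x (Z i) W).card = μ

/-- `μ` is the scalar `μ_η`: the multiplicity in the standard module of any thin irreducible
`T`-module with endpoint 2 and local eigenvalue `η`, and `0` if there is no such module. -/
def IsMu (G : SimpleGraph X) (x : X) (η : ℝ) (μ : ℕ) : Prop :=
  (∀ W, IsThinWithLocalEigenvalue G x η W → IsMultiplicity G x W μ) ∧
  ((¬ ∃ W, IsThinWithLocalEigenvalue G x η W) → μ = 0)

/-- The span of the irreducible `T`-modules with endpoint `i`. For `i = 0` there is only one such
module (for `G` distance-regular), and the span is that module `V_0`. -/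
def endpointSpan (G : SimpleGraph X) (x : X) (i : ℕ) : Submodule ℂ (X → ℂ) :=
  sSup {W | IsIrreducibleTModule G x W ∧ endpoint G x W = i}

/-- The space `U`: the orthogonal complement of `E*_2 V_0 + E*_2 Y` in `E*_2 V`, where `Y` is the
span of the irreducible `T`-modules with endpoint 1. -/
def spaceU (G : SimpleGraph X) (x : X) : Submodule ℂ (X → ℂ) where
  carrier := {v | v ∈ image (dualIdempotent G x 2) ⊤ ∧
    ∀ w ∈ image (dualIdempotent G x 2) (endpointSpan G x 0) ⊔
      image (dualIdempotent G x 2) (endpointSpan G x 1), hermitian v w = 0}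
  add_mem' := by
    rintro u v ⟨hu, hu'⟩ ⟨hv, hv'⟩
    refine ⟨add_mem hu hv, fun w hw => ?_⟩
    have h1 : u ⬝ᵥ star w = 0 := hu' w hw
    have h2 : v ⬝ᵥ star w = 0 := hv' w hw
    simp [hermitian, add_dotProduct, h1, h2]
  zero_mem' := ⟨zero_mem _, fun w _ => by simp [hermitian]⟩
  smul_mem' := by
    rintro c v ⟨hv, hv'⟩
    refine ⟨Submodule.smul_mem _ c hv, fun w hw => ?_⟩
    have h1 : v ⬝ᵥ star w = 0 := hv' w hw
    simp [hermitian, smul_dotProduct, h1]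

/-- The space `U_η` of all `v ∈ U` with `E*_2 A_2 E*_2 v = η v`. -/
def eigenspaceU (G : SimpleGraph X) (x : X) (η : ℝ) : Submodule ℂ (X → ℂ) :=
  spaceU G x ⊓ Module.End.eigenspace (localMatrix G x).mulVecLin (η : ℂ)

/-- The graph `Γ_2^2(x)`: the vertices are the `y` with `∂(x,y) = 2`, and `y, z` are adjacent
when `∂(y,z) = 2`. -/
def localGraph (G : SimpleGraph X) (x : X) : SimpleGraph {y : X // G.dist x y = 2} where
  Adj y z := G.dist (y : X) (z : X) = 2
  symm := ⟨fun y z h => by rw [SimpleGraph.dist_comm]; exact h⟩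
  loopless := ⟨fun y h => by simp at h⟩

open Classical in
/-- The multiset of eigenvalues of the adjacency matrix of `Γ_2^2(x)`, with multiplicities. -/
def localSpectrum (G : SimpleGraph X) (x : X) : Multiset ℝ :=
  ((localGraph G x).adjMatrix ℝ).charpoly.roots

/-- `e 1, …, e k₂` lists the local eigenvalues in such a way that `e 1 = p^2_{22}` and
`e i = b₃ - 1` for `2 ≤ i ≤ k`. Here `k = p^0_{11}`, `k₂ = p^0_{22}` and `b₃ = p^3_{14}`. -/
structure IsLocalOrdering (G : SimpleGraph X) (x : X) (p : ℕ → ℕ → ℕ → ℕ) (e : ℕ → ℝ) : Prop where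
  eigenvalues : (Finset.Icc 1 (p 0 2 2)).val.map e = localSpectrum G x
  first : e 1 = (p 2 2 2 : ℝ)
  second : ∀ i, 2 ≤ i → i ≤ p 0 1 1 → e i = (p 3 1 4 : ℝ) - 1

/-- `m` is `mult_η`: orderings `η_1, …, η_{k₂}` of the local eigenvalues as above exist, and in
each of them `η` appears exactly `m` times among `η_{k+1}, …, η_{k₂}`. -/
def IsMult (G : SimpleGraph X) (x : X) (p : ℕ → ℕ → ℕ → ℕ) (η : ℝ) (m : ℕ) : Prop :=
  (∃ e, IsLocalOrdering G x p e) ∧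
  ∀ e, IsLocalOrdering G x p e →
    ((Finset.Icc (p 0 1 1 + 1) (p 0 2 2)).filter fun i => e i = η).card = m

end Subconstituent

end

noncomputable section

namespace Subconstituent

open Matrix

set_option linter.unusedSectionVars false

variable {X : Type*} [Fintype X] [DecidableEq X] {G : SimpleGraph X} {p : ℕ → ℕ → ℕ → ℕ}

/-! ### Distances in a bipartite distance-regular graph -/

/-! Let `u` be the cosine sequence of `θ = θ_n` and `F` the matrix with entries `u (∂(y,z))`. The
space `U` consists of the vectors on the second layer killed by `E*_1 A` (`mem_spaceU_iff`), and
their entries sum to zero. If such a `v` has `E*_2 A_2 E*_2 v = η v`, then on the second layer `F v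
= (1 + η u_2 - (1 + η) u_4) v`, and `η = θ̃_n` is the value that makes this coefficient vanish
(`IsCosine.tilde_identity`). Since `F²` is a multiple of `F`, `‖F v‖²` is a multiple of `⟨v, F v⟩ =
0`, so `F v = 0` everywhere (`radial_cosine_mulVec_eq_zero`).

From a vertex of layer `j`, the second layer is seen at distances `j - 2`, `j`, `j + 2`, which
splits the sum of `v` into lower, middle and upper parts. Eliminating the middle part between `J v =
0` (`J` all ones) and `F v = 0` leaves `(u_{j-2} - u_j) lower = (u_j - u_{j+2}) upper`. If `u_j ≠
u_{j+2}` throughout, the two outer sums are proportional in each layer, and then the lower sums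
span, layer by layer, a thin irreducible module with endpoint 2 (`IsPrimitive.isLadder`, `ladder`).
The choice of `n` is used here: if `u_j = u_{j+2}`, a truncation of `u` would violate the Rayleigh
bound saying that `θ_1²` is the largest squared eigenvalue below `k²`, or `θ_d²` the smallest one
(`IsCosine.ne_of_extremal_max`, `IsCosine.ne_of_extremal_min`).

Thus every nonzero vector of `U_η` generates a thin irreducible module. As sums of vectors of `U_η`
stay in `U_η`, all nonzero ones have the same annihilator in `T`, so these modules are isomorphic;
each meets `U_η` in a line, whence `μ_η = dim U_η` (`isMu_finrank`).

The equality with `mult_η` holds for every real `η`: the second layer is the direct sum of the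
all-ones line, the image under `E*_2 A` of the sum-zero vectors of the first layer, and `U`. The
local matrix acts on the first two as `p^2_22` and `b_3 - 1`, which accounts for `η_1, …, η_k`
(`finrank_localEigenspace`, `isMult_finrank`). -/

lemma even_dist_add_dist_add_dist (hc : G.Connected) (hbip : G.IsBipartite) (x y z : X) :
    Even (G.dist x y + G.dist y z + G.dist x z) := by
  let C : G.Coloring Bool := SimpleGraph.Colorable.toColoring hbip (by simp)
  have key : ∀ u v : X, Even (G.dist u v) ↔ (C u ↔ C v) := by
    intro u v
    obtain ⟨q, hq⟩ := hc.exists_walk_length_eq_dist u v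
    rw [← hq]
    exact C.even_length_iff_congr q
  rw [Nat.even_add, Nat.even_add, key, key, key]
  tauto

lemma dist_le_diam' (hc : G.Connected) (x y : X) : G.dist x y ≤ G.diam := by
  have := hc.nonempty
  exact SimpleGraph.dist_le_diam (SimpleGraph.connected_iff_ediam_ne_top.1 hc)

lemma dist_step (hc : G.Connected) (hbip : G.IsBipartite) {y w : X} (h : G.dist y w = 1) (z : X) :
    G.dist w z = G.dist y z + 1 ∨ G.dist w z + 1 = G.dist y z := by
  have h1 := even_dist_add_dist_add_dist hc hbip y w z
  have h2 := hc.dist_triangle (u := y) (v := w) (w := z)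
  have h3 := hc.dist_triangle (u := w) (v := y) (w := z)
  rw [SimpleGraph.dist_comm (u := w) (v := y)] at h3
  rw [h] at *
  obtain ⟨r, hr⟩ := h1
  omega

lemma exists_neighbor_closer (hc : G.Connected) {y z : X} {h : ℕ} (hd : G.dist y z = h + 1) :
    ∃ w, G.dist y w = 1 ∧ G.dist w z = h := by
  obtain ⟨q, hq⟩ := hc.exists_walk_length_eq_dist y z
  cases q with
  | nil => simp at hd
  | @cons _ w _ hadj q =>
    refine ⟨w, SimpleGraph.dist_eq_one_iff_adj.2 hadj, ?_⟩
    have h1 := SimpleGraph.dist_le q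
    have h2 := hc.dist_triangle (u := y) (v := w) (w := z)
    rw [SimpleGraph.dist_eq_one_iff_adj.2 hadj] at h2
    simp at hq
    omega

lemma exists_pair_dist_eq (hc : G.Connected) {h : ℕ} (hh : h ≤ G.diam) :
    ∃ y z : X, G.dist y z = h := by
  have := hc.nonempty
  induction hn : G.diam - h generalizing h with
  | zero =>
    obtain ⟨u, v, huv⟩ := G.exists_dist_eq_diam
    exact ⟨u, v, by omega⟩
  | succ n ih =>
    obtain ⟨y, z, hyz⟩ := ih (h := h + 1) (by omega) (by omega)
    obtain ⟨w, -, hw⟩ := exists_neighbor_closer hc hyz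
    exact ⟨w, z, hw⟩

/-- Regularity carries a nonempty sphere from one centre to all others: `p 0 h h` is the size of the
sphere of radius `h` about any vertex. -/
lemma exists_dist_eq (hG : IsDistanceRegularWith G p) (x : X) {h : ℕ} (hh : h ≤ G.diam) :
    ∃ y, G.dist x y = h := by
  obtain ⟨y, z, hyz⟩ := exists_pair_dist_eq hG.connected hh
  have h1 := hG.card_eq 0 h h (Nat.zero_le _) hh hh y y (by simp)
  have h2 := hG.card_eq 0 h h (Nat.zero_le _) hh hh x x (by simp)
  have h3 : 0 < p 0 h h := by
    rw [← h1]
    exact Finset.card_pos.2 ⟨z, by simp [hyz, G.dist_comm (u := z)]⟩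
  rw [← h2] at h3
  obtain ⟨w, hw⟩ := Finset.card_pos.1 h3
  exact ⟨w, (Finset.mem_filter.1 hw).2.1⟩

/-- The intersection number `b_i`, with `b_i = 0` for `i ≥ D`. -/
def bNum (G : SimpleGraph X) (p : ℕ → ℕ → ℕ → ℕ) (i : ℕ) : ℕ :=
  if i < G.diam then p i 1 (i + 1) else 0

/-- The intersection number `c_i`, with `c_0 = 0` and `c_i = 0` for `i > D`. -/
def cNum (G : SimpleGraph X) (p : ℕ → ℕ → ℕ → ℕ) (i : ℕ) : ℕ :=
  if 1 ≤ i ∧ i ≤ G.diam then p i 1 (i - 1) else 0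

lemma card_up (hG : IsDistanceRegularWith G p) (hD : 1 ≤ G.diam) (y z : X) :
    (Finset.univ.filter fun w : X => G.dist y w = 1 ∧ G.dist w z = G.dist y z + 1).card =
      bNum G p (G.dist y z) := by
  unfold bNum
  split_ifs with h
  · exact hG.card_eq _ _ _ h.le hD h y z rfl
  · rw [Finset.card_eq_zero, Finset.filter_eq_empty_iff]
    rintro w - ⟨-, hw⟩
    have := dist_le_diam' hG.connected w z
    omega

lemma card_down (hG : IsDistanceRegularWith G p) (hD : 1 ≤ G.diam) (y z : X) :
    (Finset.univ.filter fun w : X => G.dist y w = 1 ∧ G.dist w z + 1 = G.dist y z).card =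
      cNum G p (G.dist y z) := by
  have hd := dist_le_diam' hG.connected y z
  unfold cNum
  split_ifs with h
  · rw [← hG.card_eq _ _ _ h.2 hD ((Nat.sub_le _ _).trans hd) y z rfl]
    congr 1
    ext w
    simp only [Finset.mem_filter, Finset.mem_univ, true_and]
    omega
  · rw [Finset.card_eq_zero, Finset.filter_eq_empty_iff]
    rintro w - ⟨-, hw⟩
    omega

lemma bNum_pos (hG : IsDistanceRegularWith G p) {i : ℕ} (hi : i < G.diam) : 0 < bNum G p i := by
  obtain ⟨z, w, hw⟩ := exists_pair_dist_eq hG.connected (h := i + 1) hi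
  obtain ⟨y, hy, hyw⟩ := exists_neighbor_closer hG.connected hw
  rw [← hyw, ← card_up hG (by omega)]
  refine Finset.card_pos.2 ⟨z, ?_⟩
  simp only [Finset.mem_filter, Finset.mem_univ, true_and]
  rw [G.dist_comm (u := y) (v := z)]
  exact ⟨hy, by omega⟩

lemma cNum_pos (hG : IsDistanceRegularWith G p) {i : ℕ} (h1 : 1 ≤ i) (hi : i ≤ G.diam) :
    0 < cNum G p i := by
  obtain ⟨z, w, hw⟩ := exists_pair_dist_eq hG.connected hi
  obtain ⟨j, rfl⟩ : ∃ j, i = j + 1 := ⟨i - 1, by omega⟩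
  obtain ⟨y, hy, hyw⟩ := exists_neighbor_closer hG.connected hw
  rw [← hw, ← card_down hG (by omega)]
  refine Finset.card_pos.2 ⟨y, ?_⟩
  simp only [Finset.mem_filter, Finset.mem_univ, true_and]
  exact ⟨hy, by omega⟩

lemma cNum_zero : cNum G p 0 = 0 := by simp [cNum]

lemma bNum_diam : bNum G p G.diam = 0 := by simp [bNum]

lemma card_dist_eq (hG : IsDistanceRegularWith G p) {h : ℕ} (hh : h ≤ G.diam) (y : X) :
    (Finset.univ.filter fun w : X => G.dist y w = h).card = p 0 h h := by
  rw [← hG.card_eq 0 h h (Nat.zero_le _) hh hh y y (by simp)]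
  congr 1
  ext w
  simp [G.dist_comm (u := w)]

/-- The sum over the neighbours of `y` of a function of the distance to `z`. -/
def step (R : Type*) [CommSemiring R] (G : SimpleGraph X) (p : ℕ → ℕ → ℕ → ℕ) (g : ℕ → R) (i : ℕ) :
    R :=
  cNum G p i * g (i - 1) + bNum G p i * g (i + 1)

/-- The matrix whose `(y, z)` entry is `g (∂(y, z))`. -/
def radial {R : Type*} (G : SimpleGraph X) (g : ℕ → R) : Matrix X X R :=
  Matrix.of fun y z => g (G.dist y z)

@[simp] lemma radial_apply {R : Type*} (g : ℕ → R) (y z : X) :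
    radial G g y z = g (G.dist y z) := rfl

lemma distMatrix_eq_radial {R : Type*} [Zero R] [One R] (i : ℕ) :
    distMatrix R G i = radial G (fun j => if j = i then 1 else 0) := rfl

lemma radial_congr {R : Type*} (hc : G.Connected) {f g : ℕ → R} (h : ∀ i ≤ G.diam, f i = g i) :
    radial G f = radial G g := by
  ext y z
  exact h _ (dist_le_diam' hc y z)

lemma radial_add {R : Type*} [Add R] (f g : ℕ → R) :
    radial G f + radial G g = radial G (f + g) := rfl

lemma radial_smul {R : Type*} [Mul R] (a : R) (g : ℕ → R) :
    a • radial G g = radial G (a • g) := rfl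

lemma radial_transpose {R : Type*} (g : ℕ → R) : (radial G g)ᵀ = radial G g := by
  ext y z
  simp [G.dist_comm (u := z)]

section Step

variable {R : Type*} [CommSemiring R]

/-- Bipartiteness leaves a neighbour of `y` only two possible distances to `z`. At distance 0 the
truncated index `i - 1` is harmless, since `cNum` vanishes there. -/
lemma sum_neighbors (hG : IsDistanceRegularWith G p) (hbip : G.IsBipartite) (hD : 1 ≤ G.diam)
    (g : ℕ → R) (y z : X) :
    ∑ w ∈ Finset.univ.filter (fun w => G.dist y w = 1), g (G.dist w z) =
      step R G p g (G.dist y z) := by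
  have hun : Finset.univ.filter (fun w => G.dist y w = 1) =
      (Finset.univ.filter fun w : X => G.dist y w = 1 ∧ G.dist w z + 1 = G.dist y z) ∪
      (Finset.univ.filter fun w : X => G.dist y w = 1 ∧ G.dist w z = G.dist y z + 1) := by
    ext w
    simp only [Finset.mem_filter, Finset.mem_univ, true_and, Finset.mem_union]
    constructor
    · intro h
      rcases dist_step hG.connected hbip h z with h' | h' <;> tauto
    · tauto
  have hdis : Disjoint
      (Finset.univ.filter fun w : X => G.dist y w = 1 ∧ G.dist w z + 1 = G.dist y z)
      (Finset.univ.filter fun w : X => G.dist y w = 1 ∧ G.dist w z = G.dist y z + 1) := by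
    rw [Finset.disjoint_left]
    intro w h1 h2
    simp only [Finset.mem_filter, Finset.mem_univ, true_and] at h1 h2
    omega
  rw [hun, Finset.sum_union hdis, step, ← card_up hG hD, ← card_down hG hD]
  congr 1
  · rw [← nsmul_eq_mul]
    refine Finset.sum_eq_card_nsmul fun w hw => ?_
    simp only [Finset.mem_filter, Finset.mem_univ, true_and] at hw
    congr 1; omega
  · rw [← nsmul_eq_mul]
    refine Finset.sum_eq_card_nsmul fun w hw => ?_
    simp only [Finset.mem_filter, Finset.mem_univ, true_and] at hw
    congr 1; omega

lemma distMatrix_mulVec_apply (i : ℕ) (v : X → R) (y : X) :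
    (distMatrix R G i *ᵥ v) y = ∑ z ∈ Finset.univ.filter (fun z => G.dist y z = i), v z := by
  simp [mulVec, dotProduct, distMatrix, Finset.sum_filter]

lemma distMatrix_one_mul_radial (hG : IsDistanceRegularWith G p) (hbip : G.IsBipartite)
    (hD : 1 ≤ G.diam) (g : ℕ → R) :
    distMatrix R G 1 * radial G g = radial G (step R G p g) := by
  ext y z
  rw [radial_apply, ← sum_neighbors hG hbip hD, mul_apply, Finset.sum_filter]
  simp [distMatrix]

lemma distMatrix_one_mulVec_dist (hG : IsDistanceRegularWith G p) (hbip : G.IsBipartite)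
    (hD : 1 ≤ G.diam) (g : ℕ → R) (x : X) :
    distMatrix R G 1 *ᵥ (fun y => g (G.dist x y)) = fun y => step R G p g (G.dist x y) := by
  ext y
  rw [distMatrix_mulVec_apply, G.dist_comm (u := x), ← sum_neighbors hG hbip hD]
  exact Finset.sum_congr rfl fun w _ => by rw [G.dist_comm]

end Step

lemma bNum_add_cNum (hG : IsDistanceRegularWith G p) (hbip : G.IsBipartite) (hD : 1 ≤ G.diam)
    {i : ℕ} (hi : i ≤ G.diam) : cNum G p i + bNum G p i = p 0 1 1 := by
  obtain ⟨y, z, rfl⟩ := exists_pair_dist_eq hG.connected hi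
  have := sum_neighbors (R := ℕ) hG hbip hD (fun _ => 1) y z
  simp only [Finset.sum_const, smul_eq_mul, mul_one, step, Nat.cast_id] at this
  rw [← this, card_dist_eq hG hD]

/-! ### The spectrum of the adjacency matrix -/

section DistPoly

variable {R : Type*} [CommRing R]

lemma distMatrix_zero (hc : G.Connected) : distMatrix R G 0 = 1 := by
  ext y z
  simp [distMatrix, hc.dist_eq_zero_iff, one_apply]

/-- The usual three-term recurrence, without its middle term because the graph is bipartite. For `m
+ 1 = D` the last term is zero as well, which produces an annihilating polynomial of degree `D + 1`.
-/
lemma distMatrix_one_mul_distMatrix (hG : IsDistanceRegularWith G p) (hbip : G.IsBipartite)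
    (hD : 1 ≤ G.diam) (m : ℕ) :
    distMatrix R G 1 * distMatrix R G (m + 1) =
      (bNum G p m : R) • distMatrix R G m + (cNum G p (m + 2) : R) • distMatrix R G (m + 2) := by
  rw [distMatrix_eq_radial (m + 1), distMatrix_one_mul_radial hG hbip hD, distMatrix_eq_radial m,
    distMatrix_eq_radial (m + 2), radial_smul, radial_smul, radial_add]
  refine radial_congr hG.connected fun i hi => ?_
  simp only [step, Pi.add_apply, Pi.smul_apply, smul_eq_mul]
  rcases Nat.lt_trichotomy i m with h | h | h
  · rw [if_neg (by omega), if_neg (by omega), if_neg (by omega), if_neg (by omega)]; simp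
  · subst h
    rw [if_neg (by omega), if_pos (by omega), if_pos rfl, if_neg (by omega)]; simp
  · rcases Nat.lt_trichotomy i (m + 2) with h' | h' | h'
    · rw [if_neg (by omega), if_neg (by omega), if_neg (by omega), if_neg (by omega)]; simp
    · subst h'
      rw [if_pos (by omega), if_neg (by omega), if_neg (by omega), if_pos rfl]; simp
    · rw [if_neg (by omega), if_neg (by omega), if_neg (by omega), if_neg (by omega)]; simp

end DistPoly

open Polynomial in
lemma exists_polynomial_distMatrix (hG : IsDistanceRegularWith G p) (hbip : G.IsBipartite)
    (m : ℕ) (hm : m + 1 ≤ G.diam) :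
    (∃ q : ℝ[X], q.natDegree = m ∧ aeval (distMatrix ℝ G 1) q = distMatrix ℝ G m) ∧
    (∃ q : ℝ[X], q.natDegree = m + 1 ∧ aeval (distMatrix ℝ G 1) q = distMatrix ℝ G (m + 1)) := by
  induction m with
  | zero =>
    exact ⟨⟨1, by simp, by simp [distMatrix_zero hG.connected]⟩, ⟨Polynomial.X, by simp, by simp⟩⟩
  | succ m ih =>
    obtain ⟨⟨q, hq, hq'⟩, ⟨r, hr, hr'⟩⟩ := ih (by omega)
    refine ⟨⟨r, hr, hr'⟩, ?_⟩
    have hc : (cNum G p (m + 2) : ℝ) ≠ 0 := by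
      have := cNum_pos hG (i := m + 2) (by omega) (by omega)
      positivity
    refine ⟨C ((cNum G p (m + 2) : ℝ)⁻¹) * (Polynomial.X * r - C (bNum G p m : ℝ) * q), ?_, ?_⟩
    · rw [natDegree_C_mul (inv_ne_zero hc), natDegree_sub_eq_left_of_natDegree_lt]
      · rw [natDegree_X_mul (by rintro rfl; simp at hr), hr]
      · rw [natDegree_X_mul (by rintro rfl; simp at hr), hr]
        exact (natDegree_C_mul_le _ _).trans_lt (by omega)
    · simp only [map_mul, map_sub, aeval_X, hr', hq', aeval_C,
        distMatrix_one_mul_distMatrix hG hbip (by omega : 1 ≤ G.diam), Algebra.algebraMap_eq_smul_one,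
        smul_mul_assoc, one_mul, add_sub_cancel_left, smul_smul, inv_mul_cancel₀ hc, one_smul]

open Polynomial in
lemma exists_annihilating_polynomial (hG : IsDistanceRegularWith G p) (hbip : G.IsBipartite)
    (hD : 1 ≤ G.diam) :
    ∃ q : ℝ[X], q.natDegree = G.diam + 1 ∧ aeval (distMatrix ℝ G 1) q = 0 := by
  obtain ⟨m, hm⟩ : ∃ m, G.diam = m + 1 := ⟨G.diam - 1, by omega⟩
  obtain ⟨⟨q, hq, hq'⟩, ⟨r, hr, hr'⟩⟩ := exists_polynomial_distMatrix hG hbip m hm.ge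
  refine ⟨Polynomial.X * r - C (bNum G p m : ℝ) * q, ?_, ?_⟩
  · rw [natDegree_sub_eq_left_of_natDegree_lt]
    · rw [natDegree_X_mul (by rintro rfl; simp at hr), hr, hm]
    · rw [natDegree_X_mul (by rintro rfl; simp at hr), hr]
      exact (natDegree_C_mul_le _ _).trans_lt (by omega)
  · have hc : cNum G p (m + 2) = 0 := by simp [cNum, hm]
    simp only [map_sub, map_mul, aeval_X, aeval_C, hr', hq',
      distMatrix_one_mul_distMatrix hG hbip hD, hc, Algebra.algebraMap_eq_smul_one, smul_mul_assoc,
      one_mul, Nat.cast_zero, zero_smul, add_zero, sub_self]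

lemma distMatrix_isHermitian (i : ℕ) : (distMatrix ℝ G i).IsHermitian := by
  ext y z
  simp [distMatrix, G.dist_comm (u := z)]

/-- The set of eigenvalues of the adjacency matrix. -/
def spec (G : SimpleGraph X) : Finset ℝ := (distMatrix ℝ G 1).charpoly.roots.toFinset

lemma mem_spec {s : ℝ} : s ∈ spec G ↔ ∃ w : X → ℝ, w ≠ 0 ∧ distMatrix ℝ G 1 *ᵥ w = s • w := by
  rw [spec, Multiset.mem_toFinset, Polynomial.mem_roots (charpoly_monic _).ne_zero,
    Polynomial.IsRoot.def, eval_charpoly, ← exists_mulVec_eq_zero_iff]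
  refine exists_congr fun w => and_congr_right fun _ => ?_
  rw [sub_mulVec, sub_eq_zero, eq_comm, scalar_apply, ← smul_one_eq_diagonal, smul_mulVec,
    one_mulVec]

lemma eigenvalues_mem_spec (j : X) :
    (distMatrix_isHermitian (G := G) 1).eigenvalues j ∈ spec G := by
  rw [mem_spec]
  refine ⟨_, ?_, (distMatrix_isHermitian (G := G) 1).mulVec_eigenvectorBasis j⟩
  intro h
  apply (distMatrix_isHermitian (G := G) 1).eigenvectorBasis.orthonormal.ne_zero j
  ext i
  exact congrFun h i

lemma aeval_mulVec_of_eigenvector {A : Matrix X X ℝ} {w : X → ℝ} {s : ℝ} (h : A *ᵥ w = s • w)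
    (q : Polynomial ℝ) : Polynomial.aeval A q *ᵥ w = q.eval s • w := by
  induction q using Polynomial.induction_on' with
  | add f g hf hg => simp [add_mulVec, hf, hg, add_smul]
  | monomial n a =>
    have hn : ∀ n : ℕ, A ^ n *ᵥ w = s ^ n • w := by
      intro n
      induction n with
      | zero => simp
      | succ n ih => rw [pow_succ, ← mulVec_mulVec, h, mulVec_smul, ih, smul_smul, pow_succ']
    rw [Polynomial.aeval_monomial, ← mulVec_mulVec, hn, Algebra.algebraMap_eq_smul_one, smul_mulVec,
      one_mulVec, smul_smul, Polynomial.eval_monomial]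

lemma dotProduct_self_eq_sum {A : Matrix X X ℝ} (hA : A.IsHermitian) (f : X → ℝ) :
    f ⬝ᵥ f = ∑ j, (⇑(hA.eigenvectorBasis j) ⬝ᵥ f) ^ 2 := by
  have h := hA.eigenvectorBasis.sum_sq_norm_inner_right (WithLp.toLp 2 f)
  have h1 : ∀ g : X → ℝ, ∀ j, inner ℝ (hA.eigenvectorBasis j) (WithLp.toLp 2 g) =
      ⇑(hA.eigenvectorBasis j) ⬝ᵥ g := by
    intro g j
    simp [PiLp.inner_apply, dotProduct, mul_comm]
  simp only [h1, EuclideanSpace.norm_sq_eq, Real.norm_eq_abs, sq_abs] at h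
  rw [h]
  simp [dotProduct, sq]

lemma dotProduct_mulVec_eigenvector {A : Matrix X X ℝ} (hA : A.IsHermitian) (f : X → ℝ) (j : X) :
    ⇑(hA.eigenvectorBasis j) ⬝ᵥ (A *ᵥ f) = hA.eigenvalues j * (⇑(hA.eigenvectorBasis j) ⬝ᵥ f) := by
  rw [dotProduct_mulVec, ← mulVec_transpose]
  have : Aᵀ = A := by simpa using! hA
  rw [this, hA.mulVec_eigenvectorBasis, smul_dotProduct, smul_eq_mul]

open Polynomial in
-- The polynomial kills an orthonormal eigenbasis of `A`; each row of its value is therefore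
-- orthogonal to the basis, and vanishes by Parseval.
lemma aeval_prod_spec_eq_zero :
    aeval (distMatrix ℝ G 1) (∏ s ∈ spec G, (Polynomial.X - C s)) = 0 := by
  set hA := distMatrix_isHermitian (G := G) 1
  set M := aeval (distMatrix ℝ G 1) (∏ s ∈ spec G, (Polynomial.X - C s)) with hM
  have h0 : ∀ j, M *ᵥ ⇑(hA.eigenvectorBasis j) = 0 := by
    intro j
    rw [hM, aeval_mulVec_of_eigenvector (hA.mulVec_eigenvectorBasis j), eval_prod,
      Finset.prod_eq_zero (eigenvalues_mem_spec j) (by simp), zero_smul]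
  ext y z
  have h1 : (M y) ⬝ᵥ (M y) = 0 := by
    rw [dotProduct_self_eq_sum hA]
    refine Finset.sum_eq_zero fun j _ => ?_
    rw [dotProduct_comm]
    have := congrFun (h0 j) y
    simp only [mulVec, Pi.zero_apply] at this
    rw [this]; simp
  exact congrFun (dotProduct_self_eq_zero.1 h1) z

open Polynomial in
-- Look at an entry whose two vertices are at distance equal to the degree: lower powers of `A`
-- contribute nothing, and the leading power counts walks of that length, a geodesic among them.
lemma aeval_ne_zero_of_monic (hc : G.Connected) {q : ℝ[X]} (hq : q.Monic)
    (hd : q.natDegree ≤ G.diam) : aeval (distMatrix ℝ G 1) q ≠ 0 := by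
  classical
  obtain ⟨y, z, hyz⟩ := exists_pair_dist_eq hc hd
  intro h0
  have h1 := congrFun (congrFun h0 y) z
  have hadj : distMatrix ℝ G 1 = G.adjMatrix ℝ := by
    ext a b
    simp [distMatrix, SimpleGraph.adjMatrix_apply, SimpleGraph.dist_eq_one_iff_adj]
  rw [aeval_eq_sum_range, Matrix.sum_apply, Finset.sum_range_succ,
    Finset.sum_eq_zero, zero_add, hq.coeff_natDegree, one_smul, hadj,
    SimpleGraph.adjMatrix_pow_apply_eq_card_walk] at h1
  · obtain ⟨w, hw⟩ := hc.exists_walk_length_eq_dist y z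
    simp only [Matrix.zero_apply, Nat.cast_eq_zero, Fintype.card_eq_zero_iff] at h1
    exact h1.false ⟨w, by simpa [hyz] using hw⟩
  · intro i hi
    rw [Finset.mem_range] at hi
    rw [hadj, Matrix.smul_apply, SimpleGraph.adjMatrix_pow_apply_eq_card_walk]
    have : IsEmpty {w : G.Walk y z | w.length = i} := by
      refine ⟨fun ⟨w, hw⟩ => ?_⟩
      have := SimpleGraph.dist_le w
      have hw' : w.length = i := hw
      omega
    simp

/-- Some polynomial of degree `D + 1` annihilates `A`, hence vanishes at all eigenvalues; conversely
the product of the factors `X - s` annihilates `A`, so its degree exceeds `D`. -/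
lemma card_spec (hG : IsDistanceRegularWith G p) (hbip : G.IsBipartite) (hD : 1 ≤ G.diam) :
    (spec G).card = G.diam + 1 := by
  apply le_antisymm
  · obtain ⟨q, hq, hq'⟩ := exists_annihilating_polynomial hG hbip hD
    have hq0 : q ≠ 0 := by rintro rfl; simp at hq
    rw [← hq]
    refine Polynomial.card_le_degree_of_subset_roots (p := q) ?_
    intro s hs
    obtain ⟨w, hw, hw'⟩ := mem_spec.1 (Finset.mem_def.2 hs)
    rw [Polynomial.mem_roots hq0, Polynomial.IsRoot.def]
    have := aeval_mulVec_of_eigenvector hw' q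
    rw [hq', zero_mulVec, eq_comm, smul_eq_zero] at this
    exact this.resolve_right hw
  · by_contra! h
    refine aeval_ne_zero_of_monic hG.connected
      (Polynomial.monic_prod_of_monic (spec G) _ fun s _ => Polynomial.monic_X_sub_C s) ?_
      aeval_prod_spec_eq_zero
    rw [Polynomial.natDegree_prod_of_monic _ _ fun s _ => Polynomial.monic_X_sub_C s]
    simp only [Polynomial.natDegree_X_sub_C, Finset.sum_const, smul_eq_mul, mul_one]
    omega

/-- The sign vector of the two colour classes. -/
def signVec (G : SimpleGraph X) (x y : X) : ℝ := (-1) ^ G.dist x y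

lemma signVec_mul_self (x y : X) : signVec G x y * signVec G x y = 1 := by
  rw [signVec, ← mul_pow]; simp

/-- Adjacent vertices carry opposite signs, so conjugation by the sign vector turns `A` into `-A`.
This makes the spectrum symmetric about zero. -/
lemma mulVec_signVec_mul (hc : G.Connected) (hbip : G.IsBipartite) (x : X) (w : X → ℝ) :
    distMatrix ℝ G 1 *ᵥ (fun y => signVec G x y * w y) =
      fun y => - (signVec G x y * (distMatrix ℝ G 1 *ᵥ w) y) := by
  ext y
  rw [distMatrix_mulVec_apply, distMatrix_mulVec_apply, Finset.mul_sum, ← Finset.sum_neg_distrib]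
  refine Finset.sum_congr rfl fun z hz => ?_
  rw [Finset.mem_filter] at hz
  have := dist_step hc hbip hz.2 x
  rw [G.dist_comm (u := z), G.dist_comm (u := y)] at this
  rcases this with h | h
  · simp only [signVec, h, pow_succ]; ring
  · simp only [signVec, ← h, pow_succ]; ring

lemma neg_mem_spec (hc : G.Connected) (hbip : G.IsBipartite) {s : ℝ} (hs : s ∈ spec G) :
    -s ∈ spec G := by
  have := hc.nonempty
  obtain ⟨x⟩ := this
  obtain ⟨w, hw, hw'⟩ := mem_spec.1 hs
  refine mem_spec.2 ⟨fun y => signVec G x y * w y, ?_, ?_⟩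
  · intro h
    apply hw
    ext y
    have h1 := congrFun h y
    have h2 := signVec_mul_self (G := G) x y
    simp only [Pi.zero_apply, mul_eq_zero] at h1
    rcases h1 with h1 | h1
    · rw [h1] at h2; simp at h2
    · exact h1
  · rw [mulVec_signVec_mul hc hbip, hw']
    ext y
    simp only [Pi.smul_apply, smul_eq_mul]
    ring

/-! ### The valency as the largest eigenvalue, through the Laplacian. -/

section Laplacian

open Classical in
lemma lapMatrix_mulVec_eq (hG : IsDistanceRegularWith G p) (hD : 1 ≤ G.diam) (w : X → ℝ) :
    G.lapMatrix ℝ *ᵥ w = (p 0 1 1 : ℝ) • w - distMatrix ℝ G 1 *ᵥ w := by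
  ext y
  have hn : G.neighborFinset y = Finset.univ.filter (fun z => G.dist y z = 1) := by
    ext z
    simp [SimpleGraph.dist_eq_one_iff_adj]
  rw [SimpleGraph.lapMatrix_mulVec_apply, Pi.sub_apply, distMatrix_mulVec_apply,
    ← SimpleGraph.card_neighborFinset_eq_degree, hn, card_dist_eq hG hD]
  simp

lemma le_valency_of_mem_spec (hG : IsDistanceRegularWith G p) (hD : 1 ≤ G.diam) {s : ℝ}
    (hs : s ∈ spec G) : s ≤ p 0 1 1 := by
  classical
  obtain ⟨w, hw, hw'⟩ := mem_spec.1 hs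
  have h1 := (SimpleGraph.posSemidef_lapMatrix ℝ G).dotProduct_mulVec_nonneg w
  rw [lapMatrix_mulVec_eq hG hD, hw', ← sub_smul, dotProduct_smul, star_trivial, smul_eq_mul] at h1
  have h2 : 0 < w ⬝ᵥ w := by
    have := dotProduct_star_self_pos_iff.2 hw
    simpa using this
  by_contra! h
  nlinarith

/-- Such a vector lies in the kernel of the Laplacian, so connectedness makes it constant. -/
lemma eigenvector_valency_const (hG : IsDistanceRegularWith G p) (hD : 1 ≤ G.diam) {w : X → ℝ}
    (hw : distMatrix ℝ G 1 *ᵥ w = (p 0 1 1 : ℝ) • w) (y z : X) : w y = w z := by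
  classical
  refine (SimpleGraph.lapMatrix_mulVec_eq_zero_iff_forall_reachable G (x := w)).1 ?_ y z
    (hG.connected y z)
  rw [lapMatrix_mulVec_eq hG hD, hw, sub_self]

lemma valency_mem_spec (hG : IsDistanceRegularWith G p) (hD : 1 ≤ G.diam) :
    (p 0 1 1 : ℝ) ∈ spec G := by
  have := hG.connected.nonempty
  refine mem_spec.2 ⟨fun _ => 1, fun h => ?_, ?_⟩
  · obtain ⟨x⟩ := this
    simpa using congrFun h x
  · ext y
    rw [distMatrix_mulVec_apply]
    simp [card_dist_eq hG hD]

end Laplacian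

/-- Expand `f` in an eigenbasis: orthogonality to the constants and to the sign vector removes the
eigenvalues `k` and `-k`, and every other squared eigenvalue is at most `t²`. -/
lemma mulVec_dotProduct_mulVec_le (hG : IsDistanceRegularWith G p) (hbip : G.IsBipartite)
    (hD : 1 ≤ G.diam) {t : ℝ}
    (ht : ∀ s ∈ spec G, s ≠ p 0 1 1 → s ≠ -p 0 1 1 → s ^ 2 ≤ t ^ 2) (x : X) (f : X → ℝ)
    (h1 : ∑ y, f y = 0) (h2 : ∑ y, signVec G x y * f y = 0) :
    (distMatrix ℝ G 1 *ᵥ f) ⬝ᵥ (distMatrix ℝ G 1 *ᵥ f) ≤ t ^ 2 * (f ⬝ᵥ f) := by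
  set hA := distMatrix_isHermitian (G := G) 1
  rw [dotProduct_self_eq_sum hA, dotProduct_self_eq_sum hA f, Finset.mul_sum]
  refine Finset.sum_le_sum fun j _ => ?_
  rw [dotProduct_mulVec_eigenvector, mul_pow]
  have hev := hA.mulVec_eigenvectorBasis j
  by_cases hk : hA.eigenvalues j = p 0 1 1
  · have hz : ⇑(hA.eigenvectorBasis j) ⬝ᵥ f = 0 := by
      rw [hk] at hev
      have := eigenvector_valency_const hG hD hev
      simp only [dotProduct]
      rw [Finset.sum_congr rfl fun y _ => by rw [this y x], ← Finset.mul_sum, h1, mul_zero]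
    rw [hz]; simp
  by_cases hk' : hA.eigenvalues j = -p 0 1 1
  · have hz : ⇑(hA.eigenvectorBasis j) ⬝ᵥ f = 0 := by
      rw [hk'] at hev
      have h3 := mulVec_signVec_mul hG.connected hbip x (hA.eigenvectorBasis j)
      -- Twisting by signs turns an eigenvector for `-k` into one for `k`, which is constant; so the
      -- original is a multiple of the sign vector.
      have h4 := eigenvector_valency_const hG hD
        (w := fun y => signVec G x y * hA.eigenvectorBasis j y) (by
          rw [h3, hev]; ext y; simp only [Pi.smul_apply, smul_eq_mul]; ring)
      have h5 : ∀ y, hA.eigenvectorBasis j y =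
          (signVec G x x * hA.eigenvectorBasis j x) * signVec G x y := by
        intro y
        rw [h4 x y, mul_right_comm, signVec_mul_self, one_mul]
      simp only [dotProduct]
      rw [Finset.sum_congr rfl fun y _ => by rw [h5 y, mul_assoc], ← Finset.mul_sum, h2, mul_zero]
    rw [hz]; simp
  · exact mul_le_mul_of_nonneg_right (ht _ (eigenvalues_mem_spec j) hk hk') (sq_nonneg _)

lemma le_mulVec_dotProduct_mulVec {t : ℝ} (ht : ∀ s ∈ spec G, t ^ 2 ≤ s ^ 2) (f : X → ℝ) :
    t ^ 2 * (f ⬝ᵥ f) ≤ (distMatrix ℝ G 1 *ᵥ f) ⬝ᵥ (distMatrix ℝ G 1 *ᵥ f) := by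
  set hA := distMatrix_isHermitian (G := G) 1
  rw [dotProduct_self_eq_sum hA, dotProduct_self_eq_sum hA (_ *ᵥ _), Finset.mul_sum]
  refine Finset.sum_le_sum fun j _ => ?_
  rw [dotProduct_mulVec_eigenvector, mul_pow]
  exact mul_le_mul_of_nonneg_right (ht _ (eigenvalues_mem_spec j)) (sq_nonneg _)

/-! ### Cosine sequences -/

/-- `u` is the cosine sequence of the eigenvalue `θ`. -/
structure IsCosine (G : SimpleGraph X) (p : ℕ → ℕ → ℕ → ℕ) (θ : ℝ) (u : ℕ → ℝ) : Prop where
  zero : u 0 = 1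
  step_eq : ∀ i ≤ G.diam, step ℝ G p u i = θ * u i

lemma exists_aeval_eq_radial (hG : IsDistanceRegularWith G p) (hbip : G.IsBipartite)
    (hD : 1 ≤ G.diam) (q : Polynomial ℝ) :
    ∃ g : ℕ → ℝ, Polynomial.aeval (distMatrix ℝ G 1) q = radial G g := by
  induction q using Polynomial.induction_on with
  | C a =>
    refine ⟨a • fun j => if j = 0 then 1 else 0, ?_⟩
    rw [← radial_smul, ← distMatrix_eq_radial, distMatrix_zero hG.connected, Polynomial.aeval_C,
      Algebra.algebraMap_eq_smul_one]
  | add f g hf hg =>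
    obtain ⟨a, ha⟩ := hf
    obtain ⟨b, hb⟩ := hg
    exact ⟨a + b, by rw [map_add, ha, hb, radial_add]⟩
  | monomial n a ih =>
    obtain ⟨g, hg⟩ := ih
    refine ⟨step ℝ G p g, ?_⟩
    rw [pow_succ', mul_left_comm, map_mul, Polynomial.aeval_X, hg,
      distMatrix_one_mul_radial hG hbip hD]

/-- Write the minimal polynomial of `A` as `(X - θ) q`. Then `q(A)` is a nonzero radial matrix
killed by `A - θ`, so its profile `g` satisfies the recurrence. If `g 0` were zero, the recurrence
(with `b_i ≠ 0`) would make `g` vanish up to the diameter; hence `g` can be scaled to start at 1. -/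
lemma exists_isCosine (hG : IsDistanceRegularWith G p) (hbip : G.IsBipartite) (hD : 1 ≤ G.diam)
    {θ : ℝ} (hθ : θ ∈ spec G) : ∃ u, IsCosine G p θ u := by
  set A := distMatrix ℝ G 1 with hA
  obtain ⟨w, hw, hw'⟩ := mem_spec.1 hθ
  have hroot : (minpoly ℝ A).IsRoot θ := by
    have h := aeval_mulVec_of_eigenvector hw' (minpoly ℝ A)
    rw [minpoly.aeval, zero_mulVec, eq_comm, smul_eq_zero] at h
    exact h.resolve_right hw
  obtain ⟨q, hq⟩ := Polynomial.dvd_iff_isRoot.2 hroot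
  have hint : IsIntegral ℝ A := IsIntegral.of_finite ℝ A
  have hq0 : q ≠ 0 := by
    rintro rfl
    exact minpoly.ne_zero hint (by simpa using hq)
  have hne : Polynomial.aeval A q ≠ 0 := by
    intro h
    have h1 := Polynomial.natDegree_le_of_dvd (minpoly.dvd ℝ A h) hq0
    rw [hq, Polynomial.natDegree_mul (Polynomial.X_sub_C_ne_zero θ) hq0,
      Polynomial.natDegree_X_sub_C] at h1
    omega
  obtain ⟨g, hg⟩ := exists_aeval_eq_radial hG hbip hD q
  have hstep : ∀ i ≤ G.diam, step ℝ G p g i = θ * g i := by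
    have h1 : (A - algebraMap ℝ _ θ) * radial G g = 0 := by
      rw [← hg]
      have := congrArg (Polynomial.aeval A) hq
      rw [minpoly.aeval, map_mul, map_sub, Polynomial.aeval_X, Polynomial.aeval_C] at this
      exact this.symm
    rw [sub_mul, sub_eq_zero, hA, distMatrix_one_mul_radial hG hbip hD,
      Algebra.algebraMap_eq_smul_one, smul_mul_assoc, one_mul, radial_smul] at h1
    intro i hi
    obtain ⟨y, z, rfl⟩ := exists_pair_dist_eq hG.connected hi
    exact congrFun (congrFun h1 y) z
  have hg0 : g 0 ≠ 0 := by
    intro h0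
    apply hne
    have hall : ∀ n, ∀ i ≤ n, i ≤ G.diam → g i = 0 := by
      intro n
      induction n with
      | zero => intro i hi _; obtain rfl : i = 0 := by omega
                exact h0
      | succ n ih =>
        intro i hi hiD
        rcases Nat.lt_or_ge i (n + 1) with h | h
        · exact ih i (by omega) hiD
        · obtain rfl : i = n + 1 := by omega
          have h1 := hstep n (by omega)
          have hb := bNum_pos hG (i := n) (by omega)
          rw [step, ih n le_rfl (by omega), ih (n - 1) (by omega) (by omega)] at h1
          simp only [mul_zero, zero_add, mul_eq_zero, Nat.cast_eq_zero] at h1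
          exact h1.resolve_left hb.ne'
    rw [hg, radial_congr hG.connected (g := 0) fun i hi => hall i i le_rfl hi]
    rfl
  refine ⟨fun i => (g 0)⁻¹ * g i, by simp [hg0], fun i hi => ?_⟩
  have := hstep i hi
  simp only [step] at this ⊢
  linear_combination (g 0)⁻¹ * this

namespace IsCosine

variable {θ : ℝ} {u : ℕ → ℝ}

lemma not_both_zero (hu : IsCosine G p θ u) (hG : IsDistanceRegularWith G p) {j : ℕ}
    (hj : j + 1 ≤ G.diam) : ¬ (u j = 0 ∧ u (j + 1) = 0) := by
  induction j with
  | zero => rintro ⟨h, -⟩; rw [hu.zero] at h; simp at h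
  | succ j ih =>
    rintro ⟨h1, h2⟩
    refine ih (by omega) ⟨?_, h1⟩
    have h := hu.step_eq (j + 1) (by omega)
    have hc := cNum_pos hG (i := j + 1) (by omega) (by omega)
    rw [step, h1, h2] at h
    simp only [mul_zero, add_zero, mul_eq_zero, Nat.cast_eq_zero, Nat.add_sub_cancel] at h
    exact h.resolve_left hc.ne'

/-- With equal outer values the recurrence at `j + 1` collapses, because `c_{j+1} + b_{j+1} = k`. -/
lemma mul_apply_middle (hu : IsCosine G p θ u) (hG : IsDistanceRegularWith G p)
    (hbip : G.IsBipartite) {j : ℕ} (hj : j + 2 ≤ G.diam) (h : u j = u (j + 2)) :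
    θ * u (j + 1) = p 0 1 1 * u j := by
  have h1 := hu.step_eq (j + 1) (by omega)
  have h2 := bNum_add_cNum hG hbip (by omega) (i := j + 1) (by omega)
  rw [← h1, step, ← h2, Nat.add_sub_cancel, ← h]
  push_cast; ring

lemma apply_ne_zero (hu : IsCosine G p θ u) (hG : IsDistanceRegularWith G p)
    (hbip : G.IsBipartite) (hθ : θ ≠ 0) {j : ℕ} (hj : j + 2 ≤ G.diam) (h : u j = u (j + 2)) :
    u j ≠ 0 := by
  intro h0
  have := hu.mul_apply_middle hG hbip hj h
  rw [h0, mul_zero] at this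
  exact hu.not_both_zero hG (by omega) ⟨h0, (mul_eq_zero.1 this).resolve_left hθ⟩

end IsCosine

lemma distMatrix_mulVec_dotProduct (i : ℕ) (f g : X → ℝ) :
    (distMatrix ℝ G i *ᵥ f) ⬝ᵥ g = f ⬝ᵥ (distMatrix ℝ G i *ᵥ g) := by
  have : (distMatrix ℝ G i)ᵀ = distMatrix ℝ G i := by
    rw [distMatrix_eq_radial, radial_transpose]
  rw [dotProduct_mulVec, ← mulVec_transpose, this]

lemma distMatrix_one_mulVec_dist' (hG : IsDistanceRegularWith G p) (hbip : G.IsBipartite)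
    (hD : 1 ≤ G.diam) {f g : ℕ → ℝ} (h : ∀ i ≤ G.diam, step ℝ G p f i = g i) (x : X) :
    distMatrix ℝ G 1 *ᵥ (fun y => f (G.dist x y)) = fun y => g (G.dist x y) := by
  rw [distMatrix_one_mulVec_dist hG hbip hD]
  ext y
  exact h _ (dist_le_diam' hG.connected x y)

/-- Suppose `u_j = u_{j+2} = c`. Then `u - c`, cut off beyond layer `j` on the colour class of layer
`j`, is almost an eigenvector of `A²` for `θ²`. Corrected to be orthogonal to the eigenvectors of
`k` and `-k`, it has Rayleigh quotient for `A²` above `θ²`, contrary to extremality. -/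
lemma IsCosine.ne_of_extremal_max {θ : ℝ} {u : ℕ → ℝ} (hu : IsCosine G p θ u)
    (hG : IsDistanceRegularWith G p) (hbip : G.IsBipartite) (hθ : θ ≠ 0)
    (hk : θ ^ 2 < (p 0 1 1 : ℝ) ^ 2)
    (ht : ∀ s ∈ spec G, s ≠ p 0 1 1 → s ≠ -p 0 1 1 → s ^ 2 ≤ θ ^ 2)
    {j : ℕ} (hj : j + 2 ≤ G.diam) : u j ≠ u (j + 2) := by
  intro heq
  have hD : 1 ≤ G.diam := by omega
  have hc0 := hu.apply_ne_zero hG hbip hθ hj heq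
  have hmid := hu.mul_apply_middle hG hbip hj heq
  set c := u j with hc
  set k : ℝ := ((p 0 1 1 : ℕ) : ℝ) with hkdef
  have hbc : ∀ i ≤ G.diam, (cNum G p i : ℝ) + bNum G p i = k := fun i hi => by
    rw [hkdef, ← bNum_add_cNum hG hbip hD hi]; push_cast; rfl
  have := hG.connected.nonempty
  obtain ⟨x⟩ := this
  -- `g1` and `g2` will be the profiles of `A g0` and `A² g0`. The cutoff costs nothing: `u j - c =
  -- 0` in layer `j` and `θ u (j + 1) - k c = 0` in layer `j + 1`.
  let g0 : ℕ → ℝ := fun i => if i % 2 = j % 2 ∧ i ≤ j then u i - c else 0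
  let g1 : ℕ → ℝ := fun i => if i % 2 ≠ j % 2 ∧ i ≤ j + 1 then θ * u i - k * c else 0
  let g2 : ℕ → ℝ := fun i => if i % 2 = j % 2 ∧ i ≤ j then θ ^ 2 * u i - k ^ 2 * c else 0
  -- `e0` is the indicator of the colour class of layer `j`, `e1` and `e2` its images under `A` and
  -- `A²`, and `l0` the indicator of the part of the class in layers up to `j`.
  let e0 : ℕ → ℝ := fun i => if i % 2 = j % 2 then 1 else 0
  let e1 : ℕ → ℝ := fun i => if i % 2 ≠ j % 2 then k else 0
  let e2 : ℕ → ℝ := fun i => if i % 2 = j % 2 then k ^ 2 else 0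
  let l0 : ℕ → ℝ := fun i => if i % 2 = j % 2 ∧ i ≤ j then 1 else 0
  have hs0 : ∀ i ≤ G.diam, step ℝ G p g0 i = g1 i := by
    intro i hi
    have hst := hu.step_eq i hi
    have hb := hbc i hi
    simp only [step, g0, g1] at hst ⊢
    rcases Nat.eq_zero_or_pos i with rfl | hpos
    · rw [cNum_zero, Nat.cast_zero, zero_mul, zero_add] at *
      by_cases h : (0 + 1) % 2 = j % 2
      · rw [if_pos (by omega), if_pos (by omega)]
        linear_combination hst - c * hb
      · rw [if_neg (by omega), if_neg (by omega), mul_zero]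
    · by_cases h : i % 2 = j % 2
      · rw [if_neg (by omega), if_neg (by omega), if_neg (by omega)]; simp
      · rcases Nat.lt_trichotomy i (j + 1) with h' | h' | h'
        · rw [if_pos (by omega), if_pos (by omega), if_pos (by omega)]
          linear_combination hst - c * hb
        · subst h'
          rw [if_pos (by omega), if_neg (by omega), if_pos (by omega), Nat.add_sub_cancel]
          linear_combination -hmid + (cNum G p (j + 1) : ℝ) * hc
        · rw [if_neg (by omega), if_neg (by omega), if_neg (by omega)]; simp
  have hs1 : ∀ i ≤ G.diam, step ℝ G p g1 i = g2 i := by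
    intro i hi
    have hst := hu.step_eq i hi
    have hb := hbc i hi
    simp only [step, g1, g2] at hst ⊢
    rcases Nat.eq_zero_or_pos i with rfl | hpos
    · rw [cNum_zero, Nat.cast_zero, zero_mul, zero_add] at *
      by_cases h : (0 + 1) % 2 ≠ j % 2
      · rw [if_pos (by omega), if_pos (by omega)]
        linear_combination θ * hst - k * c * hb
      · rw [if_neg (by omega), if_neg (by omega), mul_zero]
    · by_cases h : i % 2 ≠ j % 2
      · rw [if_neg (by omega), if_neg (by omega), if_neg (by omega)]; simp
      · rcases Nat.lt_trichotomy i (j + 2) with h' | h' | h'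
        · rw [if_pos (by omega), if_pos (by omega), if_pos (by omega)]
          linear_combination θ * hst - k * c * hb
        · subst h'
          rw [if_pos (by omega), if_neg (by omega), if_neg (by omega)]
          rw [show j + 2 - 1 = j + 1 by omega, hmid]; ring
        · rw [if_neg (by omega), if_neg (by omega), if_neg (by omega)]; simp
  have he0 : ∀ i ≤ G.diam, step ℝ G p e0 i = e1 i := by
    intro i hi
    have hb := hbc i hi
    simp only [step, e0, e1]
    rcases Nat.eq_zero_or_pos i with rfl | hpos
    · rw [cNum_zero, Nat.cast_zero, zero_mul, zero_add] at *
      by_cases h : (0 + 1) % 2 = j % 2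
      · rw [if_pos (by omega), if_pos (by omega), mul_one, hb]
      · rw [if_neg (by omega), if_neg (by omega), mul_zero]
    · by_cases h : i % 2 = j % 2
      · rw [if_neg (by omega), if_neg (by omega), if_neg (by omega)]; simp
      · rw [if_pos (by omega), if_pos (by omega), if_pos (by omega)]
        linear_combination hb
  have he1 : ∀ i ≤ G.diam, step ℝ G p e1 i = e2 i := by
    intro i hi
    have hb := hbc i hi
    simp only [step, e1, e2]
    rcases Nat.eq_zero_or_pos i with rfl | hpos
    · rw [cNum_zero, Nat.cast_zero, zero_mul, zero_add] at *
      by_cases h : (0 + 1) % 2 ≠ j % 2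
      · rw [if_pos (by omega), if_pos (by omega), hb]; ring
      · rw [if_neg (by omega), if_neg (by omega), mul_zero]
    · by_cases h : i % 2 ≠ j % 2
      · rw [if_neg (by omega), if_neg (by omega), if_neg (by omega)]; simp
      · rw [if_pos (by omega), if_pos (by omega), if_pos (by omega)]
        linear_combination k * hb
  let vec : (ℕ → ℝ) → X → ℝ := fun g y => g (G.dist x y)
  set A := distMatrix ℝ G 1 with hAdef
  have hAg : A *ᵥ (A *ᵥ vec g0) = θ ^ 2 • vec g0 - ((k ^ 2 - θ ^ 2) * c) • vec l0 := by
    have h1 : A *ᵥ vec g0 = vec g1 := distMatrix_one_mulVec_dist' hG hbip hD hs0 x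
    have h2 : A *ᵥ vec g1 = vec g2 := distMatrix_one_mulVec_dist' hG hbip hD hs1 x
    rw [h1, h2]
    ext y
    simp only [vec, g0, g2, l0, Pi.sub_apply, Pi.smul_apply, smul_eq_mul]
    split_ifs
    · ring
    · simp
  have hAe : A *ᵥ (A *ᵥ vec e0) = k ^ 2 • vec e0 := by
    have h1 : A *ᵥ vec e0 = vec e1 := distMatrix_one_mulVec_dist' hG hbip hD he0 x
    have h2 : A *ᵥ vec e1 = vec e2 := distMatrix_one_mulVec_dist' hG hbip hD he1 x
    rw [h1, h2]
    ext y
    simp only [vec, e0, e2, Pi.smul_apply, smul_eq_mul]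
    split_ifs <;> simp
  set KL := vec l0 ⬝ᵥ vec e0 with hKL
  set K := vec e0 ⬝ᵥ vec e0 with hK
  have hsplit : K = KL + ∑ y, (if G.dist x y % 2 = j % 2 ∧ ¬ G.dist x y ≤ j then (1 : ℝ) else 0) := by
    simp only [hK, hKL, dotProduct, ← Finset.sum_add_distrib]
    refine Finset.sum_congr rfl fun y _ => ?_
    simp only [vec, e0, l0]
    by_cases h1 : G.dist x y % 2 = j % 2 <;> by_cases h2 : G.dist x y ≤ j <;> simp [h1, h2]
  have hKLpos : 0 < KL := by
    obtain ⟨y, hy⟩ := exists_dist_eq hG x (h := j) (by omega)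
    refine Finset.sum_pos' (fun z _ => ?_) ⟨y, Finset.mem_univ _, ?_⟩
    · simp only [vec, e0, l0]; split_ifs <;> norm_num
    · simp [vec, e0, l0, hy]
  have hKpos : KL < K := by
    obtain ⟨y, hy⟩ := exists_dist_eq hG x hj
    rw [hsplit, lt_add_iff_pos_right]
    refine Finset.sum_pos' (fun z _ => ?_) ⟨y, Finset.mem_univ _, ?_⟩
    · split_ifs <;> norm_num
    · simp [hy]
  have hll : vec l0 ⬝ᵥ vec l0 = KL := by
    refine Finset.sum_congr rfl fun y _ => ?_
    simp only [vec, e0, l0]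
    split_ifs <;> simp_all
  have hgl : vec g0 ⬝ᵥ vec l0 = vec g0 ⬝ᵥ vec e0 := by
    refine Finset.sum_congr rfl fun y _ => ?_
    simp only [vec, e0, l0, g0]
    split_ifs <;> simp_all
  -- Move `A²` across the pairing with `e0`, where it acts as `k²`, and compare with `hAg`; the
  -- factor `k² - θ²` cancels.
  have hge : vec g0 ⬝ᵥ vec e0 = -c * KL := by
    have h1 : (A *ᵥ (A *ᵥ vec g0)) ⬝ᵥ vec e0 = vec g0 ⬝ᵥ (A *ᵥ (A *ᵥ vec e0)) := by
      rw [hAdef, distMatrix_mulVec_dotProduct, distMatrix_mulVec_dotProduct]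
    rw [hAg, hAe, sub_dotProduct, smul_dotProduct, smul_dotProduct, dotProduct_smul] at h1
    simp only [smul_eq_mul] at h1
    have h2 : k ^ 2 - θ ^ 2 ≠ 0 := by linarith
    apply mul_left_cancel₀ h2
    linear_combination -h1
  -- The combination of `g0` and `e0` orthogonal to `e0`. Being supported on one colour class, it is
  -- then orthogonal to the constants and to the sign vector.
  set f := K • vec g0 + (c * KL) • vec e0 with hf
  have hfe : f ⬝ᵥ vec e0 = 0 := by
    rw [hf, add_dotProduct, smul_dotProduct, smul_dotProduct, hge, ← hK]
    simp only [smul_eq_mul]; ring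
  have hfl : f ⬝ᵥ vec l0 = -c * KL * (K - KL) := by
    rw [hf, add_dotProduct, smul_dotProduct, smul_dotProduct, hgl, hge,
      dotProduct_comm (vec e0), ← hKL]
    simp only [smul_eq_mul]; ring
  have hsupp : ∀ y, f y * vec e0 y = f y := by
    intro y
    simp only [hf, Pi.add_apply, Pi.smul_apply, smul_eq_mul, vec, g0, e0]
    split_ifs <;> simp_all
  have hb1 : ∑ y, f y = 0 := by
    rw [← hfe]
    exact Finset.sum_congr rfl fun y _ => (hsupp y).symm
  have hb2 : ∑ y, signVec G x y * f y = 0 := by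
    have : ∑ y, signVec G x y * f y = (-1) ^ j * (f ⬝ᵥ vec e0) := by
      rw [dotProduct, Finset.mul_sum]
      refine Finset.sum_congr rfl fun y _ => ?_
      rw [← hsupp y]
      simp only [vec, e0]
      by_cases h : G.dist x y % 2 = j % 2
      · rw [if_pos h, signVec, neg_one_pow_eq_pow_mod_two, h, ← neg_one_pow_eq_pow_mod_two]; ring
      · rw [if_neg h]; simp
    rw [this, hfe, mul_zero]
  have hfin := mulVec_dotProduct_mulVec_le hG hbip hD ht x f hb1 hb2
  have hAf : A *ᵥ (A *ᵥ f) = θ ^ 2 • f - ((k ^ 2 - θ ^ 2) * c) • (K • vec l0 - KL • vec e0) := by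
    rw [hf, mulVec_add, mulVec_smul, mulVec_smul, mulVec_add, mulVec_smul, mulVec_smul, hAg, hAe]
    ext y
    simp only [Pi.add_apply, Pi.sub_apply, Pi.smul_apply, smul_eq_mul]
    ring
  rw [distMatrix_mulVec_dotProduct, ← hAdef, hAf, dotProduct_sub, dotProduct_smul, dotProduct_smul,
    dotProduct_sub, dotProduct_smul, dotProduct_smul, hfe, hfl] at hfin
  simp only [smul_eq_mul] at hfin
  -- This is the amount by which `⟨A² f, f⟩` exceeds `θ² ⟨f, f⟩`; `K - KL` is positive because layer
  -- `j + 2` is nonempty.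
  have hpos : 0 < (k ^ 2 - θ ^ 2) * (c * c) * (K * KL * (K - KL)) := by
    have h1 : 0 < k ^ 2 - θ ^ 2 := by linarith
    have h2 : 0 < c * c := mul_self_pos.2 hc0
    have h3 : 0 < K - KL := by linarith
    have h4 : 0 < K := by linarith
    positivity
  linarith

/-- Here `u` itself, cut off beyond layer `j` on the colour class of layer `j`, has Rayleigh
quotient for `A²` below `θ²`, which is impossible when `θ²` is the least squared eigenvalue. -/
lemma IsCosine.ne_of_extremal_min {θ : ℝ} {u : ℕ → ℝ} (hu : IsCosine G p θ u)
    (hG : IsDistanceRegularWith G p) (hbip : G.IsBipartite) (hθ : θ ≠ 0)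
    (ht : ∀ s ∈ spec G, θ ^ 2 ≤ s ^ 2)
    {j : ℕ} (hj : j + 2 ≤ G.diam) : u j ≠ u (j + 2) := by
  intro heq
  have hD : 1 ≤ G.diam := by omega
  have hc0 := hu.apply_ne_zero hG hbip hθ hj heq
  have hmid := hu.mul_apply_middle hG hbip hj heq
  have := hG.connected.nonempty
  obtain ⟨x⟩ := this
  let g0 : ℕ → ℝ := fun i => if i % 2 = j % 2 ∧ i ≤ j then u i else 0
  have hs0 : ∀ i ≤ G.diam, step ℝ G p g0 i = if i % 2 ≠ j % 2 ∧ i ≤ j then θ * u i else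
      if i = j + 1 then cNum G p (j + 1) * u j else 0 := by
    intro i hi
    have hst := hu.step_eq i hi
    simp only [step, g0] at hst ⊢
    rcases Nat.eq_zero_or_pos i with rfl | hpos
    · rw [cNum_zero, Nat.cast_zero, zero_mul, zero_add] at *
      by_cases h : (0 + 1) % 2 = j % 2
      · rw [if_pos (by omega), if_pos (by omega)]
        linear_combination hst
      · rw [if_neg (by omega), if_neg (by omega), if_neg (by omega), mul_zero]
    · by_cases h : i % 2 = j % 2
      · rw [if_neg (by omega), if_neg (by omega), if_neg (by omega), if_neg (by omega)]; simp
      · rcases Nat.lt_trichotomy i (j + 1) with h' | h' | h'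
        · rw [if_pos (by omega), if_pos (by omega), if_pos (by omega)]
          linear_combination hst
        · subst h'
          rw [if_pos (by omega), if_neg (by omega), if_neg (by omega), if_pos rfl,
            Nat.add_sub_cancel]
          ring
        · rw [if_neg (by omega), if_neg (by omega), if_neg (by omega), if_neg (by omega)]; simp
  -- The cutoff is felt only at `i = j`: in layer `j + 1` the image of `g0` is `c_{j+1} u_j` instead
  -- of `θ u_{j+1} = k u_j`, so it falls short by `b_{j+1} u_j`.
  have hs1 : ∀ i ≤ G.diam, g0 i * step ℝ G p (step ℝ G p g0) i =
      θ ^ 2 * (g0 i * g0 i) -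
        (if i = j then bNum G p j * bNum G p (j + 1) * (u j * u j) else 0) := by
    intro i hi
    by_cases hij : i % 2 = j % 2 ∧ i ≤ j
    · have hst := hu.step_eq i hi
      have hgi : g0 i = u i := if_pos hij
      rw [hgi]
      unfold step at hst
      rcases Nat.lt_or_ge i j with hlt | hge
      · rw [if_neg (by omega), step, hs0 (i + 1) (by omega), if_pos (by omega)]
        rcases Nat.eq_zero_or_pos i with rfl | hpos
        · rw [cNum_zero, Nat.cast_zero, zero_mul, zero_add] at *
          linear_combination θ * u 0 * hst
        · rw [hs0 (i - 1) (by omega), if_pos (by omega)]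
          linear_combination θ * u i * hst
      · obtain rfl : i = j := by omega
        have hb := bNum_add_cNum hG hbip hD (i := i + 1) (by omega)
        rw [← hb] at hmid
        push_cast at hmid
        rw [if_pos rfl, step, hs0 (i + 1) (by omega), if_neg (by omega), if_pos rfl]
        rcases Nat.eq_zero_or_pos i with rfl | hpos
        · rw [cNum_zero, Nat.cast_zero, zero_mul, zero_add] at *
          linear_combination θ * u 0 * hst - u 0 * bNum G p 0 * hmid
        · rw [hs0 (i - 1) (by omega), if_pos (by omega)]
          linear_combination θ * u i * hst - u i * bNum G p i * hmid
    · have hgi : g0 i = 0 := if_neg hij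
      rw [hgi, if_neg (by omega)]; simp
  have hfin := le_mulVec_dotProduct_mulVec ht (fun y => g0 (G.dist x y))
  rw [distMatrix_mulVec_dotProduct, distMatrix_one_mulVec_dist hG hbip hD,
    distMatrix_one_mulVec_dist hG hbip hD] at hfin
  simp only [dotProduct] at hfin
  rw [Finset.sum_congr rfl fun y _ => hs1 _ (dist_le_diam' hG.connected x y),
    Finset.sum_sub_distrib, ← Finset.mul_sum] at hfin
  have hpos : 0 < ∑ y, (if G.dist x y = j then
      (bNum G p j : ℝ) * bNum G p (j + 1) * (u j * u j) else 0) := by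
    have h1 := bNum_pos hG (i := j) (by omega)
    have h2 := bNum_pos hG (i := j + 1) (by omega)
    have h3 : 0 < u j * u j := mul_self_pos.2 hc0
    obtain ⟨y, hy⟩ := exists_dist_eq hG x (h := j) (by omega)
    refine Finset.sum_pos' (fun z _ => ?_) ⟨y, Finset.mem_univ _, ?_⟩
    · split_ifs <;> positivity
    · rw [if_pos hy]; positivity
  linarith

/-! ### The ordering of the eigenvalues -/

/-- In a strictly decreasing list, an index counts the larger entries. This turns statements about
`θ_i` into counting; the default `0` is not reached for indices in range. -/
lemma sort_getD_spec (S : Finset ℝ) {i : ℕ} (hi : i < S.card) :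
    (S.sort (· ≥ ·)).getD i 0 ∈ S ∧
      (S.filter fun s => (S.sort (· ≥ ·)).getD i 0 < s).card = i := by
  set l := S.sort (· ≥ ·) with hl
  have hlen : l.length = S.card := Finset.length_sort _
  have hpw : ∀ a b (ha : a < l.length) (hb : b < l.length), a < b → l[b] < l[a] :=
    List.pairwise_iff_getElem.1 (Finset.sortedGT_sort S).pairwise
  have hget : ∀ a, (ha : a < l.length) → l.getD a 0 = l[a] := fun a ha =>
    List.getD_eq_getElem l 0 ha
  have hmem : ∀ s, s ∈ S ↔ ∃ a, ∃ ha : a < l.length, l[a] = s := by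
    intro s
    rw [← Finset.mem_sort (· ≥ ·), ← hl, List.mem_iff_getElem]
  have hi' : i < l.length := hlen ▸ hi
  refine ⟨(hmem _).2 ⟨i, hi', (hget i hi').symm⟩, ?_⟩
  have himg : (S.filter fun s => l.getD i 0 < s) = (Finset.range i).image fun a => l.getD a 0 := by
    ext s
    rw [Finset.mem_filter, Finset.mem_image, hmem, hget i hi']
    constructor
    · rintro ⟨⟨a, ha, rfl⟩, hlt⟩
      refine ⟨a, Finset.mem_range.2 ?_, hget a ha⟩
      by_contra! h
      rcases h.lt_or_eq with h | rfl
      · exact (hpw i a hi' ha h).not_gt hlt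
      · exact lt_irrefl _ hlt
    · rintro ⟨a, ha, rfl⟩
      have hai := Finset.mem_range.1 ha
      have hal : a < l.length := hai.trans hi'
      rw [hget a hal]
      exact ⟨⟨a, hal, rfl⟩, hpw a i hal hi' hai⟩
  rw [himg, Finset.card_image_of_injOn, Finset.card_range]
  intro a ha b hb hab
  have ha' : a < l.length := (Finset.mem_range.1 ha).trans hi'
  have hb' : b < l.length := (Finset.mem_range.1 hb).trans hi'
  simp only [hget a ha', hget b hb'] at hab
  rcases Nat.lt_trichotomy a b with h | h | h
  · exact absurd hab (hpw a b ha' hb' h).ne'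
  · exact h
  · exact absurd hab (hpw b a hb' ha' h).ne

lemma card_neg_spec (hc : G.Connected) (hbip : G.IsBipartite) :
    ((spec G).filter fun s => s < 0).card = ((spec G).filter fun s => 0 < s).card := by
  refine Finset.card_bij (fun s _ => -s) ?_ ?_ ?_
  · intro s hs
    rw [Finset.mem_filter] at hs ⊢
    exact ⟨neg_mem_spec hc hbip hs.1, by linarith [hs.2]⟩
  · intro a _ b _ h
    exact neg_injective h
  · intro s hs
    rw [Finset.mem_filter] at hs
    exact ⟨-s, Finset.mem_filter.2 ⟨neg_mem_spec hc hbip hs.1, by linarith [hs.2]⟩, by simp⟩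

lemma card_spec_eq (hc : G.Connected) (hbip : G.IsBipartite) :
    (spec G).card = 2 * ((spec G).filter fun s => 0 < s).card +
      ((spec G).filter fun s => s = 0).card := by
  have h1 := Finset.card_filter_add_card_filter_not (s := spec G) (fun s => s < 0)
  have h2 := Finset.card_filter_add_card_filter_not
    (s := (spec G).filter fun s => ¬ s < 0) (fun s => s = 0)
  rw [Finset.filter_filter, Finset.filter_filter] at h2
  have h3 : ((spec G).filter fun s => ¬ s < 0 ∧ s = 0) = (spec G).filter fun s => s = 0 := by
    refine Finset.filter_congr fun s _ => ⟨fun h => h.2, ?_⟩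
    rintro rfl
    simp
  have h4 : ((spec G).filter fun s => ¬ s < 0 ∧ ¬ s = 0) = (spec G).filter fun s => 0 < s := by
    refine Finset.filter_congr fun s _ => ?_
    rw [not_lt, lt_iff_le_and_ne, ne_comm]
  rw [h3, h4] at h2
  rw [card_neg_spec hc hbip] at h1
  omega

/-- For `θ = 0` the recurrence at odd indices propagates `u ≠ 0` through the even ones; at the odd
index `D`, where `b_D = 0`, it demands `u_{D-1} = 0`. -/
lemma zero_notMem_spec (hG : IsDistanceRegularWith G p) (hbip : G.IsBipartite)
    (hodd : Odd G.diam) : (0 : ℝ) ∉ spec G := by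
  intro h
  have hD : 1 ≤ G.diam := hodd.pos
  obtain ⟨u, hu⟩ := exists_isCosine hG hbip hD h
  have key : ∀ m, 2 * m < G.diam → u (2 * m) ≠ 0 := by
    intro m
    induction m with
    | zero => intro _; simp [hu.zero]
    | succ m ih =>
      intro hm h0
      have hst := hu.step_eq (2 * m + 1) (by omega)
      have hc := cNum_pos hG (i := 2 * m + 1) (by omega) (by omega)
      rw [step, show 2 * m + 1 + 1 = 2 * (m + 1) by ring, h0, zero_mul, mul_zero, add_zero,
        Nat.add_sub_cancel, mul_eq_zero, Nat.cast_eq_zero] at hst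
      exact ih (by omega) (hst.resolve_left hc.ne')
  obtain ⟨d, hd⟩ := hodd
  have hst := hu.step_eq G.diam le_rfl
  have hc := cNum_pos hG (i := G.diam) (by omega) le_rfl
  rw [step, bNum_diam, Nat.cast_zero, zero_mul, zero_mul, add_zero, mul_eq_zero,
    Nat.cast_eq_zero] at hst
  refine key d (by omega) ?_
  rw [show 2 * d = G.diam - 1 by omega]
  exact hst.resolve_left hc.ne'

lemma eigenvalue_one_spec (hG : IsDistanceRegularWith G p) (hbip : G.IsBipartite)
    (hD : 3 ≤ G.diam) :
    eigenvalue G 1 ∈ spec G ∧ 0 < eigenvalue G 1 ∧ eigenvalue G 1 < p 0 1 1 ∧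
      ∀ s ∈ spec G, s ≠ p 0 1 1 → s ≠ -p 0 1 1 → s ^ 2 ≤ eigenvalue G 1 ^ 2 := by
  have hcard := card_spec hG hbip (by omega)
  obtain ⟨hmem, hfil⟩ := sort_getD_spec (spec G) (i := 1) (by omega)
  change eigenvalue G 1 ∈ spec G at hmem
  change ((spec G).filter fun s => eigenvalue G 1 < s).card = 1 at hfil
  have hk := valency_mem_spec hG (by omega)
  have hlt : eigenvalue G 1 < p 0 1 1 := by
    obtain ⟨s, hs⟩ := Finset.card_pos.1 (hfil.symm ▸ Nat.one_pos)
    rw [Finset.mem_filter] at hs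
    exact hs.2.trans_le (le_valency_of_mem_spec hG (by omega) hs.1)
  have hle : ∀ s ∈ spec G, s ≠ p 0 1 1 → s ≤ eigenvalue G 1 := by
    intro s hs hne
    by_contra! h
    exact hne (Finset.card_le_one.1 hfil.le _ (Finset.mem_filter.2 ⟨hs, h⟩) _
      (Finset.mem_filter.2 ⟨hk, hlt⟩))
  -- If `θ_1 ≤ 0`, at most one eigenvalue is positive; by symmetry there are then at most three
  -- eigenvalues, fewer than `D + 1`.
  have hpos : 0 < eigenvalue G 1 := by
    by_contra! h
    have h1 : ((spec G).filter fun s => 0 < s).card ≤ 1 := by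
      rw [← hfil]
      refine Finset.card_le_card fun s hs => ?_
      rw [Finset.mem_filter] at hs ⊢
      exact ⟨hs.1, h.trans_lt hs.2⟩
    have h2 := card_spec_eq hG.connected hbip
    have h3 : ((spec G).filter fun s => s = 0).card ≤ 1 := by
      rw [Finset.card_le_one]
      intro a ha b hb
      rw [(Finset.mem_filter.1 ha).2, (Finset.mem_filter.1 hb).2]
    omega
  refine ⟨hmem, hpos, hlt, fun s hs h1 h2 => ?_⟩
  have h3 := hle s hs h1
  have h4 := hle (-s) (neg_mem_spec hG.connected hbip hs) (fun h => h2 (by linarith))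
  exact sq_le_sq' (by linarith) h3

/-- For `D = 2d + 1` the `2d + 2` eigenvalues are nonzero and come in pairs `±s`, so `d + 1` are
positive and the one of index `d` is the least of these. -/
lemma eigenvalue_half_spec (hG : IsDistanceRegularWith G p) (hbip : G.IsBipartite)
    (hodd : Odd G.diam) :
    eigenvalue G (G.diam / 2) ∈ spec G ∧ 0 < eigenvalue G (G.diam / 2) ∧
      ∀ s ∈ spec G, eigenvalue G (G.diam / 2) ^ 2 ≤ s ^ 2 := by
  have hcard := card_spec hG hbip hodd.pos
  obtain ⟨d, hd⟩ := hodd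
  obtain ⟨hmem, hfil⟩ := sort_getD_spec (spec G) (i := G.diam / 2) (by omega)
  set t := eigenvalue G (G.diam / 2) with ht
  change t ∈ spec G at hmem
  change ((spec G).filter fun s => t < s).card = _ at hfil
  have h0 := zero_notMem_spec hG hbip ⟨d, hd⟩
  have hP : ((spec G).filter fun s => 0 < s).card = d + 1 := by
    have h1 := card_spec_eq hG.connected hbip
    have h2 : ((spec G).filter fun s => s = 0).card = 0 := by
      rw [Finset.card_eq_zero, Finset.filter_eq_empty_iff]
      rintro s hs rfl
      exact h0 hs
    omega
  have hpos : 0 < t := by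
    by_contra! h
    have h1 : ((spec G).filter fun s => 0 < s).card ≤ G.diam / 2 := by
      rw [← hfil]
      refine Finset.card_le_card fun s hs => ?_
      rw [Finset.mem_filter] at hs ⊢
      exact ⟨hs.1, h.trans_lt hs.2⟩
    omega
  have hmin : ∀ s ∈ spec G, 0 < s → t ≤ s := by
    intro s hs hs0
    by_contra! h
    have hsub : insert s (insert t ((spec G).filter fun s => t < s)) ⊆
        (spec G).filter fun s => 0 < s := by
      intro r hr
      simp only [Finset.mem_insert, Finset.mem_filter] at hr ⊢
      rcases hr with rfl | rfl | hr
      · exact ⟨hs, hs0⟩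
      · exact ⟨hmem, hpos⟩
      · exact ⟨hr.1, hpos.trans hr.2⟩
    have := Finset.card_le_card hsub
    rw [Finset.card_insert_of_notMem, Finset.card_insert_of_notMem, hfil, hP] at this
    · omega
    · simp
    · simp [h.ne, h.le]
  refine ⟨hmem, hpos, fun s hs => ?_⟩
  rcases lt_trichotomy s 0 with h | rfl | h
  · have := hmin (-s) (neg_mem_spec hG.connected hbip hs) (by linarith)
    rw [← neg_sq s]
    exact pow_le_pow_left₀ hpos.le this 2
  · exact absurd hs h0
  · exact pow_le_pow_left₀ hpos.le (hmin s hs h) 2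

lemma cNum_one (hG : IsDistanceRegularWith G p) (hD : 1 ≤ G.diam) : cNum G p 1 = 1 := by
  obtain ⟨y, z, hyz⟩ := exists_pair_dist_eq hG.connected hD
  have h := card_down hG hD y z
  rw [hyz] at h
  rw [← h, Finset.card_eq_one]
  refine ⟨z, ?_⟩
  ext w
  simp only [Finset.mem_filter, Finset.mem_univ, true_and, Finset.mem_singleton]
  constructor
  · rintro ⟨-, h⟩
    exact hG.connected.dist_eq_zero_iff.1 (by omega)
  · rintro rfl
    simp [hyz]

/-- Eliminating `u_1` and `u_3` from the recurrence at indices 0 to 3 gives `key`. Together with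
`u_2 ≠ u_4` it also shows that the denominator `θ² - b_2` is nonzero. -/
lemma IsCosine.tilde_identity {θ : ℝ} {u : ℕ → ℝ} (hu : IsCosine G p θ u)
    (hG : IsDistanceRegularWith G p) (hbip : G.IsBipartite) (hD : 4 ≤ G.diam)
    (h24 : u 2 ≠ u 4) :
    1 + tilde p θ * u 2 - (1 + tilde p θ) * u 4 = 0 := by
  have e0 := hu.step_eq 0 (by omega)
  have e1 := hu.step_eq 1 (by omega)
  have e2 := hu.step_eq 2 (by omega)
  have e3 := hu.step_eq 3 (by omega)
  have k0 := congrArg (Nat.cast : ℕ → ℝ) (bNum_add_cNum hG hbip (by omega) (i := 0) (by omega))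
  have k1 := congrArg (Nat.cast : ℕ → ℝ) (bNum_add_cNum hG hbip (by omega) (i := 1) (by omega))
  have k2 := congrArg (Nat.cast : ℕ → ℝ) (bNum_add_cNum hG hbip (by omega) (i := 2) (by omega))
  have k3 := congrArg (Nat.cast : ℕ → ℝ) (bNum_add_cNum hG hbip (by omega) (i := 3) (by omega))
  rw [cNum_zero] at k0
  rw [cNum_one hG (by omega)] at k1
  have hb2 : (p 2 1 3 : ℝ) = bNum G p 2 := by rw [bNum, if_pos (by omega)]
  have hb3 : (p 3 1 4 : ℝ) = bNum G p 3 := by rw [bNum, if_pos (by omega)]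
  have hb2pos := bNum_pos hG (i := 2) (by omega)
  have hb3pos := bNum_pos hG (i := 3) (by omega)
  simp only [step, cNum_zero, cNum_one hG (by omega : 1 ≤ G.diam), Nat.cast_zero, Nat.cast_one,
    zero_add, hu.zero, mul_one, Nat.sub_self, Nat.reduceAdd, Nat.reduceSub]
    at e0 e1 e2 e3
  push_cast at k0 k1 k2 k3
  have key : (bNum G p 2 : ℝ) * bNum G p 3 * (u 4 - u 2) =
      -((1 - u 2) * (θ ^ 2 - bNum G p 2)) := by
    linear_combination (bNum G p 2 : ℝ) * e3 + θ * e2 - θ * e0 - (bNum G p 2 : ℝ) * e1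
      - (bNum G p 2 : ℝ) * u 2 * k3 - θ * u 1 * k2 + θ * u 1 * k0 + (bNum G p 2 : ℝ) * u 2 * k1
  have hne : θ ^ 2 - bNum G p 2 ≠ 0 := by
    intro h
    rw [h, mul_zero, neg_zero, mul_eq_zero, mul_eq_zero, Nat.cast_eq_zero, Nat.cast_eq_zero] at key
    rcases key with (h | h) | h
    · omega
    · omega
    · exact h24 (by linarith)
  rw [tilde, hb2, hb3]
  field_simp
  linear_combination key

/-- The cosine sequence of `θ_1`, or of `θ_d` when the diameter is odd. -/
lemma exists_extremal_cosine (hG : IsDistanceRegularWith G p) (hbip : G.IsBipartite)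
    (hD : 4 ≤ G.diam) {n : ℕ} (hn : n = 1 ∨ (Odd G.diam ∧ n = G.diam / 2)) :
    ∃ u, IsCosine G p (eigenvalue G n) u ∧ (∀ j, j + 2 ≤ G.diam → u j ≠ u (j + 2)) ∧
      1 + tilde p (eigenvalue G n) * u 2 - (1 + tilde p (eigenvalue G n)) * u 4 = 0 := by
  have hmain : ∃ u, IsCosine G p (eigenvalue G n) u ∧
      (∀ j, j + 2 ≤ G.diam → u j ≠ u (j + 2)) := by
    rcases hn with rfl | ⟨hodd, rfl⟩
    · obtain ⟨h1, h2, h3, h4⟩ := eigenvalue_one_spec hG hbip (by omega)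
      obtain ⟨u, hu⟩ := exists_isCosine hG hbip (by omega) h1
      refine ⟨u, hu, fun j hj => hu.ne_of_extremal_max hG hbip h2.ne' ?_ h4 hj⟩
      exact pow_lt_pow_left₀ h3 h2.le two_ne_zero
    · obtain ⟨h1, h2, h3⟩ := eigenvalue_half_spec hG hbip hodd
      obtain ⟨u, hu⟩ := exists_isCosine hG hbip (by omega) h1
      exact ⟨u, hu, fun j hj => hu.ne_of_extremal_min hG hbip h2.ne' h3 hj⟩
  obtain ⟨u, hu, hne⟩ := hmain
  exact ⟨u, hu, hne, hu.tilde_identity hG hbip hD (hne 2 (by omega))⟩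

variable {x : X}

/-! ### The Hermitian form and complete reducibility -/

lemma hermitian_add_left (u v w : X → ℂ) : hermitian (u + v) w = hermitian u w + hermitian v w :=
  add_dotProduct _ _ _

lemma hermitian_smul_left (a : ℂ) (u w : X → ℂ) : hermitian (a • u) w = a * hermitian u w :=
  smul_dotProduct _ _ _

lemma hermitian_smul_right (a : ℂ) (u w : X → ℂ) : hermitian u (a • w) = star a * hermitian u w := by
  simp [hermitian]

lemma hermitian_zero_left (w : X → ℂ) : hermitian 0 w = 0 := zero_dotProduct _

lemma hermitian_zero_right (w : X → ℂ) : hermitian w 0 = 0 := by simp [hermitian]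

lemma hermitian_star (u v : X → ℂ) : star (hermitian u v) = hermitian v u := by
  simp [hermitian, dotProduct, mul_comm]

lemma hermitian_eq_zero_comm {u v : X → ℂ} (h : hermitian u v = 0) : hermitian v u = 0 := by
  rw [← hermitian_star, h, star_zero]

lemma hermitian_self_eq_zero {u : X → ℂ} : hermitian u u = 0 ↔ u = 0 := by
  open scoped ComplexOrder in exact dotProduct_self_star_eq_zero

lemma hermitian_mulVec_left (B : Matrix X X ℂ) (u v : X → ℂ) :
    hermitian (B *ᵥ u) v = hermitian u (Bᴴ *ᵥ v) := by
  rw [hermitian, hermitian, star_mulVec, conjTranspose_conjTranspose, dotProduct_comm,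
    dotProduct_mulVec, dotProduct_comm]

/-- The orthogonal complement of a subspace of the standard module. -/
def perp (W : Submodule ℂ (X → ℂ)) : Submodule ℂ (X → ℂ) where
  carrier := {v | ∀ w ∈ W, hermitian v w = 0}
  add_mem' := fun hu hv w hw => by rw [hermitian_add_left, hu w hw, hv w hw, add_zero]
  zero_mem' := fun w _ => hermitian_zero_left w
  smul_mem' := fun c _ hv w hw => by rw [hermitian_smul_left, hv w hw, mul_zero]

lemma le_perp_comm {V W : Submodule ℂ (X → ℂ)} (h : V ≤ perp W) : W ≤ perp V :=
  fun w hw _ hv => hermitian_eq_zero_comm (h hv w hw)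

lemma exists_sub_mem_perp (W : Submodule ℂ (X → ℂ)) (v : X → ℂ) :
    ∃ w ∈ W, v - w ∈ perp W := by
  let e : (X → ℂ) ≃ₗ[ℂ] EuclideanSpace ℂ X := (WithLp.linearEquiv 2 ℂ (X → ℂ)).symm
  let W' : Submodule ℂ (EuclideanSpace ℂ X) := W.map e.toLinearMap
  obtain ⟨y, hy, z, hz, hyz⟩ := W'.exists_add_mem_mem_orthogonal (e v)
  obtain ⟨w, hw, rfl⟩ := hy
  refine ⟨w, hw, fun u hu => ?_⟩
  have h1 := (Submodule.mem_orthogonal _ _).1 hz (e u) ⟨u, hu, rfl⟩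
  have h2 : z = e (v - w) := by
    rw [map_sub]
    exact eq_sub_of_add_eq' hyz.symm
  rw [h2] at h1
  rw [hermitian, ← h1]
  exact (EuclideanSpace.inner_eq_star_dotProduct (e u) (e (v - w))).symm

lemma dualIdempotent_mulVec (i : ℕ) (v : X → ℂ) :
    dualIdempotent G x i *ᵥ v = fun y => if G.dist x y = i then v y else 0 := by
  ext y
  simp [dualIdempotent, mulVec_diagonal]

lemma dualIdempotent_conjTranspose (i : ℕ) :
    (dualIdempotent G x i)ᴴ = dualIdempotent G x i := by
  rw [dualIdempotent, diagonal_conjTranspose]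
  congr 1
  ext y
  by_cases h : G.dist x y = i <;> simp [h]

lemma distMatrix_conjTranspose (i : ℕ) : (distMatrix ℂ G i)ᴴ = distMatrix ℂ G i := by
  ext y z
  simp [distMatrix, G.dist_comm (u := z)]

lemma subconstituentAlgebra_eq : subconstituentAlgebra G x =
    Algebra.adjoin ℂ ({distMatrix ℂ G 1} ∪ {B | ∃ i ≤ G.diam, B = dualIdempotent G x i}) :=
  (Algebra.adjoin_union _ _).symm

lemma distMatrix_one_mem : distMatrix ℂ G 1 ∈ subconstituentAlgebra G x := by
  rw [subconstituentAlgebra_eq]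
  exact Algebra.subset_adjoin (Or.inl rfl)

lemma dualIdempotent_mem (hc : G.Connected) (i : ℕ) :
    dualIdempotent G x i ∈ subconstituentAlgebra G x := by
  by_cases hi : i ≤ G.diam
  · rw [subconstituentAlgebra_eq]
    exact Algebra.subset_adjoin (Or.inr ⟨i, hi, rfl⟩)
  · have : dualIdempotent G x i = 0 := by
      ext y z
      have := dist_le_diam' hc x y
      simp [dualIdempotent, diagonal_apply, show G.dist x y ≠ i by omega]
    rw [this]
    exact zero_mem _

/-- The generators are Hermitian, so `T` is closed under adjoints; hence orthogonal complements of
`T`-modules are `T`-modules. -/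
lemma conjTranspose_mem {B : Matrix X X ℂ} (hB : B ∈ subconstituentAlgebra G x) :
    Bᴴ ∈ subconstituentAlgebra G x := by
  rw [subconstituentAlgebra_eq] at hB ⊢
  induction hB using Algebra.adjoin_induction with
  | mem B hB =>
    have : Bᴴ = B := by
      rcases hB with rfl | ⟨i, -, rfl⟩
      · exact distMatrix_conjTranspose 1
      · exact dualIdempotent_conjTranspose i
    rw [this]
    exact Algebra.subset_adjoin hB
  | algebraMap r =>
    rw [Algebra.algebraMap_eq_smul_one, conjTranspose_smul, conjTranspose_one]
    exact Subalgebra.smul_mem _ (one_mem _) _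
  | add a b _ _ ha hb => rw [conjTranspose_add]; exact add_mem ha hb
  | mul a b _ _ ha hb => rw [conjTranspose_mul]; exact mul_mem hb ha

lemma isTModule_of_generators {W : Submodule ℂ (X → ℂ)}
    (h1 : ∀ w ∈ W, distMatrix ℂ G 1 *ᵥ w ∈ W) (h2 : ∀ i, ∀ w ∈ W, dualIdempotent G x i *ᵥ w ∈ W) :
    IsTModule G x W := by
  intro B hB
  rw [subconstituentAlgebra_eq] at hB
  induction hB using Algebra.adjoin_induction with
  | mem B hB =>
    rcases hB with rfl | ⟨i, -, rfl⟩
    · exact h1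
    · exact h2 i
  | algebraMap r =>
    intro w hw
    rw [Algebra.algebraMap_eq_smul_one, smul_mulVec, one_mulVec]
    exact W.smul_mem _ hw
  | add a b _ _ ha hb => intro w hw; rw [add_mulVec]; exact W.add_mem (ha w hw) (hb w hw)
  | mul a b _ _ ha hb => intro w hw; rw [← mulVec_mulVec]; exact ha _ (hb w hw)

lemma isTModule_perp {W : Submodule ℂ (X → ℂ)} (hW : IsTModule G x W) :
    IsTModule G x (perp W) := by
  intro B hB v hv w hw
  rw [hermitian_mulVec_left]
  exact hv _ (hW _ (conjTranspose_mem hB) w hw)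

lemma isTModule_inf {V W : Submodule ℂ (X → ℂ)} (hV : IsTModule G x V) (hW : IsTModule G x W) :
    IsTModule G x (V ⊓ W) :=
  fun B hB v hv => ⟨hV B hB v hv.1, hW B hB v hv.2⟩

lemma inf_perp_eq_bot (W : Submodule ℂ (X → ℂ)) : W ⊓ perp W = ⊥ := by
  rw [eq_bot_iff]
  rintro w ⟨h1, h2⟩
  exact hermitian_self_eq_zero.1 (h2 w h1)

lemma exists_irreducible_le {V : Submodule ℂ (X → ℂ)} (hV : IsTModule G x V) (h0 : V ≠ ⊥) :
    ∃ W ≤ V, IsIrreducibleTModule G x W := by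
  induction hn : Module.finrank ℂ V using Nat.strong_induction_on generalizing V with
  | _ n ih =>
    by_cases h : ∃ W' ≤ V, IsTModule G x W' ∧ W' ≠ ⊥ ∧ W' ≠ V
    · obtain ⟨W', hle, hT, hb, hne⟩ := h
      obtain ⟨W, hW, hW'⟩ := ih _ (hn ▸ Submodule.finrank_lt_finrank_of_lt (lt_of_le_of_ne hle hne))
        hT hb rfl
      exact ⟨W, hW.trans hle, hW'⟩
    · push Not at h
      refine ⟨V, le_rfl, hV, h0, fun W' hle hT => ?_⟩
      by_cases hb : W' = ⊥
      · exact Or.inl hb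
      · exact Or.inr (h W' hle hT hb)

/-- Split off an irreducible submodule and recurse on its orthogonal complement inside `V`, which
has smaller dimension. -/
lemma exists_orthogonal_family {V : Submodule ℂ (X → ℂ)} (hV : IsTModule G x V) :
    ∃ (m : ℕ) (Z : Fin m → Submodule ℂ (X → ℂ)), (∀ i, IsIrreducibleTModule G x (Z i)) ∧
      (∀ i j, i ≠ j → Z i ≤ perp (Z j)) ∧ ⨆ i, Z i = V := by
  induction hn : Module.finrank ℂ V using Nat.strong_induction_on generalizing V with
  | _ n ih =>
    by_cases h0 : V = ⊥
    · exact ⟨0, Fin.elim0, fun i => i.elim0, fun i => i.elim0, by simp [h0]⟩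
    · obtain ⟨W, hWV, hW⟩ := exists_irreducible_le hV h0
      have hlt : V ⊓ perp W < V := by
        refine lt_of_le_of_ne inf_le_left fun h => hW.2.1 ?_
        rw [← inf_perp_eq_bot W]
        exact (inf_eq_left.2 (hWV.trans (inf_eq_left.1 h))).symm
      obtain ⟨m, Z, hZ1, hZ2, hZ3⟩ := ih _ (hn ▸ Submodule.finrank_lt_finrank_of_lt hlt)
        (isTModule_inf hV (isTModule_perp hW.1)) rfl
      have hZW : ∀ i, Z i ≤ perp W := fun i =>
        (le_iSup Z i).trans (hZ3.le.trans inf_le_right)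
      refine ⟨m + 1, Fin.cons W Z, ?_, ?_, ?_⟩
      · intro i
        refine Fin.cases ?_ (fun i => ?_) i
        · simpa using hW
        · simpa using hZ1 i
      · intro i j
        refine Fin.cases ?_ (fun i => ?_) i <;> refine Fin.cases ?_ (fun j => ?_) j
        · simp
        · intro _
          simpa using le_perp_comm (hZW j)
        · intro _
          simpa using hZW i
        · intro hij
          simpa using hZ2 i j (fun h => hij (by rw [h]))
      · apply le_antisymm
        · refine iSup_le fun i => Fin.cases ?_ (fun i => ?_) i
          · simpa using hWV
          · simpa using (le_iSup Z i).trans (hZ3.le.trans inf_le_left)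
        · intro v hv
          obtain ⟨w, hw, hvw⟩ := exists_sub_mem_perp W v
          have h1 : v - w ∈ ⨆ i, Z i := by
            rw [hZ3]
            exact ⟨V.sub_mem hv (hWV hw), hvw⟩
          have h2 : ⨆ i, Z i ≤ ⨆ i, (Fin.cons W Z : Fin (m + 1) → _) i :=
            iSup_le fun i => le_iSup_of_le i.succ (by simp)
          have h3 : W ≤ ⨆ i, (Fin.cons W Z : Fin (m + 1) → _) i := le_iSup_of_le 0 (by simp)
          rw [← sub_add_cancel v w]
          exact Submodule.add_mem _ (h2 h1) (h3 hw)

lemma iSupIndep_of_orthogonal {m : ℕ} {Z : Fin m → Submodule ℂ (X → ℂ)}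
    (h : ∀ i j, i ≠ j → Z i ≤ perp (Z j)) : iSupIndep Z := by
  intro i
  rw [disjoint_iff, eq_bot_iff, ← inf_perp_eq_bot (Z i)]
  exact inf_le_inf_left _ (iSup₂_le fun j hj => h j i hj)

lemma isTModule_top : IsTModule G x ⊤ := fun _ _ _ _ => trivial

lemma exists_isOrthogonalDecomposition (G : SimpleGraph X) (x : X) :
    ∃ (m : ℕ) (Z : Fin m → Submodule ℂ (X → ℂ)), IsOrthogonalDecomposition G x Z := by
  obtain ⟨m, Z, h1, h2, h3⟩ := exists_orthogonal_family (isTModule_top (G := G) (x := x))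
  exact ⟨m, Z, h1, fun i j hij u hu v hv => h2 i j hij hu v hv,
    (DirectSum.isInternal_submodule_iff_iSupIndep_and_iSup_eq_top _).2
      ⟨iSupIndep_of_orthogonal h2, h3⟩⟩

/-! ### Layers and endpoints -/

lemma mem_image_dualIdempotent (hc : G.Connected) {W : Submodule ℂ (X → ℂ)}
    (hW : IsTModule G x W) {i : ℕ} {w : X → ℂ} :
    w ∈ image (dualIdempotent G x i) W ↔ w ∈ W ∧ ∀ y, G.dist x y ≠ i → w y = 0 := by
  constructor
  · rintro ⟨v, hv, rfl⟩
    refine ⟨hW _ (dualIdempotent_mem hc i) v hv, fun y hy => ?_⟩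
    rw [mulVecLin_apply, dualIdempotent_mulVec]
    exact if_neg hy
  · rintro ⟨hw, h⟩
    refine ⟨w, hw, ?_⟩
    rw [mulVecLin_apply, dualIdempotent_mulVec]
    ext y
    split_ifs with hy
    · rfl
    · exact (h y hy).symm

lemma image_ne_bot_of_endpoint (hc : G.Connected) {W : Submodule ℂ (X → ℂ)}
    (h0 : W ≠ ⊥) :
    image (dualIdempotent G x (endpoint G x W)) W ≠ ⊥ := by
  have hne : {i | i ≤ G.diam ∧ image (dualIdempotent G x i) W ≠ ⊥}.Nonempty := by
    obtain ⟨w, hw, hw0⟩ := Submodule.exists_mem_ne_zero_of_ne_bot h0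
    obtain ⟨y, hy⟩ := Function.ne_iff.1 hw0
    refine ⟨G.dist x y, dist_le_diam' hc x y, fun h => hy ?_⟩
    have h1 : dualIdempotent G x (G.dist x y) *ᵥ w ∈ image (dualIdempotent G x (G.dist x y)) W :=
      ⟨w, hw, rfl⟩
    rw [h, Submodule.mem_bot, dualIdempotent_mulVec] at h1
    simpa using congrFun h1 y
  exact (Nat.sInf_mem hne).2

lemma endpoint_le {W : Submodule ℂ (X → ℂ)} {i : ℕ} (hi : i ≤ G.diam)
    (h : image (dualIdempotent G x i) W ≠ ⊥) : endpoint G x W ≤ i :=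
  Nat.sInf_le ⟨hi, h⟩

lemma apply_eq_zero_of_lt_endpoint (hc : G.Connected) {W : Submodule ℂ (X → ℂ)} {w : X → ℂ}
    (hw : w ∈ W) {y : X} (hy : G.dist x y < endpoint G x W) : w y = 0 := by
  by_contra h
  refine hy.not_ge (endpoint_le (dist_le_diam' hc x y) fun h' => h ?_)
  have h1 : dualIdempotent G x (G.dist x y) *ᵥ w ∈ image (dualIdempotent G x (G.dist x y)) W :=
    ⟨w, hw, rfl⟩
  rw [h', Submodule.mem_bot, dualIdempotent_mulVec] at h1
  simpa using congrFun h1 y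

lemma radial_mem_boseMesner (hG : IsDistanceRegularWith G p) (hbip : G.IsBipartite)
    (hD : 1 ≤ G.diam) (g : ℕ → ℂ) : radial G g ∈ boseMesner G := by
  have hA : distMatrix ℂ G 1 ∈ boseMesner G := Algebra.subset_adjoin rfl
  have hall : ∀ m, m + 1 ≤ G.diam →
      distMatrix ℂ G m ∈ boseMesner G ∧ distMatrix ℂ G (m + 1) ∈ boseMesner G := by
    intro m
    induction m with
    | zero => exact fun _ => ⟨by rw [distMatrix_zero hG.connected]; exact one_mem _, hA⟩
    | succ m ih =>
      intro hm
      obtain ⟨h1, h2⟩ := ih (by omega)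
      refine ⟨h2, ?_⟩
      have hc : (cNum G p (m + 2) : ℂ) ≠ 0 := by
        exact_mod_cast (cNum_pos hG (i := m + 2) (by omega) (by omega)).ne'
      have h3 : distMatrix ℂ G (m + 2) = (cNum G p (m + 2) : ℂ)⁻¹ •
          (distMatrix ℂ G 1 * distMatrix ℂ G (m + 1) - (bNum G p m : ℂ) • distMatrix ℂ G m) := by
        rw [distMatrix_one_mul_distMatrix hG hbip hD, add_sub_cancel_left, smul_smul,
          inv_mul_cancel₀ hc, one_smul]
      rw [h3]
      exact Subalgebra.smul_mem _ (sub_mem (mul_mem hA h2) (Subalgebra.smul_mem _ h1 _)) _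
  have hsum : radial G g = ∑ i ∈ Finset.range (G.diam + 1), g i • distMatrix ℂ G i := by
    ext y z
    rw [Matrix.sum_apply]
    have := dist_le_diam' hG.connected y z
    simp [distMatrix, Nat.lt_succ_iff.2 this]
  rw [hsum]
  refine sum_mem fun i hi => Subalgebra.smul_mem _ ?_ _
  rw [Finset.mem_range] at hi
  rcases Nat.eq_zero_or_pos i with rfl | hpos
  · exact (hall 0 hD).1
  · have := (hall (i - 1) (by omega)).2
    rwa [Nat.sub_add_cancel hpos] at this

lemma radial_mem (hG : IsDistanceRegularWith G p) (hbip : G.IsBipartite) (hD : 1 ≤ G.diam)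
    (g : ℕ → ℂ) : radial G g ∈ subconstituentAlgebra G x :=
  (le_sup_left : boseMesner G ≤ _) (radial_mem_boseMesner hG hbip hD g)

lemma localMatrix_mem (hG : IsDistanceRegularWith G p) (hbip : G.IsBipartite) (hD : 1 ≤ G.diam) :
    localMatrix G x ∈ subconstituentAlgebra G x :=
  mul_mem (mul_mem (dualIdempotent_mem hG.connected 2)
    (by rw [distMatrix_eq_radial]; exact radial_mem hG hbip hD _))
    (dualIdempotent_mem hG.connected 2)

/-! ### Thin modules generated by a vector in one layer -/

/-- The function `y ↦ ∑ v z` over the `z` at the least possible distance from `y`, for `v`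
supported in the layer `r`. -/
def lowerSum (G : SimpleGraph X) (x : X) (r : ℕ) (v : X → ℂ) (y : X) : ℂ :=
  ∑ z, if G.dist y z + r = G.dist x y then v z else 0

/-- The function `y ↦ ∑ v z` over the `z` at the greatest possible distance from `y`, for `v`
supported in the layer `r`. -/
def upperSum (G : SimpleGraph X) (x : X) (r : ℕ) (v : X → ℂ) (y : X) : ℂ :=
  ∑ z, if G.dist y z = G.dist x y + r then v z else 0

/-- `v` is supported in the layer `r`, and in each layer its lower and upper sums are proportional. -/
structure IsLadder (G : SimpleGraph X) (x : X) (r : ℕ) (v : X → ℂ) : Prop where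
  supp : ∀ y, G.dist x y ≠ r → v y = 0
  coeff : ∃ τ κ : ℕ → ℂ, ∀ y, lowerSum G x r v y = τ (G.dist x y) * upperSum G x r v y ∧
    upperSum G x r v y = κ (G.dist x y) * lowerSum G x r v y

/-- The module of all functions that are, in each layer, multiples of the lower sums of `v`. -/
def ladder (G : SimpleGraph X) (x : X) (r : ℕ) (v : X → ℂ) : Submodule ℂ (X → ℂ) where
  carrier := {f | ∃ a : ℕ → ℂ, f = fun y => a (G.dist x y) * lowerSum G x r v y}
  add_mem' := by
    rintro _ _ ⟨a, rfl⟩ ⟨b, rfl⟩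
    exact ⟨a + b, by ext y; simp [add_mul]⟩
  zero_mem' := ⟨0, by ext y; simp⟩
  smul_mem' := by
    rintro c _ ⟨a, rfl⟩
    exact ⟨c • a, by ext y; simp [mul_assoc]⟩

section Sums

variable {r : ℕ} {v : X → ℂ}

/-- Exchange the sums. For `z` in layer `r` at the least possible distance from `y`, the triangle
inequality shows that the `w` counted are exactly the neighbours of `y` closer to `z`. -/
lemma sum_lowerSum (hG : IsDistanceRegularWith G p) (hbip : G.IsBipartite) (hD : 1 ≤ G.diam)
    (hv : ∀ y, G.dist x y ≠ r → v y = 0) (y : X) :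
    ∑ w, (if G.dist y w = 1 ∧ G.dist x w + 1 = G.dist x y then lowerSum G x r v w else 0) =
      cNum G p (G.dist x y - r) * lowerSum G x r v y := by
  have hc := hG.connected
  have h1 : ∀ w, (if G.dist y w = 1 ∧ G.dist x w + 1 = G.dist x y then lowerSum G x r v w else 0) =
      ∑ z, if G.dist y w = 1 ∧ G.dist x w + 1 = G.dist x y ∧ G.dist w z + r = G.dist x w
        then v z else 0 := by
    intro w
    by_cases h : G.dist y w = 1 ∧ G.dist x w + 1 = G.dist x y
    · rw [if_pos h, lowerSum]
      simp only [h.1, h.2, true_and]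
    · rw [if_neg h, Finset.sum_eq_zero]
      intro z _
      exact if_neg fun h' => h ⟨h'.1, h'.2.1⟩
  rw [Finset.sum_congr rfl fun w _ => h1 w, Finset.sum_comm, lowerSum, Finset.mul_sum]
  refine Finset.sum_congr rfl fun z _ => ?_
  by_cases hz : G.dist x z = r
  · have t1 := hc.dist_triangle (u := x) (v := z) (w := y)
    rw [G.dist_comm (u := z) (v := y)] at t1
    by_cases hyz : G.dist y z + r = G.dist x y
    · rw [if_pos hyz, show G.dist x y - r = G.dist y z by omega, ← card_down hG hD,
        ← Finset.sum_filter, Finset.sum_const, nsmul_eq_mul]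
      congr 3
      ext w
      simp only [Finset.mem_filter, Finset.mem_univ, true_and]
      have t2 := hc.dist_triangle (u := x) (v := z) (w := w)
      rw [G.dist_comm (u := z) (v := w)] at t2
      constructor
      · rintro ⟨a, b, c⟩; exact ⟨a, by omega⟩
      · rintro ⟨a, b⟩
        have t3 := dist_step hc hbip a x
        rw [G.dist_comm (u := w) (v := x), G.dist_comm (u := y) (v := x)] at t3
        exact ⟨a, by omega, by omega⟩
    · rw [if_neg hyz, mul_zero]
      refine Finset.sum_eq_zero fun w _ => if_neg ?_
      rintro ⟨a, b, c⟩
      have t2 := hc.dist_triangle (u := y) (v := w) (w := z)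
      omega
  · simp [hv z hz]

/-- The mirror image of `sum_lowerSum`: the `w` counted are the neighbours of `y` farther from `z`.
-/
lemma sum_upperSum (hG : IsDistanceRegularWith G p) (hbip : G.IsBipartite) (hD : 1 ≤ G.diam)
    (hv : ∀ y, G.dist x y ≠ r → v y = 0) (y : X) :
    ∑ w, (if G.dist y w = 1 ∧ G.dist x w = G.dist x y + 1 then upperSum G x r v w else 0) =
      bNum G p (G.dist x y + r) * upperSum G x r v y := by
  have hc := hG.connected
  have h1 : ∀ w, (if G.dist y w = 1 ∧ G.dist x w = G.dist x y + 1 then upperSum G x r v w else 0) =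
      ∑ z, if G.dist y w = 1 ∧ G.dist x w = G.dist x y + 1 ∧ G.dist w z = G.dist x w + r
        then v z else 0 := by
    intro w
    by_cases h : G.dist y w = 1 ∧ G.dist x w = G.dist x y + 1
    · rw [if_pos h, upperSum]
      simp only [h.1, h.2, true_and]
    · rw [if_neg h, Finset.sum_eq_zero]
      intro z _
      exact if_neg fun h' => h ⟨h'.1, h'.2.1⟩
  rw [Finset.sum_congr rfl fun w _ => h1 w, Finset.sum_comm, upperSum, Finset.mul_sum]
  refine Finset.sum_congr rfl fun z _ => ?_
  by_cases hz : G.dist x z = r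
  · have t1 := hc.dist_triangle (u := y) (v := x) (w := z)
    rw [G.dist_comm (u := y) (v := x)] at t1
    by_cases hyz : G.dist y z = G.dist x y + r
    · rw [if_pos hyz, ← hyz, ← card_up hG hD, ← Finset.sum_filter, Finset.sum_const, nsmul_eq_mul]
      congr 3
      ext w
      simp only [Finset.mem_filter, Finset.mem_univ, true_and]
      have t2 := hc.dist_triangle (u := w) (v := x) (w := z)
      rw [G.dist_comm (u := w) (v := x)] at t2
      constructor
      · rintro ⟨a, b, c⟩; exact ⟨a, by omega⟩
      · rintro ⟨a, b⟩
        have t3 := dist_step hc hbip a x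
        rw [G.dist_comm (u := w) (v := x), G.dist_comm (u := y) (v := x)] at t3
        exact ⟨a, by omega, by omega⟩
    · rw [if_neg hyz, mul_zero]
      refine Finset.sum_eq_zero fun w _ => if_neg ?_
      rintro ⟨a, b, c⟩
      have t2 := hc.dist_triangle (u := w) (v := y) (w := z)
      rw [G.dist_comm (u := w) (v := y)] at t2
      omega
  · simp [hv z hz]

lemma lowerSum_of_dist_eq (hc : G.Connected) {y : X} (hy : G.dist x y = r) :
    lowerSum G x r v y = v y := by
  rw [lowerSum, Finset.sum_eq_single y]
  · simp [hy]
  · intro z _ hz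
    refine if_neg fun h => hz ?_
    rw [hy] at h
    exact (hc.dist_eq_zero_iff.1 (by omega)).symm
  · simp

end Sums

namespace IsLadder

variable {r : ℕ} {v : X → ℂ}

/-- Steps away from `x` into layer `j` are governed by `sum_lowerSum`. For steps towards `x`,
convert lower sums to upper ones by `τ`, apply `sum_upperSum`, and convert back by `κ`. -/
lemma isTModule (hv : IsLadder G x r v) (hG : IsDistanceRegularWith G p) (hbip : G.IsBipartite)
    (hD : 1 ≤ G.diam) : IsTModule G x (ladder G x r v) := by
  apply isTModule_of_generators
  · rintro _ ⟨a, rfl⟩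
    obtain ⟨τ, κ, hτκ⟩ := hv.coeff
    refine ⟨fun j => a (j - 1) * cNum G p (j - r) +
      a (j + 1) * τ (j + 1) * bNum G p (j + r) * κ j, ?_⟩
    ext y
    have hsplit : (distMatrix ℂ G 1 *ᵥ fun w => a (G.dist x w) * lowerSum G x r v w) y =
        a (G.dist x y - 1) *
          ∑ w, (if G.dist y w = 1 ∧ G.dist x w + 1 = G.dist x y then lowerSum G x r v w else 0) +
        a (G.dist x y + 1) * τ (G.dist x y + 1) *
          ∑ w, (if G.dist y w = 1 ∧ G.dist x w = G.dist x y + 1 then upperSum G x r v w else 0) := by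
      rw [distMatrix_mulVec_apply, Finset.sum_filter, Finset.mul_sum, Finset.mul_sum,
        ← Finset.sum_add_distrib]
      refine Finset.sum_congr rfl fun w _ => ?_
      by_cases h : G.dist y w = 1
      · have t := dist_step hG.connected hbip h x
        rw [G.dist_comm (u := w) (v := x), G.dist_comm (u := y) (v := x)] at t
        rcases t with t | t
        · rw [if_pos h, if_neg (by omega), if_pos ⟨h, t⟩, (hτκ w).1, t]; ring
        · rw [if_pos h, if_pos ⟨h, t⟩, if_neg (by omega), ← t, Nat.add_sub_cancel]; ring
      · simp [h]
    rw [hsplit, sum_lowerSum hG hbip hD hv.supp, sum_upperSum hG hbip hD hv.supp, (hτκ y).2]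
    ring
  · rintro i _ ⟨a, rfl⟩
    refine ⟨fun j => if j = i then a j else 0, ?_⟩
    rw [dualIdempotent_mulVec]
    ext y
    by_cases h : G.dist x y = i <;> simp [h]

lemma self_mem (hv : IsLadder G x r v) (hc : G.Connected) : v ∈ ladder G x r v := by
  refine ⟨fun j => if j = r then 1 else 0, ?_⟩
  ext y
  by_cases h : G.dist x y = r
  · simp [h, lowerSum_of_dist_eq hc h]
  · simp [h, hv.supp y h]

lemma ladder_le (hG : IsDistanceRegularWith G p) (hbip : G.IsBipartite)
    (hD : 1 ≤ G.diam) {W : Submodule ℂ (X → ℂ)} (hW : IsTModule G x W) (hvW : v ∈ W) :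
    ladder G x r v ≤ W := by
  rintro _ ⟨a, rfl⟩
  have h : (fun y => a (G.dist x y) * lowerSum G x r v y) =
      ∑ j ∈ Finset.range (G.diam + 1), a j • (dualIdempotent G x j *ᵥ
        (radial G (fun i => if i + r = j then (1 : ℂ) else 0) *ᵥ v)) := by
    ext y
    have hy := dist_le_diam' hG.connected x y
    simp only [Finset.sum_apply, Pi.smul_apply, dualIdempotent_mulVec, smul_eq_mul]
    rw [Finset.sum_eq_single (G.dist x y)]
    · rw [if_pos rfl, lowerSum]
      congr 1
      simp [mulVec, dotProduct]
    · intro j _ hj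
      rw [if_neg (Ne.symm hj), mul_zero]
    · intro h
      simp at h; omega
  rw [h]
  exact Submodule.sum_mem _ fun j _ => W.smul_mem _ (hW _ (dualIdempotent_mem hG.connected j) _
    (hW _ (radial_mem hG hbip hD _) _ hvW))

lemma eq_smul_of_mem (hv : IsLadder G x r v) (hc : G.Connected) {f : X → ℂ}
    (hf : f ∈ ladder G x r v) : ∃ c : ℂ, dualIdempotent G x r *ᵥ f = c • v := by
  obtain ⟨a, rfl⟩ := hf
  refine ⟨a r, ?_⟩
  rw [dualIdempotent_mulVec]
  ext y
  by_cases h : G.dist x y = r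
  · simp [h, lowerSum_of_dist_eq hc h]
  · simp [h, hv.supp y h]

lemma dualIdempotent_mulVec_self (hv : IsLadder G x r v) : dualIdempotent G x r *ᵥ v = v := by
  rw [dualIdempotent_mulVec]
  ext y
  split_ifs with h
  · rfl
  · exact (hv.supp y h).symm

/-- The layer `r` of the module is the line through `v`. A submodule that is nonzero there contains
`v`, hence everything; otherwise `v` lies in its orthogonal complement, which is a module and so
contains the whole ladder. -/
lemma isIrreducible (hv : IsLadder G x r v) (hG : IsDistanceRegularWith G p)
    (hbip : G.IsBipartite) (hD : 1 ≤ G.diam) (h0 : v ≠ 0) :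
    IsIrreducibleTModule G x (ladder G x r v) := by
  have hT := hv.isTModule hG hbip hD
  have hmem := hv.self_mem hG.connected
  refine ⟨hT, fun h => h0 ?_, fun W hle hW => ?_⟩
  · rw [h] at hmem
    exact hmem
  by_cases h : ∃ w ∈ W, dualIdempotent G x r *ᵥ w ≠ 0
  · right
    obtain ⟨w, hw, hne⟩ := h
    obtain ⟨c, hc⟩ := hv.eq_smul_of_mem hG.connected (hle hw)
    have hc0 : c ≠ 0 := by
      rintro rfl
      exact hne (by rw [hc, zero_smul])
    have hvW : v ∈ W := by
      have h1 := hW _ (dualIdempotent_mem hG.connected r) w hw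
      rw [hc] at h1
      have h2 := W.smul_mem c⁻¹ h1
      rwa [smul_smul, inv_mul_cancel₀ hc0, one_smul] at h2
    exact le_antisymm hle (ladder_le hG hbip hD hW hvW)
  · left
    push Not at h
    have hvp : v ∈ perp W := by
      intro w hw
      rw [← hv.dualIdempotent_mulVec_self, hermitian_mulVec_left, dualIdempotent_conjTranspose,
        h w hw, hermitian_zero_right]
    rw [eq_bot_iff, ← inf_perp_eq_bot W]
    exact le_inf le_rfl (hle.trans (ladder_le hG hbip hD (isTModule_perp hW) hvp))

lemma isThin : IsThin G x (ladder G x r v) := by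
  intro i _
  have hle : image (dualIdempotent G x i) (ladder G x r v) ≤
      Submodule.span ℂ {dualIdempotent G x i *ᵥ lowerSum G x r v} := by
    rintro _ ⟨_, ⟨a, rfl⟩, rfl⟩
    rw [Submodule.mem_span_singleton]
    refine ⟨a i, ?_⟩
    rw [mulVecLin_apply, dualIdempotent_mulVec, dualIdempotent_mulVec]
    ext y
    by_cases h : G.dist x y = i <;> simp [h]
  refine (Submodule.finrank_mono hle).trans ?_
  have := finrank_span_le_card (R := ℂ) ({dualIdempotent G x i *ᵥ lowerSum G x r v} : Set (X → ℂ))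
  simpa using this

lemma apply_eq_zero_of_lt {f : X → ℂ} (hf : f ∈ ladder G x r v) {y : X} (hy : G.dist x y < r) :
    f y = 0 := by
  obtain ⟨a, rfl⟩ := hf
  simp only [lowerSum]
  rw [Finset.sum_eq_zero, mul_zero]
  intro z _
  exact if_neg (by omega)

lemma endpoint_eq (hv : IsLadder G x r v) (hG : IsDistanceRegularWith G p)
    (hbip : G.IsBipartite) (hD : 1 ≤ G.diam) (hr : r ≤ G.diam) (h0 : v ≠ 0) :
    endpoint G x (ladder G x r v) = r := by
  have hT := hv.isTModule hG hbip hD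
  have hmem := hv.self_mem hG.connected
  apply le_antisymm
  · refine endpoint_le hr fun h => h0 ?_
    have h1 : v ∈ image (dualIdempotent G x r) (ladder G x r v) :=
      ⟨v, hmem, hv.dualIdempotent_mulVec_self⟩
    rw [h] at h1
    exact h1
  · by_contra! hlt
    refine image_ne_bot_of_endpoint hG.connected (x := x)
      (hv.isIrreducible hG hbip hD h0).2.1 ?_
    rw [eq_bot_iff]
    intro w hw
    rw [mem_image_dualIdempotent hG.connected hT] at hw
    rw [Submodule.mem_bot]
    ext y
    by_cases hy : G.dist x y = endpoint G x (ladder G x r v)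
    · exact apply_eq_zero_of_lt hw.1 (by omega)
    · exact hw.2 y hy

end IsLadder

/-! ### Modules with endpoint zero or one, and the space `U` -/

lemma isLadder_single : IsLadder G x 0 (Pi.single x 1) where
  supp y hy := by
    have : y ≠ x := by rintro rfl; simp at hy
    simp [this]
  coeff := ⟨1, 1, fun y => by simp [lowerSum, upperSum]⟩

/-- Any `y` is at distance `∂(x,y) ± 1` from each neighbour of `x`, so lower and upper sums add up
to the total, which is zero. -/
lemma isLadder_of_sum_eq_zero (hc : G.Connected) (hbip : G.IsBipartite) {u : X → ℂ}
    (hu : ∀ y, G.dist x y ≠ 1 → u y = 0) (hsum : ∑ y, u y = 0) : IsLadder G x 1 u where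
  supp := hu
  coeff := by
    have h : ∀ y, lowerSum G x 1 u y + upperSum G x 1 u y = 0 := by
      intro y
      rw [lowerSum, upperSum, ← Finset.sum_add_distrib]
      refine (Finset.sum_congr rfl fun z _ => ?_).trans hsum
      by_cases hz : G.dist x z = 1
      · have := dist_step hc hbip hz y
        rw [G.dist_comm (u := z)] at this
        rcases this with h | h
        · rw [if_neg (by omega), if_pos h, zero_add]
        · rw [if_pos h, if_neg (by omega), add_zero]
      · simp [hu z hz]
    exact ⟨-1, -1, fun y => ⟨by simp; linear_combination h y, by simp; linear_combination h y⟩⟩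

/-- Vectors in the second layer that are annihilated by `E*_1 A`. -/
structure IsPrimitive (G : SimpleGraph X) (x : X) (v : X → ℂ) : Prop where
  supp : ∀ y, G.dist x y ≠ 2 → v y = 0
  ann : ∀ y, G.dist x y = 1 → (distMatrix ℂ G 1 *ᵥ v) y = 0

/-- Double counting: each vertex of layer 2 has `c_2` neighbours in layer 1. -/
lemma sum_layer_one_mulVec (hG : IsDistanceRegularWith G p) (hD : 2 ≤ G.diam) {v : X → ℂ}
    (hv : ∀ y, G.dist x y ≠ 2 → v y = 0) :
    ∑ y, (if G.dist x y = 1 then (distMatrix ℂ G 1 *ᵥ v) y else 0) = cNum G p 2 * ∑ z, v z := by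
  have h1 : ∀ y, (if G.dist x y = 1 then (distMatrix ℂ G 1 *ᵥ v) y else 0) =
      ∑ z, if G.dist x y = 1 ∧ G.dist y z + 1 = G.dist x z then v z else 0 := by
    intro y
    rw [distMatrix_mulVec_apply, Finset.sum_filter]
    by_cases h : G.dist x y = 1
    · rw [if_pos h]
      refine Finset.sum_congr rfl fun z _ => ?_
      by_cases hz : G.dist x z = 2
      · exact if_congr (by omega) rfl rfl
      · simp [hv z hz]
    · simp [h]
  rw [Finset.sum_congr rfl fun y _ => h1 y, Finset.sum_comm, Finset.mul_sum]
  refine Finset.sum_congr rfl fun z _ => ?_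
  by_cases hz : G.dist x z = 2
  · rw [← Finset.sum_filter, Finset.sum_const, nsmul_eq_mul, card_down hG (by omega), hz]
  · simp [hv z hz]

lemma IsPrimitive.sum_eq_zero (hG : IsDistanceRegularWith G p) (hD : 2 ≤ G.diam) {v : X → ℂ}
    (hv : IsPrimitive G x v) : ∑ z, v z = 0 := by
  have h := sum_layer_one_mulVec hG hD hv.supp
  rw [Finset.sum_eq_zero, eq_comm, mul_eq_zero, Nat.cast_eq_zero] at h
  · exact h.resolve_left (cNum_pos hG (by omega) hD).ne'
  · intro y _
    split_ifs with hy
    · exact hv.ann y hy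
    · rfl

lemma top_eq_iSup_irreducible :
    (⊤ : Submodule ℂ (X → ℂ)) = sSup {W | IsIrreducibleTModule G x W} := by
  obtain ⟨m, Z, h1, -, h3⟩ := exists_orthogonal_family (isTModule_top (G := G) (x := x))
  rw [eq_comm, eq_top_iff, ← h3]
  exact iSup_le fun i => le_sSup (h1 i)

/-- An irreducible module that does not vanish on layer 1 has endpoint at most 1, and the
irreducible modules span everything. -/
lemma dualIdempotent_one_mulVec_mem (hc : G.Connected) (hD : 1 ≤ G.diam) (f : X → ℂ) :
    dualIdempotent G x 1 *ᵥ f ∈ endpointSpan G x 0 ⊔ endpointSpan G x 1 := by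
  have hle : (⊤ : Submodule ℂ (X → ℂ)) ≤
      (endpointSpan G x 0 ⊔ endpointSpan G x 1).comap (dualIdempotent G x 1).mulVecLin := by
    rw [top_eq_iSup_irreducible (G := G) (x := x)]
    refine sSup_le fun W hW w hw => ?_
    rw [Submodule.mem_comap, mulVecLin_apply]
    by_cases h0 : dualIdempotent G x 1 *ᵥ w = 0
    · rw [h0]; exact zero_mem _
    · have hle : endpoint G x W ≤ 1 := by
        refine endpoint_le hD fun h => h0 ?_
        have : dualIdempotent G x 1 *ᵥ w ∈ image (dualIdempotent G x 1) W := ⟨w, hw, rfl⟩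
        rw [h] at this
        exact this
      have hmem := hW.1 _ (dualIdempotent_mem hc 1) w hw
      rcases Nat.le_one_iff_eq_zero_or_eq_one.1 hle with h | h
      · exact Submodule.mem_sup_left ((le_sSup ⟨hW, h⟩ : W ≤ endpointSpan G x 0) hmem)
      · exact Submodule.mem_sup_right ((le_sSup ⟨hW, h⟩ : W ≤ endpointSpan G x 1) hmem)
  exact hle (Submodule.mem_top (x := f))

lemma isTModule_sSup {S : Set (Submodule ℂ (X → ℂ))} (hS : ∀ W ∈ S, IsTModule G x W) :
    IsTModule G x (sSup S) := by
  intro B hB w hw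
  have hle : sSup S ≤ (sSup S).comap B.mulVecLin :=
    sSup_le fun W hW w hw => (le_sSup hW : W ≤ _) (hS W hW B hB w hw)
  exact hle hw

lemma isTModule_endpointSpan (i : ℕ) : IsTModule G x (endpointSpan G x i) :=
  isTModule_sSup fun _ hW => hW.1.1

lemma isTModule_sup {V W : Submodule ℂ (X → ℂ)} (hV : IsTModule G x V) (hW : IsTModule G x W) :
    IsTModule G x (V ⊔ W) := by
  rw [← sSup_pair]
  apply isTModule_sSup
  rintro _ (rfl | rfl)
  exacts [hV, hW]

lemma IsPrimitive.hermitian_lowerSum_one {v : X → ℂ} (hv : IsPrimitive G x v) {u : X → ℂ}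
    (hu : ∀ y, G.dist x y ≠ 1 → u y = 0) : hermitian v (lowerSum G x 1 u) = 0 := by
  have h1 : hermitian v (lowerSum G x 1 u) = hermitian v (distMatrix ℂ G 1 *ᵥ u) := by
    refine Finset.sum_congr rfl fun y _ => ?_
    by_cases hy : G.dist x y = 2
    · rw [Pi.star_apply, Pi.star_apply, distMatrix_mulVec_apply, Finset.sum_filter, lowerSum]
      congr 2
      refine Finset.sum_congr rfl fun z _ => ?_
      exact if_congr (by omega) rfl rfl
    · simp [hv.supp y hy]
  rw [h1, ← distMatrix_conjTranspose, ← hermitian_mulVec_left]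
  refine Finset.sum_eq_zero fun y _ => ?_
  by_cases hy : G.dist x y = 1
  · rw [hv.ann y hy, zero_mul]
  · simp [hu y hy]

lemma hermitian_dualIdempotent_two {v : X → ℂ} (hv : ∀ y, G.dist x y ≠ 2 → v y = 0) (w : X → ℂ) :
    hermitian v (dualIdempotent G x 2 *ᵥ w) = hermitian v w := by
  rw [dualIdempotent_mulVec]
  refine Finset.sum_congr rfl fun y _ => ?_
  by_cases hy : G.dist x y = 2
  · simp [hy]
  · simp [hv y hy]

/-- Such a module contains the unit vector at `x`, so it is that vector's ladder and is constant on
layer 2, where `v` has sum zero. -/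
lemma IsPrimitive.hermitian_endpoint_zero (hG : IsDistanceRegularWith G p) (hbip : G.IsBipartite)
    (hD : 2 ≤ G.diam) {v : X → ℂ} (hv : IsPrimitive G x v) {W : Submodule ℂ (X → ℂ)}
    (hW : IsIrreducibleTModule G x W) (hend : endpoint G x W = 0) {w : X → ℂ} (hw : w ∈ W) :
    hermitian v w = 0 := by
  have hc := hG.connected
  have hL := isLadder_single (G := G) (x := x)
  obtain ⟨f, hf, hf0⟩ := Submodule.exists_mem_ne_zero_of_ne_bot
    (image_ne_bot_of_endpoint hc (x := x) hW.2.1)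
  rw [hend, mem_image_dualIdempotent hc hW.1] at hf
  have hfx : f = f x • Pi.single x 1 := by
    ext y
    by_cases hy : y = x
    · subst hy; simp
    · have : G.dist x y ≠ 0 := fun h => hy (hc.dist_eq_zero_iff.1 h).symm
      simp [hf.2 y this, hy]
  have hfx0 : f x ≠ 0 := by
    intro h
    rw [h, zero_smul] at hfx
    exact hf0 hfx
  have hmem : (Pi.single x 1 : X → ℂ) ∈ W := by
    have := W.smul_mem (f x)⁻¹ hf.1
    rwa [hfx, smul_smul, Pi.smul_apply, Pi.single_eq_same, smul_eq_mul, mul_one,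
      inv_mul_cancel₀ hfx0, one_smul] at this
  have hle := IsLadder.ladder_le hG hbip (by omega) (r := 0) hW.1 hmem
  have heq : ladder G x 0 (Pi.single x 1) = W := by
    refine (hW.2.2 _ hle (hL.isTModule hG hbip (by omega))).resolve_left fun h => ?_
    have h1 := hL.self_mem hc
    rw [h, Submodule.mem_bot] at h1
    simpa using congrFun h1 x
  rw [← heq] at hw
  obtain ⟨a, rfl⟩ := hw
  have h1 : ∀ y, v y * star (a (G.dist x y) * lowerSum G x 0 (Pi.single x 1) y) =
      v y * star (a 2) := by
    intro y
    by_cases hy : G.dist x y = 2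
    · have : lowerSum G x 0 (Pi.single x 1) y = 1 := by
        rw [lowerSum, Finset.sum_eq_single x]
        · simp [G.dist_comm (u := y)]
        · intro z _ hz
          simp [hz]
        · simp
      rw [hy, this, mul_one]
    · simp [hv.supp y hy]
  rw [hermitian, dotProduct]
  simp only [Pi.star_apply]
  rw [Finset.sum_congr rfl fun y _ => h1 y, ← Finset.sum_mul, hv.sum_eq_zero hG hD, zero_mul]

/-- Take `u` in layer 1 of the module. As the endpoint is 1, `A u` vanishes at `x`, so `u` has sum
zero and the module is its ladder; on layer 2 this is the line of `E*_2 A u`, orthogonal to `v`. -/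
lemma IsPrimitive.hermitian_endpoint_one (hG : IsDistanceRegularWith G p) (hbip : G.IsBipartite)
    (hD : 2 ≤ G.diam) {v : X → ℂ} (hv : IsPrimitive G x v) {W : Submodule ℂ (X → ℂ)}
    (hW : IsIrreducibleTModule G x W) (hend : endpoint G x W = 1) {w : X → ℂ} (hw : w ∈ W) :
    hermitian v w = 0 := by
  have hc := hG.connected
  obtain ⟨u, hu, hu0⟩ := Submodule.exists_mem_ne_zero_of_ne_bot
    (image_ne_bot_of_endpoint hc (x := x) hW.2.1)
  rw [hend, mem_image_dualIdempotent hc hW.1] at hu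
  have hsum : ∑ y, u y = 0 := by
    have h1 := apply_eq_zero_of_lt_endpoint hc (x := x) (hW.1 _ distMatrix_one_mem u hu.1)
      (y := x) (by rw [hend]; simp)
    rw [distMatrix_mulVec_apply, Finset.sum_filter] at h1
    rw [← h1]
    refine Finset.sum_congr rfl fun y _ => ?_
    split_ifs with hy
    · rfl
    · exact hu.2 y hy
  have hL := isLadder_of_sum_eq_zero hc hbip hu.2 hsum
  have hle := IsLadder.ladder_le hG hbip (by omega) (r := 1) hW.1 hu.1
  have heq : ladder G x 1 u = W := by
    refine (hW.2.2 _ hle (hL.isTModule hG hbip (by omega))).resolve_left fun h => ?_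
    have h1 := hL.self_mem hc
    rw [h, Submodule.mem_bot] at h1
    exact hu0 h1
  rw [← heq] at hw
  obtain ⟨a, rfl⟩ := hw
  have h1 : hermitian v (fun y => a (G.dist x y) * lowerSum G x 1 u y) =
      hermitian v (a 2 • lowerSum G x 1 u) := by
    refine Finset.sum_congr rfl fun y _ => ?_
    by_cases hy : G.dist x y = 2
    · simp [hy]
    · simp [hv.supp y hy]
  rw [h1, hermitian_smul_right, hv.hermitian_lowerSum_one hu.2, mul_zero]

lemma mem_spaceU_iff (hG : IsDistanceRegularWith G p) (hbip : G.IsBipartite) (hD : 2 ≤ G.diam)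
    {v : X → ℂ} : v ∈ spaceU G x ↔ IsPrimitive G x v := by
  have hc := hG.connected
  constructor
  · rintro ⟨h1, h2⟩
    have hsupp := ((mem_image_dualIdempotent hc isTModule_top).1 h1).2
    refine ⟨hsupp, fun y hy => ?_⟩
    -- Unit vectors of layer 1 lie in the span of the modules with endpoint 0 or 1. Applying `E*_2
    -- A` gives vectors orthogonal to `v`, and moving `A` across says that `A v` vanishes at `y`.
    have h3 := dualIdempotent_one_mulVec_mem (x := x) hc (by omega) (Pi.single y 1)
    have h4 := isTModule_sup (isTModule_endpointSpan 0) (isTModule_endpointSpan 1) _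
      (distMatrix_one_mem (G := G) (x := x)) _ h3
    have h5 : dualIdempotent G x 2 *ᵥ (distMatrix ℂ G 1 *ᵥ (dualIdempotent G x 1 *ᵥ Pi.single y 1))
        ∈ image (dualIdempotent G x 2) (endpointSpan G x 0) ⊔
          image (dualIdempotent G x 2) (endpointSpan G x 1) := by
      rw [image, image, ← Submodule.map_sup]
      exact ⟨_, h4, rfl⟩
    have h6 := h2 _ h5
    rw [hermitian_dualIdempotent_two hsupp, ← distMatrix_conjTranspose,
      ← hermitian_mulVec_left, ← dualIdempotent_conjTranspose, ← hermitian_mulVec_left,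
      dualIdempotent_mulVec, hermitian] at h6
    simpa [hy, dotProduct, Pi.single_apply] using h6
  · intro hv
    refine ⟨(mem_image_dualIdempotent hc isTModule_top).2 ⟨trivial, hv.supp⟩, ?_⟩
    have key : ∀ i, (∀ W, IsIrreducibleTModule G x W → endpoint G x W = i → ∀ w ∈ W,
        hermitian v w = 0) → endpointSpan G x i ≤ perp (Submodule.span ℂ {v}) := by
      intro i hi
      refine sSup_le fun W hW => le_perp_comm ?_
      rw [Submodule.span_singleton_le_iff_mem]
      exact hi W hW.1 hW.2
    have h0 := key 0 fun W hW he w hw => hv.hermitian_endpoint_zero hG hbip hD hW he hw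
    have h1 := key 1 fun W hW he w hw => hv.hermitian_endpoint_one hG hbip hD hW he hw
    intro w hw
    rw [image, image, ← Submodule.map_sup] at hw
    obtain ⟨w, hw, rfl⟩ := hw
    rw [mulVecLin_apply, hermitian_dualIdempotent_two hv.supp]
    exact hermitian_eq_zero_comm (sup_le h0 h1 hw v (Submodule.mem_span_singleton_self v))

/-! ### Vectors of `U` with an extremal local eigenvalue -/

/-- The part of `A_j v` in the layer `j`. -/
def middleSum (G : SimpleGraph X) (x : X) (v : X → ℂ) (y : X) : ℂ :=
  ∑ z, if G.dist y z = G.dist x y then v z else 0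

/-- Parity and the triangle inequality leave only the distances `j - 2`, `j`, `j + 2` from layer `j`
to layer 2. For `j < 2` the truncated index is harmless, the lower sum being empty. -/
lemma radial_mulVec_apply (hc : G.Connected) (hbip : G.IsBipartite) {v : X → ℂ}
    (hv : ∀ y, G.dist x y ≠ 2 → v y = 0) (g : ℕ → ℂ) (y : X) :
    (radial G g *ᵥ v) y = g (G.dist x y - 2) * lowerSum G x 2 v y +
      g (G.dist x y) * middleSum G x v y + g (G.dist x y + 2) * upperSum G x 2 v y := by
  rw [lowerSum, middleSum, upperSum, Finset.mul_sum, Finset.mul_sum, Finset.mul_sum,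
    ← Finset.sum_add_distrib, ← Finset.sum_add_distrib]
  refine Finset.sum_congr rfl fun z _ => ?_
  change g (G.dist y z) * v z = _
  by_cases hz : G.dist x z = 2
  · obtain ⟨r, hr⟩ := even_dist_add_dist_add_dist hc hbip x y z
    have t1 := hc.dist_triangle (u := x) (v := y) (w := z)
    have t2 := hc.dist_triangle (u := y) (v := x) (w := z)
    have t3 := hc.dist_triangle (u := x) (v := z) (w := y)
    rw [G.dist_comm (u := y) (v := x)] at t2
    rw [G.dist_comm (u := z) (v := y)] at t3
    have hcases : G.dist y z + 2 = G.dist x y ∨ G.dist y z = G.dist x y ∨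
        G.dist y z = G.dist x y + 2 := by omega
    rcases hcases with h | h | h
    · rw [if_pos h, if_neg (by omega), if_neg (by omega), ← h, Nat.add_sub_cancel]; ring
    · rw [if_neg (by omega), if_pos h, if_neg (by omega), h]; ring
    · rw [if_neg (by omega), if_neg (by omega), if_pos h, h]; ring
  · simp [hv z hz]

/-- The recurrence says that `A` acts on the cosine matrix as `θ`, so every polynomial in `A` acts
as a scalar; applied to the cosine matrix itself, this shows that its square is a multiple of it. -/
lemma exists_mul_radial_eq_smul (hG : IsDistanceRegularWith G p) (hbip : G.IsBipartite)
    (hD : 1 ≤ G.diam) {θ : ℝ} {u : ℕ → ℝ} (hu : IsCosine G p θ u) {B : Matrix X X ℂ}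
    (hB : B ∈ boseMesner G) :
    ∃ c : ℂ, B * radial G (fun i => (u i : ℂ)) = c • radial G (fun i => (u i : ℂ)) := by
  induction hB using Algebra.adjoin_induction with
  | mem B hB =>
    obtain rfl := hB
    refine ⟨θ, ?_⟩
    rw [distMatrix_one_mul_radial hG hbip hD, radial_smul]
    refine radial_congr hG.connected fun i hi => ?_
    have := congrArg (Complex.ofReal) (hu.step_eq i hi)
    simp only [step] at this ⊢
    push_cast at this
    simpa using this
  | algebraMap r =>
    exact ⟨r, by rw [Algebra.algebraMap_eq_smul_one, smul_mul_assoc, one_mul]⟩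
  | add a b _ _ ha hb =>
    obtain ⟨c, hc⟩ := ha
    obtain ⟨d, hd⟩ := hb
    exact ⟨c + d, by rw [add_mul, hc, hd, add_smul]⟩
  | mul a b _ _ ha hb =>
    obtain ⟨c, hc⟩ := ha
    obtain ⟨d, hd⟩ := hb
    exact ⟨d * c, by rw [mul_assoc, hd, mul_smul_comm, hc, smul_smul]⟩

lemma middleSum_eq {v : X → ℂ} (hv : ∀ y, G.dist x y ≠ 2 → v y = 0) {η : ℝ}
    (hη : localMatrix G x *ᵥ v = (η : ℂ) • v) {y : X} (hy : G.dist x y = 2) :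
    middleSum G x v y = η * v y := by
  have h1 : dualIdempotent G x 2 *ᵥ v = v := by
    rw [dualIdempotent_mulVec]
    ext z
    split_ifs with hz
    · rfl
    · exact (hv z hz).symm
  rw [localMatrix, ← mulVec_mulVec, h1, ← mulVec_mulVec, dualIdempotent_mulVec] at hη
  have := congrFun hη y
  simp only [hy, if_true, distMatrix_mulVec_apply, Pi.smul_apply, smul_eq_mul] at this
  rw [← this, middleSum, Finset.sum_filter, hy]

lemma radial_cosine_mulVec_eq_zero (hG : IsDistanceRegularWith G p) (hbip : G.IsBipartite)
    (hD : 2 ≤ G.diam) {θ η : ℝ} {u : ℕ → ℝ} (hu : IsCosine G p θ u)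
    (hid : 1 + η * u 2 - (1 + η) * u 4 = 0) {v : X → ℂ} (hv : IsPrimitive G x v)
    (hη : localMatrix G x *ᵥ v = (η : ℂ) • v) :
    radial G (fun i => (u i : ℂ)) *ᵥ v = 0 := by
  have hc := hG.connected
  set F := radial G (fun i => (u i : ℂ)) with hF
  have hFH : Fᴴ = F := by
    ext y z
    simp [hF, G.dist_comm (u := z)]
  have hlayer : ∀ y, G.dist x y = 2 → (F *ᵥ v) y = 0 := by
    intro y hy
    have h1 := radial_mulVec_apply hc hbip hv.supp (fun i => (u i : ℂ)) y
    have h2 := radial_mulVec_apply hc hbip hv.supp (fun _ => (1 : ℂ)) y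
    have h3 : (radial G (fun _ => (1 : ℂ)) *ᵥ v) y = 0 := by
      rw [← hv.sum_eq_zero hG hD]
      simp [mulVec, dotProduct]
    rw [h3, lowerSum_of_dist_eq hc hy, middleSum_eq hv.supp hη hy] at h2
    rw [lowerSum_of_dist_eq hc hy, middleSum_eq hv.supp hη hy, hy] at h1
    rw [hF, h1]
    have h4 := congrArg Complex.ofReal hid
    push_cast at h4
    simp only [Nat.sub_self, hu.zero, Complex.ofReal_one, Nat.reduceAdd]
    linear_combination (-(u 4 : ℂ)) * h2 + v y * h4
  obtain ⟨c, hcF⟩ := exists_mul_radial_eq_smul hG hbip (by omega) hu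
    (radial_mem_boseMesner hG hbip (by omega) (fun i => (u i : ℂ)))
  rw [← hF] at hcF
  rw [← hermitian_self_eq_zero, hermitian_mulVec_left, hFH, mulVec_mulVec, hcF, smul_mulVec,
    hermitian_smul_right]
  have : hermitian v (F *ᵥ v) = 0 := by
    refine Finset.sum_eq_zero fun y _ => ?_
    by_cases hy : G.dist x y = 2
    · simp [hlayer y hy]
    · rw [hv.supp y hy, zero_mul]
  rw [this, mul_zero]

lemma IsPrimitive.isLadder (hG : IsDistanceRegularWith G p) (hbip : G.IsBipartite)
    (hD : 2 ≤ G.diam) {θ η : ℝ} {u : ℕ → ℝ} (hu : IsCosine G p θ u)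
    (hne : ∀ j, j + 2 ≤ G.diam → u j ≠ u (j + 2))
    (hid : 1 + η * u 2 - (1 + η) * u 4 = 0) {v : X → ℂ} (hv : IsPrimitive G x v)
    (hη : localMatrix G x *ᵥ v = (η : ℂ) • v) : IsLadder G x 2 v := by
  have hc := hG.connected
  refine ⟨hv.supp, ?_⟩
  have hneC : ∀ j, j + 2 ≤ G.diam → (u j : ℂ) - u (j + 2) ≠ 0 := by
    intro j hj h
    exact hne j hj (by exact_mod_cast sub_eq_zero.1 h)
  have hsum : ∀ y, lowerSum G x 2 v y + middleSum G x v y + upperSum G x 2 v y = 0 := by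
    intro y
    have h2 := radial_mulVec_apply hc hbip hv.supp (fun _ => (1 : ℂ)) y
    have h3 : (radial G (fun _ => (1 : ℂ)) *ᵥ v) y = 0 := by
      rw [← hv.sum_eq_zero hG hD]
      simp [mulVec, dotProduct]
    rw [h3] at h2
    linear_combination -h2
  have hrel : ∀ y, ((u (G.dist x y - 2) : ℂ) - u (G.dist x y)) * lowerSum G x 2 v y =
      ((u (G.dist x y) : ℂ) - u (G.dist x y + 2)) * upperSum G x 2 v y := by
    intro y
    have h1 := radial_mulVec_apply hc hbip hv.supp (fun i => (u i : ℂ)) y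
    rw [radial_cosine_mulVec_eq_zero hG hbip hD hu hid hv hη, Pi.zero_apply] at h1
    linear_combination -h1 - (u (G.dist x y) : ℂ) * hsum y
  have hlow : ∀ y, G.dist x y < 2 → lowerSum G x 2 v y = 0 := fun y hy =>
    Finset.sum_eq_zero fun z _ => if_neg (by omega)
  -- In layer 0 the upper sum is the total of `v`. In layer 1 the middle sum is `(A v) y = 0`, so
  -- the upper sum is again the total.
  have hup : ∀ y, G.dist x y < 2 → upperSum G x 2 v y = 0 := by
    intro y hy
    obtain h | h : G.dist x y = 0 ∨ G.dist x y = 1 := by omega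
    · rw [← hv.sum_eq_zero hG hD, upperSum]
      obtain rfl := hc.dist_eq_zero_iff.1 h
      refine Finset.sum_congr rfl fun z _ => ?_
      by_cases hz : G.dist x z = 2
      · simp [hz]
      · simp [hv.supp z hz]
    · have h1 := hsum y
      have h2 : middleSum G x v y = 0 := by
        rw [← hv.ann y h, distMatrix_mulVec_apply, Finset.sum_filter, middleSum, h]
      rw [hlow y hy, h2] at h1
      simpa using h1
  -- For `j + 2 > D` there are no vertices at distance `j + 2`, so the upper sum is empty: this
  -- justifies `κ = 0` and makes the out-of-range `u (j + 2)` in `τ` irrelevant.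
  refine ⟨fun j => if 2 ≤ j then ((u j : ℂ) - u (j + 2)) / (u (j - 2) - u j) else 0,
    fun j => if 2 ≤ j ∧ j + 2 ≤ G.diam then ((u (j - 2) : ℂ) - u j) / (u j - u (j + 2)) else 0,
    fun y => ?_⟩
  have hy := dist_le_diam' hc x y
  rcases Nat.lt_or_ge (G.dist x y) 2 with h | h
  · rw [hlow y h, hup y h]; simp
  · have h1 := hneC (G.dist x y - 2) (by omega)
    rw [Nat.sub_add_cancel h] at h1
    constructor
    · simp only [if_pos h]
      field_simp
      linear_combination hrel y
    · by_cases h' : G.dist x y + 2 ≤ G.diam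
      · have h2 := hneC (G.dist x y) h'
        simp only [if_pos (And.intro h h')]
        field_simp
        linear_combination -hrel y
      · simp only [if_neg (fun hh : 2 ≤ G.dist x y ∧ G.dist x y + 2 ≤ G.diam => h' hh.2), zero_mul]
        refine Finset.sum_eq_zero fun z _ => if_neg ?_
        have := dist_le_diam' hc y z
        omega

/-! ### The multiplicity of the modules with a given local eigenvalue -/

lemma mem_eigenspaceU_iff (hG : IsDistanceRegularWith G p) (hbip : G.IsBipartite)
    (hD : 2 ≤ G.diam) {η : ℝ} {v : X → ℂ} :
    v ∈ eigenspaceU G x η ↔ IsPrimitive G x v ∧ localMatrix G x *ᵥ v = (η : ℂ) • v := by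
  rw [eigenspaceU, Submodule.mem_inf, mem_spaceU_iff hG hbip hD, Module.End.mem_eigenspace_iff,
    mulVecLin_apply]

lemma isPrimitive_iff {v : X → ℂ} : IsPrimitive G x v ↔
    (1 - dualIdempotent G x 2) *ᵥ v = 0 ∧ (dualIdempotent G x 1 * distMatrix ℂ G 1) *ᵥ v = 0 := by
  rw [sub_mulVec, one_mulVec, ← mulVec_mulVec, dualIdempotent_mulVec, dualIdempotent_mulVec,
    funext_iff, funext_iff]
  simp only [Pi.sub_apply, Pi.zero_apply]
  constructor
  · rintro ⟨h1, h2⟩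
    refine ⟨fun y => ?_, fun y => ?_⟩
    · split_ifs with h
      · exact sub_self _
      · rw [h1 y h, sub_zero]
    · split_ifs with h
      · exact h2 y h
      · rfl
  · rintro ⟨h1, h2⟩
    refine ⟨fun y hy => ?_, fun y hy => ?_⟩
    · simpa [hy] using h1 y
    · simpa [hy] using h2 y

/-- Membership in `U_η` only depends on the annihilator in `T`. -/
lemma mem_eigenspaceU_of_annihilator (hG : IsDistanceRegularWith G p) (hbip : G.IsBipartite)
    (hD : 2 ≤ G.diam) {η : ℝ} {v w : X → ℂ} (hv : v ∈ eigenspaceU G x η)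
    (h : ∀ B ∈ subconstituentAlgebra G x, B *ᵥ v = 0 → B *ᵥ w = 0) : w ∈ eigenspaceU G x η := by
  have hc := hG.connected
  rw [mem_eigenspaceU_iff hG hbip hD, isPrimitive_iff] at hv ⊢
  have h3 := h (localMatrix G x - (η : ℂ) • 1)
    (sub_mem (localMatrix_mem hG hbip (by omega)) (Subalgebra.smul_mem _ (one_mem _) _))
  rw [sub_mulVec, sub_mulVec, smul_mulVec, smul_mulVec, one_mulVec, one_mulVec, sub_eq_zero,
    sub_eq_zero] at h3
  exact ⟨⟨h _ (sub_mem (one_mem _) (dualIdempotent_mem hc 2)) hv.1.1,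
    h _ (mul_mem (dualIdempotent_mem hc 1) distMatrix_one_mem) hv.1.2⟩, h3 hv.2⟩

/-! ### Modules generated by the vectors of `U_η`. -/

section Ladders

variable {η : ℝ}

/-- `E*_2 B v` is a multiple of `v` for `B ∈ T` and `v` a ladder vector of the second layer. -/
lemma IsLadder.exists_smul {v : X → ℂ} (hv : IsLadder G x 2 v) (hG : IsDistanceRegularWith G p)
    (hbip : G.IsBipartite) (hD : 2 ≤ G.diam) {B : Matrix X X ℂ}
    (hB : B ∈ subconstituentAlgebra G x) :
    ∃ c : ℂ, dualIdempotent G x 2 *ᵥ (B *ᵥ v) = c • v :=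
  hv.eq_smul_of_mem hG.connected
    (hv.isTModule hG hbip (by omega) B hB v (hv.self_mem hG.connected))

/-- With `C = B* B`, both `w` and `v + w` are ladder vectors, so `E*_2 C w = a w` and `E*_2 C (v +
w) = b (v + w)`; as `C v = 0`, these agree. If `a = 0` then `‖B w‖² = ⟨w, C w⟩ = 0`; otherwise `w`
is a multiple of `v`. -/
lemma annihilator_le (hG : IsDistanceRegularWith G p) (hbip : G.IsBipartite) (hD : 2 ≤ G.diam)
    (hL : ∀ v ∈ eigenspaceU G x η, IsLadder G x 2 v) {v w : X → ℂ}
    (hv : v ∈ eigenspaceU G x η) (hw : w ∈ eigenspaceU G x η) (hv0 : v ≠ 0)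
    {B : Matrix X X ℂ} (hB : B ∈ subconstituentAlgebra G x) (h : B *ᵥ v = 0) : B *ᵥ w = 0 := by
  have hC : Bᴴ * B ∈ subconstituentAlgebra G x := mul_mem (conjTranspose_mem hB) hB
  obtain ⟨a, ha⟩ := (hL w hw).exists_smul hG hbip hD hC
  obtain ⟨b, hb⟩ := (hL _ (add_mem hv hw)).exists_smul hG hbip hD hC
  have hCv : (Bᴴ * B) *ᵥ v = 0 := by rw [← mulVec_mulVec, h, mulVec_zero]
  rw [mulVec_add, hCv, zero_add, ha] at hb
  by_cases hab : a = 0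
  · rw [← hermitian_self_eq_zero, hermitian_mulVec_left, mulVec_mulVec]
    rw [← hermitian_dualIdempotent_two (hL w hw).supp, ha, hab, zero_smul, hermitian_zero_right]
  · have hwv : ∃ c : ℂ, w = c • v := by
      by_cases h' : a = b
      · subst h'
        rw [smul_add] at hb
        have : a • v = 0 := by simpa using hb.symm
        exact absurd ((smul_eq_zero.1 this).resolve_left hab) hv0
      · refine ⟨(a - b)⁻¹ * b, ?_⟩
        rw [mul_smul, eq_inv_smul_iff₀ (sub_ne_zero.2 h'), sub_smul, hb, smul_add, add_sub_cancel_right]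
    obtain ⟨c, rfl⟩ := hwv
    rw [mulVec_smul, h, smul_zero]

/-- The map `B ↦ B v` on `T`. -/
def orbitMap (G : SimpleGraph X) (x : X) (v : X → ℂ) :
    subconstituentAlgebra G x →ₗ[ℂ] (X → ℂ) where
  toFun B := (B : Matrix X X ℂ) *ᵥ v
  map_add' _ _ := add_mulVec _ _ _
  map_smul' _ _ := smul_mulVec _ _ _

lemma range_orbitMap {W : Submodule ℂ (X → ℂ)} (hW : IsIrreducibleTModule G x W) {v : X → ℂ}
    (hv : v ∈ W) (hv0 : v ≠ 0) : LinearMap.range (orbitMap G x v) = W := by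
  refine (hW.2.2 _ ?_ ?_).resolve_left fun h => hv0 ?_
  · rintro _ ⟨B, rfl⟩
    exact hW.1 _ B.2 v hv
  · rintro B hB _ ⟨C, rfl⟩
    exact ⟨⟨B, hB⟩ * C, (mulVec_mulVec _ _ _).symm⟩
  · have : v ∈ LinearMap.range (orbitMap G x v) := ⟨1, one_mulVec v⟩
    rw [h] at this
    exact this

/-- Each module is cyclic on its given vector, hence is the quotient of `T` by that vector's
annihilator. -/
lemma tIsomorphic_of_annihilator {W W' : Submodule ℂ (X → ℂ)}
    (hW : IsIrreducibleTModule G x W) (hW' : IsIrreducibleTModule G x W') {v v' : X → ℂ}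
    (hv : v ∈ W) (hv' : v' ∈ W') (hv0 : v ≠ 0) (hv0' : v' ≠ 0)
    (h : ∀ B ∈ subconstituentAlgebra G x, B *ᵥ v = 0 ↔ B *ᵥ v' = 0) : TIsomorphic G x W W' := by
  have hker : LinearMap.ker (orbitMap G x v) = LinearMap.ker (orbitMap G x v') := by
    ext B
    exact h _ B.2
  have hR := range_orbitMap hW hv hv0
  have hR' := range_orbitMap hW' hv' hv0'
  let σ : W ≃ₗ[ℂ] W' := (LinearEquiv.ofEq _ _ hR.symm) ≪≫ₗ
    (orbitMap G x v).quotKerEquivRange.symm ≪≫ₗ (Submodule.quotEquivOfEq _ _ hker) ≪≫ₗ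
    (orbitMap G x v').quotKerEquivRange ≪≫ₗ (LinearEquiv.ofEq _ _ hR')
  have hσ : ∀ (C : subconstituentAlgebra G x) (w : W), (w : X → ℂ) = (C : Matrix X X ℂ) *ᵥ v →
      (σ w : X → ℂ) = (C : Matrix X X ℂ) *ᵥ v' := by
    intro C w hw
    have h1 : (orbitMap G x v).quotKerEquivRange.symm (LinearEquiv.ofEq _ _ hR.symm w) =
        Submodule.Quotient.mk C := by
      rw [LinearEquiv.symm_apply_eq]
      ext1
      rw [LinearMap.quotKerEquivRange_apply_mk]
      exact hw
    simp only [σ, LinearEquiv.trans_apply]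
    rw [h1, Submodule.quotEquivOfEq_mk, LinearEquiv.coe_ofEq_apply,
      LinearMap.quotKerEquivRange_apply_mk]
    rfl
  refine ⟨σ, fun B hB w w₁ hw => ?_⟩
  obtain ⟨C, hC⟩ : (w : X → ℂ) ∈ LinearMap.range (orbitMap G x v) := hR ▸ w.2
  have hC' : (w : X → ℂ) = (C : Matrix X X ℂ) *ᵥ v := hC.symm
  rw [hσ C w hC', hσ (⟨B, hB⟩ * C) w₁ (by rw [hw, hC', mulVec_mulVec]; rfl), mulVec_mulVec]
  rfl

lemma tIsomorphic_of_mem_eigenspaceU (hG : IsDistanceRegularWith G p) (hbip : G.IsBipartite)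
    (hD : 2 ≤ G.diam) (hL : ∀ v ∈ eigenspaceU G x η, IsLadder G x 2 v)
    {W W' : Submodule ℂ (X → ℂ)} (hW : IsIrreducibleTModule G x W)
    (hW' : IsIrreducibleTModule G x W') {v v' : X → ℂ} (hv : v ∈ W) (hv' : v' ∈ W')
    (hv0 : v ≠ 0) (hv0' : v' ≠ 0) (hU : v ∈ eigenspaceU G x η) (hU' : v' ∈ eigenspaceU G x η) :
    TIsomorphic G x W W' :=
  tIsomorphic_of_annihilator hW hW' hv hv' hv0 hv0' fun _ hB =>
    ⟨annihilator_le hG hbip hD hL hU hU' hv0 hB, annihilator_le hG hbip hD hL hU' hU hv0' hB⟩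

/-- A module isomorphic to one that meets `U_η` meets `U_η`. -/
lemma exists_mem_eigenspaceU_of_tIsomorphic (hG : IsDistanceRegularWith G p)
    (hbip : G.IsBipartite) (hD : 2 ≤ G.diam) {Z W : Submodule ℂ (X → ℂ)}
    (hZ : IsTModule G x Z) (h : TIsomorphic G x Z W) {w : X → ℂ} (hw : w ∈ W) (hw0 : w ≠ 0)
    (hU : w ∈ eigenspaceU G x η) : ∃ z ∈ Z, z ≠ 0 ∧ z ∈ eigenspaceU G x η := by
  obtain ⟨σ, hσ⟩ := h
  obtain ⟨z, hz⟩ := σ.surjective ⟨w, hw⟩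
  have hzw : (σ z : X → ℂ) = w := congrArg Subtype.val hz
  refine ⟨z, z.2, fun h0 => hw0 ?_, mem_eigenspaceU_of_annihilator hG hbip hD hU ?_⟩
  · have : z = 0 := Subtype.ext h0
    rw [← hzw, this, map_zero]
    rfl
  · intro B hB hBw
    have h1 := hσ B hB z ⟨B *ᵥ (z : X → ℂ), hZ B hB _ z.2⟩ rfl
    rw [hzw, hBw] at h1
    have h2 : σ ⟨B *ᵥ (z : X → ℂ), hZ B hB _ z.2⟩ = 0 := Subtype.ext h1
    rw [LinearEquiv.map_eq_zero_iff] at h2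
    exact congrArg Subtype.val h2

open Classical in
/-- In an orthogonal decomposition, the number of summands that meet `U_η` is `dim U_η`. -/
lemma card_meeting_eq_finrank (hG : IsDistanceRegularWith G p) (hbip : G.IsBipartite)
    (hD : 2 ≤ G.diam) (hL : ∀ v ∈ eigenspaceU G x η, IsLadder G x 2 v)
    {m : ℕ} {Z : Fin m → Submodule ℂ (X → ℂ)} (hZ : IsOrthogonalDecomposition G x Z) :
    (Finset.univ.filter fun i => ∃ z ∈ Z i, z ≠ 0 ∧ z ∈ eigenspaceU G x η).card =
      Module.finrank ℂ (eigenspaceU G x η) := by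
  have hc := hG.connected
  have hind : iSupIndep Z := hZ.direct_sum.submodule_iSupIndep
  have htop : ⨆ i, Z i = ⊤ := hZ.direct_sum.submodule_iSup_eq_top
  let N := {i // ∃ z ∈ Z i, z ≠ 0 ∧ z ∈ eigenspaceU G x η}
  let z : N → (X → ℂ) := fun i => i.2.choose
  have hz : ∀ i : N, z i ∈ Z i.1 ∧ z i ≠ 0 ∧ z i ∈ eigenspaceU G x η := fun i => i.2.choose_spec
  have hlin : LinearIndependent ℂ z :=
    (hind.comp Subtype.val_injective).linearIndependent _ (fun i => (hz i).1) (fun i => (hz i).2.1)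
  have hspan : Submodule.span ℂ (Set.range z) = eigenspaceU G x η := by
    apply le_antisymm
    · rw [Submodule.span_le]
      rintro _ ⟨i, rfl⟩
      exact (hz i).2.2
    · intro v hv
      have hvtop : v ∈ ⨆ i, Z i := htop ▸ Submodule.mem_top
      obtain ⟨f, hf, hfv⟩ := (Submodule.mem_iSup_iff_exists_finsupp Z v).1 hvtop
      rw [Finsupp.sum_fintype _ _ (fun _ => rfl)] at hfv
      -- The summands are orthogonal modules, so `‖B f_i‖² = ⟨B f_i, B v⟩`: whatever in `T` kills
      -- `v` kills its components.
      have hfU : ∀ i, f i ∈ eigenspaceU G x η := by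
        intro i
        refine mem_eigenspaceU_of_annihilator hG hbip hD hv fun B hB hBv => ?_
        rw [← hermitian_self_eq_zero]
        have h1 : hermitian (B *ᵥ f i) (B *ᵥ v) = hermitian (B *ᵥ f i) (B *ᵥ f i) := by
          rw [← hfv, ← mulVecLin_apply B (∑ j, f j), map_sum, hermitian, star_sum,
            dotProduct_sum]
          refine Finset.sum_eq_single i (fun j _ hj => ?_) (by simp)
          exact hZ.orthogonal i j hj.symm _ ((hZ.irreducible i).1 B hB _ (hf i)) _
            ((hZ.irreducible j).1 B hB _ (hf j))
        rw [← h1, hBv, hermitian_zero_right]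
      rw [← hfv]
      refine Submodule.sum_mem _ fun i _ => ?_
      by_cases h0 : f i = 0
      · rw [h0]; exact zero_mem _
      · let i' : N := ⟨i, f i, hf i, h0, hfU i⟩
        obtain ⟨h1, h2, h3⟩ := hz i'
        have hlad := hL _ h3
        have hle := IsLadder.ladder_le hG hbip (by omega) (hZ.irreducible i).1 h1 (r := 2)
        have heq := ((hZ.irreducible i).2.2 _ hle (hlad.isTModule hG hbip (by omega))).resolve_left
          (hlad.isIrreducible hG hbip (by omega) h2).2.1
        obtain ⟨c, hcz⟩ := hlad.eq_smul_of_mem hc (heq ▸ hf i)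
        rw [(hL _ (hfU i)).dualIdempotent_mulVec_self] at hcz
        rw [hcz]
        exact Submodule.smul_mem _ _ (Submodule.subset_span ⟨i', rfl⟩)
  have hcard := finrank_span_eq_card hlin
  rw [hspan, Fintype.card_subtype] at hcard
  exact hcard.symm

lemma exists_mem_of_isThinWithLocalEigenvalue (hG : IsDistanceRegularWith G p)
    (hbip : G.IsBipartite) (hD : 2 ≤ G.diam) {W : Submodule ℂ (X → ℂ)}
    (hW : IsThinWithLocalEigenvalue G x η W) :
    ∃ w ∈ W, w ≠ 0 ∧ w ∈ eigenspaceU G x η := by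
  have hc := hG.connected
  obtain ⟨w, hw, hw0⟩ := Submodule.exists_mem_ne_zero_of_ne_bot
    (image_ne_bot_of_endpoint hc (x := x) hW.irreducible.2.1)
  rw [hW.endpoint_eq] at hw
  have hloc := hW.local_eigenvalue w hw
  rw [mem_image_dualIdempotent hc hW.irreducible.1] at hw
  refine ⟨w, hw.1, hw0, (mem_eigenspaceU_iff hG hbip hD).2 ⟨⟨hw.2, fun y hy => ?_⟩, hloc⟩⟩
  exact apply_eq_zero_of_lt_endpoint hc (x := x) (hW.irreducible.1 _ distMatrix_one_mem w hw.1)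
    (by rw [hW.endpoint_eq]; omega)

lemma IsLadder.isThinWithLocalEigenvalue (hG : IsDistanceRegularWith G p)
    (hbip : G.IsBipartite) (hD : 2 ≤ G.diam) {v : X → ℂ} (hv : IsLadder G x 2 v) (hv0 : v ≠ 0)
    (hU : v ∈ eigenspaceU G x η) : IsThinWithLocalEigenvalue G x η (ladder G x 2 v) where
  irreducible := hv.isIrreducible hG hbip (by omega) hv0
  thin := IsLadder.isThin
  endpoint_eq := hv.endpoint_eq hG hbip (by omega) hD hv0
  local_eigenvalue := by
    rintro _ ⟨w, hw, rfl⟩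
    obtain ⟨c, hc⟩ := hv.eq_smul_of_mem hG.connected hw
    rw [mulVecLin_apply, hc, mulVec_smul, ((mem_eigenspaceU_iff hG hbip hD).1 hU).2, smul_comm]

lemma isMu_finrank (hG : IsDistanceRegularWith G p) (hbip : G.IsBipartite)
    (hD : 2 ≤ G.diam) (hL : ∀ v ∈ eigenspaceU G x η, IsLadder G x 2 v) :
    IsMu G x η (Module.finrank ℂ (eigenspaceU G x η)) := by
  classical
  refine ⟨fun W hW => ⟨exists_isOrthogonalDecomposition G x, fun m Z hZ => ?_⟩, fun h => ?_⟩
  · obtain ⟨w, hw, hw0, hwU⟩ := exists_mem_of_isThinWithLocalEigenvalue hG hbip hD hW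
    rw [← card_meeting_eq_finrank hG hbip hD hL hZ]
    congr 1
    ext i
    simp only [Finset.mem_filter, Finset.mem_univ, true_and]
    constructor
    · exact fun hi => exists_mem_eigenspaceU_of_tIsomorphic hG hbip hD (hZ.irreducible i).1 hi
        hw hw0 hwU
    · rintro ⟨z, hz, hz0, hzU⟩
      exact tIsomorphic_of_mem_eigenspaceU hG hbip hD hL (hZ.irreducible i) hW.irreducible hz hw
        hz0 hw0 hzU hwU
  · by_contra hne
    have hbot : eigenspaceU G x η ≠ ⊥ := by
      intro hb
      rw [hb, finrank_bot] at hne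
      exact hne rfl
    obtain ⟨v, hv, hv0⟩ := Submodule.exists_mem_ne_zero_of_ne_bot hbot
    exact h ⟨_, (hL v hv).isThinWithLocalEigenvalue hG hbip hD hv0 hv⟩

end Ladders

/-! ### Multiplicities of eigenvalues of Hermitian matrices -/

open Polynomial Unitary in
-- Unitary diagonalization identifies both sides with the number of diagonal entries equal to `t`.
lemma count_roots_charpoly_eq_finrank {n : Type*} [Fintype n] [DecidableEq n] {H : Matrix n n ℂ}
    (hH : H.IsHermitian) (t : ℝ) :
    H.charpoly.roots.count (t : ℂ) =
      Module.finrank ℂ (Module.End.eigenspace H.mulVecLin (t : ℂ)) := by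
  classical
  have h1 : H.charpoly.roots.count (t : ℂ) = Fintype.card {i // hH.eigenvalues i = t} := by
    rw [hH.roots_charpoly_eq_eigenvalues, Multiset.count_map, Fintype.card_subtype, Finset.card_def,
      Finset.filter_val]
    congr 1
    refine Multiset.filter_congr fun i _ => ?_
    simp [eq_comm]
  have h2 : (H - (t : ℂ) • 1).rank = Fintype.card {i // hH.eigenvalues i ≠ t} := by
    have h3 : H - (t : ℂ) • 1 = conjStarAlgAut ℂ _ hH.eigenvectorUnitary
        (diagonal (fun i => (hH.eigenvalues i : ℂ) - t)) := by
      have h4 : (diagonal (fun i => (hH.eigenvalues i : ℂ) - t) : Matrix n n ℂ) =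
          diagonal (RCLike.ofReal ∘ hH.eigenvalues) - (t : ℂ) • 1 := by
        rw [smul_one_eq_diagonal, diagonal_sub]
        rfl
      rw [h4, map_sub, map_smul, map_one, ← hH.spectral_theorem]
    rw [h3, conjStarAlgAut_apply, ← coe_star]
    simp [-isUnit_iff_ne_zero, -coe_star, rank_diagonal, sub_eq_zero]
  have h5 : Module.End.eigenspace H.mulVecLin (t : ℂ) =
      LinearMap.ker (H - (t : ℂ) • 1).mulVecLin := by
    ext v
    rw [Module.End.mem_eigenspace_iff, LinearMap.mem_ker, mulVecLin_apply, mulVecLin_apply,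
      sub_mulVec, smul_mulVec, one_mulVec, sub_eq_zero]
  have h6 := LinearMap.finrank_range_add_finrank_ker (H - (t : ℂ) • 1).mulVecLin
  have h7 : Fintype.card {i // hH.eigenvalues i ≠ t} =
      Fintype.card n - Fintype.card {i // hH.eigenvalues i = t} := by
    convert Fintype.card_subtype_compl (fun i => hH.eigenvalues i = t)
  have h8 := Fintype.card_subtype_le (fun i => hH.eigenvalues i = t)
  change (H - (t : ℂ) • 1).rank + _ = _ at h6
  rw [h2, h7, Module.finrank_fintype_fun_eq_card] at h6
  rw [h1, h5]
  omega

/-- The vectors of the second layer with `E*_2 A_2 E*_2 v = t v`. -/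
def localEigenspace (G : SimpleGraph X) (x : X) (t : ℝ) : Submodule ℂ (X → ℂ) :=
  image (dualIdempotent G x 2) ⊤ ⊓ Module.End.eigenspace (localMatrix G x).mulVecLin (t : ℂ)

lemma mem_localEigenspace (hc : G.Connected) {t : ℝ} {v : X → ℂ} :
    v ∈ localEigenspace G x t ↔
      (∀ y, G.dist x y ≠ 2 → v y = 0) ∧ localMatrix G x *ᵥ v = (t : ℂ) • v := by
  rw [localEigenspace, Submodule.mem_inf, mem_image_dualIdempotent hc isTModule_top,
    Module.End.mem_eigenspace_iff, mulVecLin_apply]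
  simp

lemma localMatrix_mulVec_apply (v : X → ℂ) (y : X) :
    (localMatrix G x *ᵥ v) y =
      if G.dist x y = 2 then ∑ z, if G.dist x z = 2 ∧ G.dist y z = 2 then v z else 0 else 0 := by
  rw [localMatrix, ← mulVec_mulVec, ← mulVec_mulVec, dualIdempotent_mulVec, dualIdempotent_mulVec]
  refine if_congr Iff.rfl ?_ rfl
  rw [distMatrix_mulVec_apply, Finset.sum_filter]
  refine Finset.sum_congr rfl fun z _ => ?_
  by_cases h : G.dist x z = 2 <;> by_cases h' : G.dist y z = 2 <;> simp [h, h']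

/-- Extension by zero from the second layer. -/
def extendLayer (G : SimpleGraph X) (x : X) : ({y : X // G.dist x y = 2} → ℂ) →ₗ[ℂ] (X → ℂ) where
  toFun v y := if h : G.dist x y = 2 then v ⟨y, h⟩ else 0
  map_add' u v := by ext y; by_cases h : G.dist x y = 2 <;> simp [h]
  map_smul' c v := by ext y; by_cases h : G.dist x y = 2 <;> simp [h]

open Classical in
lemma adjMatrix_localGraph_mulVec (v : {y : X // G.dist x y = 2} → ℂ) (y : X)
    (hy : G.dist x y = 2) :
    ((localGraph G x).adjMatrix ℂ *ᵥ v) ⟨y, hy⟩ = (localMatrix G x *ᵥ extendLayer G x v) y := by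
  rw [localMatrix_mulVec_apply, if_pos hy]
  have h : ∀ z, (if G.dist x z = 2 ∧ G.dist y z = 2 then extendLayer G x v z else 0) =
      if hz : G.dist x z = 2 then (if G.dist y z = 2 then v ⟨z, hz⟩ else 0) else 0 := by
    intro z
    by_cases hz : G.dist x z = 2 <;> simp [hz, extendLayer]
  rw [Finset.sum_congr rfl fun z _ => h z, Finset.sum_dite, Finset.sum_const_zero, add_zero,
    mulVec, dotProduct]
  refine Finset.sum_bij (fun z _ => ⟨z.1, by simpa using z.2⟩) ?_ ?_ ?_ ?_
  · intro z _; simp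
  · intro a _ b _ hab
    simpa [Subtype.ext_iff] using hab
  · rintro ⟨z, hz⟩ _
    exact ⟨⟨z, by simpa using hz⟩, by simp, rfl⟩
  · rintro ⟨z, hz⟩ _
    have hadj : (localGraph G x).Adj ⟨y, hy⟩ ⟨z, by simpa using hz⟩ ↔ G.dist y z = 2 := Iff.rfl
    rw [SimpleGraph.adjMatrix_apply]
    by_cases h' : G.dist y z = 2 <;> simp [hadj, h']

lemma count_localSpectrum (hc : G.Connected) (t : ℝ) :
    (localSpectrum G x).count t = Module.finrank ℂ (localEigenspace G x t) := by
  classical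
  set N := (localGraph G x).adjMatrix ℝ with hN
  have hmap : N.map Complex.ofRealHom = (localGraph G x).adjMatrix ℂ := by
    ext y z
    simp [hN, SimpleGraph.adjMatrix_apply, apply_ite]
  have hNH : N.IsHermitian := SimpleGraph.isHermitian_adjMatrix ..
  have hH : ((localGraph G x).adjMatrix ℂ).IsHermitian := SimpleGraph.isHermitian_adjMatrix ..
  have h1 : (localSpectrum G x).count t =
      ((localGraph G x).adjMatrix ℂ).charpoly.roots.count (t : ℂ) := by
    rw [← hmap, charpoly_map, hNH.splits_charpoly.roots_map]
    have := Multiset.count_map_eq_count' Complex.ofRealHom N.charpoly.roots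
      Complex.ofReal_injective t
    rw [localSpectrum, ← Multiset.count_map_eq_count' Complex.ofRealHom _
      Complex.ofReal_injective t]
    simp [hN]
  rw [h1, count_roots_charpoly_eq_finrank hH]
  have hinj : Function.Injective (extendLayer G x) := by
    intro u v huv
    ext ⟨y, hy⟩
    simpa [extendLayer, hy] using congrFun huv y
  have hmapE : (Module.End.eigenspace ((localGraph G x).adjMatrix ℂ).mulVecLin (t : ℂ)).map
      (extendLayer G x) = localEigenspace G x t := by
    ext w
    rw [mem_localEigenspace hc, Submodule.mem_map]
    constructor
    · rintro ⟨v, hv, rfl⟩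
      rw [Module.End.mem_eigenspace_iff, mulVecLin_apply] at hv
      refine ⟨fun y hy => by simp [extendLayer, hy], ?_⟩
      ext y
      by_cases hy : G.dist x y = 2
      · rw [← adjMatrix_localGraph_mulVec v y hy, hv]
        simp [extendLayer, hy]
      · rw [localMatrix_mulVec_apply, if_neg hy]
        simp [extendLayer, hy]
    · rintro ⟨hw, hwt⟩
      have hext : extendLayer G x (fun y => w y.1) = w := by
        ext y
        by_cases hy : G.dist x y = 2
        · simp [extendLayer, hy]
        · simp [extendLayer, hy, hw y hy]
      refine ⟨fun y => w y.1, ?_, hext⟩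
      rw [Module.End.mem_eigenspace_iff, mulVecLin_apply]
      ext ⟨y, hy⟩
      rw [adjMatrix_localGraph_mulVec _ y hy, hext, hwt]
      rfl
  rw [← hmapE]
  exact (Submodule.equivMapOfInjective _ hinj _).finrank_eq

/-! ### The local eigenspaces -/

/-- Two-step paths from layer 1 to layer 2 through the second layer. -/
lemma card_paths_one_two (hG : IsDistanceRegularWith G p) (hbip : G.IsBipartite)
    (hD : 3 ≤ G.diam) {w y : X} (hw : G.dist x w = 1) (hy : G.dist x y = 2) :
    ((Finset.univ.filter fun z => G.dist w z = 1 ∧ G.dist x z = 2 ∧ G.dist z y = 2).card : ℂ) =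
      ((bNum G p 3 : ℂ) - 1) * (if G.dist w y = 1 then 1 else 0) + ((cNum G p 3 : ℂ) - 1) := by
  have hc := hG.connected
  have hins : (Finset.univ.filter fun z => G.dist w z = 1 ∧ G.dist z y = 2) =
      insert x (Finset.univ.filter fun z => G.dist w z = 1 ∧ G.dist x z = 2 ∧ G.dist z y = 2) := by
    ext z
    simp only [Finset.mem_filter, Finset.mem_univ, true_and, Finset.mem_insert]
    constructor
    · rintro ⟨h1, h2⟩
      have := dist_step hc hbip h1 x
      rw [G.dist_comm (u := z) (v := x), G.dist_comm (u := w) (v := x), hw] at this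
      rcases this with h | h
      · exact Or.inr ⟨h1, h, h2⟩
      · exact Or.inl (hc.dist_eq_zero_iff.1 (by omega)).symm
    · rintro (rfl | ⟨h1, -, h2⟩)
      · exact ⟨by rw [G.dist_comm, hw], hy⟩
      · exact ⟨h1, h2⟩
  have hcard := congrArg Finset.card hins
  rw [Finset.card_insert_of_notMem (by simp)] at hcard
  have k1 := bNum_add_cNum hG hbip (by omega) (i := 1) (by omega)
  have k3 := bNum_add_cNum hG hbip (by omega) (i := 3) (by omega)
  rw [cNum_one hG (by omega)] at k1
  have hwy := dist_step hc hbip hw y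
  rw [hy] at hwy
  rcases hwy with h | h
  · rw [if_neg (by omega)]
    have h1 := card_down hG (by omega) w y
    rw [h] at h1
    rw [← h1]
    have h2 : (Finset.univ.filter fun z => G.dist w z = 1 ∧ G.dist z y + 1 = 2 + 1) =
        Finset.univ.filter fun z => G.dist w z = 1 ∧ G.dist z y = 2 :=
      Finset.filter_congr fun z _ => by omega
    rw [h2, hcard]
    push_cast; ring
  · have hw1 : G.dist w y = 1 := by omega
    rw [if_pos hw1]
    have h1 := card_up hG (by omega) w y
    rw [hw1] at h1
    rw [h1] at hcard
    have h2 : (Finset.univ.filter fun z =>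
      G.dist w z = 1 ∧ G.dist x z = 2 ∧ G.dist z y = 2).card + 2 =
        cNum G p 3 + bNum G p 3 := by omega
    have h3 := congrArg (Nat.cast : ℕ → ℂ) h2
    push_cast at h3
    linear_combination h3

/-- Two-step paths from layer 1 to layer 1 through the second layer. -/
lemma card_paths_one_one (hG : IsDistanceRegularWith G p) (hbip : G.IsBipartite)
    (hD : 3 ≤ G.diam) {w y : X} (hw : G.dist x w = 1) (hy : G.dist x y = 1) :
    ((Finset.univ.filter fun z => G.dist w z = 1 ∧ G.dist x z = 2 ∧ G.dist z y = 1).card : ℂ) =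
      (bNum G p 2 : ℂ) * (if w = y then 1 else 0) + ((cNum G p 2 : ℂ) - 1) := by
  have hc := hG.connected
  have hins : (Finset.univ.filter fun z => G.dist w z = 1 ∧ G.dist z y = 1) =
      insert x (Finset.univ.filter fun z => G.dist w z = 1 ∧ G.dist x z = 2 ∧ G.dist z y = 1) := by
    ext z
    simp only [Finset.mem_filter, Finset.mem_univ, true_and, Finset.mem_insert]
    constructor
    · rintro ⟨h1, h2⟩
      have := dist_step hc hbip h1 x
      rw [G.dist_comm (u := z) (v := x), G.dist_comm (u := w) (v := x), hw] at this
      rcases this with h | h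
      · exact Or.inr ⟨h1, h, h2⟩
      · exact Or.inl (hc.dist_eq_zero_iff.1 (by omega)).symm
    · rintro (rfl | ⟨h1, -, h2⟩)
      · exact ⟨by rw [G.dist_comm, hw], hy⟩
      · exact ⟨h1, h2⟩
  have hcard := congrArg Finset.card hins
  rw [Finset.card_insert_of_notMem (by simp)] at hcard
  have k0 := bNum_add_cNum hG hbip (by omega) (i := 0) (by omega)
  have k2 := bNum_add_cNum hG hbip (by omega) (i := 2) (by omega)
  rw [cNum_zero] at k0
  have hwy := dist_step hc hbip hw y
  rw [hy] at hwy
  rcases hwy with h | h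
  · have hne : w ≠ y := by rintro rfl; simp at h
    rw [if_neg hne]
    have h1 := card_down hG (by omega) w y
    rw [h] at h1
    rw [← h1]
    have h2 : (Finset.univ.filter fun z => G.dist w z = 1 ∧ G.dist z y + 1 = 1 + 1) =
        Finset.univ.filter fun z => G.dist w z = 1 ∧ G.dist z y = 1 :=
      Finset.filter_congr fun z _ => by omega
    rw [h2, hcard]
    push_cast; ring
  · have hw0 : G.dist w y = 0 := by omega
    rw [if_pos (hc.dist_eq_zero_iff.1 hw0)]
    have h1 := card_up hG (by omega) w y
    rw [hw0, zero_add] at h1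
    rw [h1] at hcard
    have h2 : (Finset.univ.filter fun z =>
      G.dist w z = 1 ∧ G.dist x z = 2 ∧ G.dist z y = 1).card + 1 =
        cNum G p 2 + bNum G p 2 := by omega
    have h3 := congrArg (Nat.cast : ℕ → ℂ) h2
    push_cast at h3
    linear_combination h3

/-- The all-ones vector of the layer `i`. -/
def layerOnes (G : SimpleGraph X) (x : X) (i : ℕ) (y : X) : ℂ := if G.dist x y = i then 1 else 0

/-- The map `E*_2 A`. -/
def up (G : SimpleGraph X) (x : X) : (X → ℂ) →ₗ[ℂ] (X → ℂ) :=
  (dualIdempotent G x 2 * distMatrix ℂ G 1).mulVecLin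

/-- The map `E*_1 A`. -/
def down (G : SimpleGraph X) (x : X) : (X → ℂ) →ₗ[ℂ] (X → ℂ) :=
  (dualIdempotent G x 1 * distMatrix ℂ G 1).mulVecLin

lemma up_apply (u : X → ℂ) (y : X) :
    up G x u y = if G.dist x y = 2 then ∑ w, (if G.dist y w = 1 then u w else 0) else 0 := by
  rw [up, mulVecLin_apply, ← mulVec_mulVec, dualIdempotent_mulVec]
  simp only [distMatrix_mulVec_apply, Finset.sum_filter]

lemma down_apply (v : X → ℂ) (w : X) :
    down G x v w = if G.dist x w = 1 then ∑ y, (if G.dist w y = 1 then v y else 0) else 0 := by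
  rw [down, mulVecLin_apply, ← mulVec_mulVec, dualIdempotent_mulVec]
  simp only [distMatrix_mulVec_apply, Finset.sum_filter]

lemma down_up (hG : IsDistanceRegularWith G p) (hbip : G.IsBipartite)
    (hD : 3 ≤ G.diam) {u : X → ℂ} (hu : ∀ y, G.dist x y ≠ 1 → u y = 0) :
    down G x (up G x u) = (bNum G p 2 : ℂ) • u + (((cNum G p 2 : ℂ) - 1) * ∑ y, u y) •
      layerOnes G x 1 := by
  ext w
  rw [down_apply]
  by_cases hw : G.dist x w = 1
  · have h1 : ∀ z, (if G.dist w z = 1 then up G x u z else 0) =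
        ∑ y, (if G.dist w z = 1 ∧ G.dist x z = 2 ∧ G.dist z y = 1 then 1 else 0) * u y := by
      intro z
      rw [up_apply]
      by_cases a : G.dist w z = 1
      · by_cases b : G.dist x z = 2
        · simp only [a, b, if_true, true_and, ite_mul, one_mul, zero_mul]
        · simp [a, b]
      · simp [a]
    have h2 : ∀ y, (∑ z, (if G.dist w z = 1 ∧ G.dist x z = 2 ∧ G.dist z y = 1 then (1 : ℂ) else 0)
        * u y) = (bNum G p 2 : ℂ) * (if w = y then u y else 0) + ((cNum G p 2 : ℂ) - 1) * u y := by
      intro y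
      by_cases hy : G.dist x y = 1
      · rw [← Finset.sum_mul, Finset.sum_boole, card_paths_one_one hG hbip hD hw hy]
        split_ifs <;> ring
      · simp [hu y hy]
    rw [if_pos hw, Finset.sum_congr rfl fun z _ => h1 z, Finset.sum_comm,
      Finset.sum_congr rfl fun y _ => h2 y, Finset.sum_add_distrib, ← Finset.mul_sum,
      ← Finset.mul_sum, Finset.sum_ite_eq]
    simp [layerOnes, hw]
  · simp [hw, hu w hw, layerOnes]

/-- Exchange the sums and insert the count of `card_paths_one_two`. On sum-zero vectors the second
term drops out, which is where the local eigenvalue `b_3 - 1` comes from. -/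
lemma localMatrix_up (hG : IsDistanceRegularWith G p) (hbip : G.IsBipartite)
    (hD : 3 ≤ G.diam) {u : X → ℂ} (hu : ∀ y, G.dist x y ≠ 1 → u y = 0) :
    localMatrix G x *ᵥ up G x u = ((bNum G p 3 : ℂ) - 1) • up G x u +
      (((cNum G p 3 : ℂ) - 1) * ∑ y, u y) • layerOnes G x 2 := by
  ext y
  rw [localMatrix_mulVec_apply]
  by_cases hy : G.dist x y = 2
  · have h1 : ∀ z, (if G.dist x z = 2 ∧ G.dist y z = 2 then up G x u z else 0) =
        ∑ w, (if G.dist w z = 1 ∧ G.dist x z = 2 ∧ G.dist z y = 2 then 1 else 0) * u w := by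
      intro z
      rw [up_apply, G.dist_comm (u := z) (v := y)]
      by_cases a : G.dist y z = 2
      · by_cases b : G.dist x z = 2
        · simp only [a, b, if_true, and_true, ite_mul, one_mul, zero_mul]
          exact Finset.sum_congr rfl fun w _ => by rw [G.dist_comm]
        · simp [a, b]
      · simp [a]
    have h2 : ∀ w, (∑ z, (if G.dist w z = 1 ∧ G.dist x z = 2 ∧ G.dist z y = 2 then (1 : ℂ) else 0)
        * u w) = ((bNum G p 3 : ℂ) - 1) * (if G.dist y w = 1 then u w else 0) +
          ((cNum G p 3 : ℂ) - 1) * u w := by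
      intro w
      by_cases hw : G.dist x w = 1
      · rw [← Finset.sum_mul, Finset.sum_boole, card_paths_one_two hG hbip hD hw hy,
          G.dist_comm (u := w)]
        split_ifs <;> ring
      · simp [hu w hw]
    rw [if_pos hy, Finset.sum_congr rfl fun z _ => h1 z, Finset.sum_comm,
      Finset.sum_congr rfl fun y _ => h2 y, Finset.sum_add_distrib, ← Finset.mul_sum,
      ← Finset.mul_sum]
    simp [layerOnes, hy, up_apply]
  · simp [hy, layerOnes, up_apply]

lemma down_localMatrix (hG : IsDistanceRegularWith G p) (hbip : G.IsBipartite)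
    (hD : 3 ≤ G.diam) {v : X → ℂ} (hv : ∀ y, G.dist x y ≠ 2 → v y = 0) :
    down G x (localMatrix G x *ᵥ v) = ((bNum G p 3 : ℂ) - 1) • down G x v +
      (((cNum G p 3 : ℂ) - 1) * ∑ y, v y) • layerOnes G x 1 := by
  ext w
  rw [down_apply]
  by_cases hw : G.dist x w = 1
  · have h1 : ∀ z, (if G.dist w z = 1 then (localMatrix G x *ᵥ v) z else 0) =
        ∑ y, (if G.dist w z = 1 ∧ G.dist x z = 2 ∧ G.dist z y = 2 then 1 else 0) * v y := by
      intro z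
      rw [localMatrix_mulVec_apply]
      by_cases a : G.dist w z = 1
      · by_cases b : G.dist x z = 2
        · simp only [a, b, if_true, true_and]
          refine Finset.sum_congr rfl fun y _ => ?_
          by_cases hy : G.dist x y = 2
          · simp [hy]
          · simp [hv y hy]
        · simp [a, b]
      · simp [a]
    have h2 : ∀ y, (∑ z, (if G.dist w z = 1 ∧ G.dist x z = 2 ∧ G.dist z y = 2 then (1 : ℂ) else 0)
        * v y) = ((bNum G p 3 : ℂ) - 1) * (if G.dist w y = 1 then v y else 0) +
          ((cNum G p 3 : ℂ) - 1) * v y := by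
      intro y
      by_cases hy : G.dist x y = 2
      · rw [← Finset.sum_mul, Finset.sum_boole, card_paths_one_two hG hbip hD hw hy]
        split_ifs <;> ring
      · simp [hv y hy]
    rw [if_pos hw, Finset.sum_congr rfl fun z _ => h1 z, Finset.sum_comm,
      Finset.sum_congr rfl fun y _ => h2 y, Finset.sum_add_distrib, ← Finset.mul_sum,
      ← Finset.mul_sum]
    simp [layerOnes, hw, down_apply]
  · simp [hw, layerOnes, down_apply]

lemma down_layerOnes (hG : IsDistanceRegularWith G p) (hD : 3 ≤ G.diam) : down G x (layerOnes G x 2) = (bNum G p 1 : ℂ) • layerOnes G x 1 := by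
  ext w
  rw [down_apply]
  by_cases hw : G.dist x w = 1
  · rw [if_pos hw]
    have h1 := card_up hG (by omega) w x
    rw [G.dist_comm (u := w) (v := x), hw] at h1
    simp only [layerOnes, Pi.smul_apply, hw, if_true, smul_eq_mul, mul_one]
    rw [← h1, Finset.card_filter]
    push_cast
    refine Finset.sum_congr rfl fun y _ => ?_
    rw [G.dist_comm (u := y) (v := x)]
    by_cases a : G.dist w y = 1 <;> by_cases b : G.dist x y = 2 <;> simp [a, b]
  · simp [hw, layerOnes]

lemma localMatrix_layerOnes (hG : IsDistanceRegularWith G p) (hD : 3 ≤ G.diam)  :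
    localMatrix G x *ᵥ layerOnes G x 2 = (p 2 2 2 : ℂ) • layerOnes G x 2 := by
  ext y
  rw [localMatrix_mulVec_apply]
  by_cases hy : G.dist x y = 2
  · rw [if_pos hy, ← hG.card_eq 2 2 2 (by omega) (by omega) (by omega) x y hy, Finset.card_filter]
    simp only [layerOnes, Pi.smul_apply, hy, if_true, smul_eq_mul, mul_one]
    push_cast
    refine Finset.sum_congr rfl fun z _ => ?_
    rw [G.dist_comm (u := z) (v := y)]
    by_cases a : G.dist y z = 2 <;> by_cases b : G.dist x z = 2 <;> simp [a, b]
  · simp [hy, layerOnes]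

lemma sum_layerOnes_one (hG : IsDistanceRegularWith G p) (hD : 3 ≤ G.diam)  : ∑ y, layerOnes G x 1 y = p 0 1 1 := by
  rw [← card_dist_eq hG (by omega : 1 ≤ G.diam) x, Finset.card_filter]
  simp [layerOnes]

/-- The vectors of the first layer whose entries sum to zero. -/
def sumZero (G : SimpleGraph X) (x : X) : Submodule ℂ (X → ℂ) :=
  image (dualIdempotent G x 1) ⊤ ⊓ LinearMap.ker (∑ y : X, LinearMap.proj y : (X → ℂ) →ₗ[ℂ] ℂ)

lemma mem_sumZero (hc : G.Connected) {u : X → ℂ} :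
    u ∈ sumZero G x ↔ (∀ y, G.dist x y ≠ 1 → u y = 0) ∧ ∑ y, u y = 0 := by
  rw [sumZero, Submodule.mem_inf, mem_image_dualIdempotent hc isTModule_top, LinearMap.mem_ker]
  simp [LinearMap.sum_apply]

lemma layerOnes_eq_zero {i : ℕ} {y : X} (hy : G.dist x y ≠ i) : layerOnes G x i y = 0 :=
  if_neg hy

lemma finrank_sumZero (hG : IsDistanceRegularWith G p) (hD : 3 ≤ G.diam) (hk : 0 < p 0 1 1) :
    Module.finrank ℂ (sumZero G x) = p 0 1 1 - 1 := by
  have hc := hG.connected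
  set φ : (X → ℂ) →ₗ[ℂ] ℂ := ∑ y : X, LinearMap.proj y with hφ
  set L := image (dualIdempotent G x 1) ⊤ with hL
  have hLk : Module.finrank ℂ L = p 0 1 1 := by
    have h1 : Module.finrank ℂ L = (dualIdempotent G x 1).rank := by
      rw [hL, image, Submodule.map_top]; rfl
    rw [h1, dualIdempotent, rank_diagonal, ← card_dist_eq hG (by omega : 1 ≤ G.diam) x,
      Fintype.card_subtype]
    congr 1
    ext y
    simp
  have hmap : (LinearMap.ker (φ ∘ₗ L.subtype)).map L.subtype = sumZero G x := by
    rw [LinearMap.ker_comp, Submodule.map_comap_subtype, sumZero]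
  have h2 := LinearMap.finrank_range_add_finrank_ker (φ ∘ₗ L.subtype)
  have h3 : LinearMap.range (φ ∘ₗ L.subtype) = ⊤ := by
    refine LinearMap.range_eq_top.2 fun c => ?_
    have hmem : layerOnes G x 1 ∈ L :=
      (mem_image_dualIdempotent hc isTModule_top).2 ⟨trivial, fun y hy => layerOnes_eq_zero hy⟩
    refine ⟨(c / p 0 1 1) • ⟨_, hmem⟩, ?_⟩
    have hs : φ (layerOnes G x 1) = p 0 1 1 := by
      rw [← sum_layerOnes_one hG hD (x := x)]
      simp [hφ, LinearMap.sum_apply]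
    have hk' : (p 0 1 1 : ℂ) ≠ 0 := by exact_mod_cast hk.ne'
    rw [map_smul, LinearMap.comp_apply, Submodule.subtype_apply, hs, smul_eq_mul,
      div_mul_cancel₀ _ hk']
  rw [h3, finrank_top, Module.finrank_self, hLk] at h2
  rw [← hmap, Submodule.finrank_map_subtype_eq]
  omega

lemma isPrimitive_iff_down {v : X → ℂ} :
    IsPrimitive G x v ↔ (∀ y, G.dist x y ≠ 2 → v y = 0) ∧ down G x v = 0 := by
  have h : down G x v = 0 ↔ ∀ y, G.dist x y = 1 → (distMatrix ℂ G 1 *ᵥ v) y = 0 := by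
    rw [funext_iff]
    refine forall_congr' fun y => ?_
    rw [down_apply, distMatrix_mulVec_apply, Finset.sum_filter]
    by_cases hy : G.dist x y = 1 <;> simp [hy]
  rw [h]
  exact ⟨fun h => ⟨h.supp, h.ann⟩, fun h => ⟨h.1, h.2⟩⟩

lemma up_eq_zero (u : X → ℂ) {y : X} (hy : G.dist x y ≠ 2) : up G x u y = 0 := by
  rw [up_apply, if_neg hy]

/-- Applying `E*_1 A` yields `a b_1` times the all-ones vector of layer 1 plus `b_2 u`; since `u`
has sum zero, adding up the entries separates the two. Every directness claim below rests on this.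
-/
lemma eq_zero_of_down_eq_zero (hG : IsDistanceRegularWith G p) (hbip : G.IsBipartite)
    (hD : 3 ≤ G.diam) (hk : 0 < p 0 1 1) {a : ℂ} {u : X → ℂ} (hu : u ∈ sumZero G x)
    (h : down G x (a • layerOnes G x 2 + up G x u) = 0) : a = 0 ∧ u = 0 := by
  obtain ⟨hu1, hu2⟩ := (mem_sumZero hG.connected).1 hu
  have hb1 : (bNum G p 1 : ℂ) ≠ 0 := by exact_mod_cast (bNum_pos hG (by omega)).ne'
  have hb2 : (bNum G p 2 : ℂ) ≠ 0 := by exact_mod_cast (bNum_pos hG (by omega)).ne'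
  have hk' : (p 0 1 1 : ℂ) ≠ 0 := by exact_mod_cast hk.ne'
  rw [map_add, map_smul, down_layerOnes hG hD, down_up hG hbip hD hu1, hu2, mul_zero, zero_smul,
    add_zero] at h
  have hs : a * (bNum G p 1 * p 0 1 1) = 0 := by
    have := congrArg (fun f : X → ℂ => ∑ y, f y) h
    simpa [Finset.sum_add_distrib, ← Finset.mul_sum, hu2, sum_layerOnes_one hG hD] using this
  have ha : a = 0 := by simpa [hb1, hk'] using hs
  rw [ha, zero_smul, zero_add] at h
  exact ⟨ha, (smul_eq_zero.1 h).resolve_left hb2⟩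

lemma exists_decomposition (hG : IsDistanceRegularWith G p) (hbip : G.IsBipartite)
    (hD : 3 ≤ G.diam) (hk : 0 < p 0 1 1) {t : ℝ} {v : X → ℂ} (hv : v ∈ localEigenspace G x t) :
    ∃ a : ℂ, ∃ u ∈ sumZero G x, a * (t - p 2 2 2) = 0 ∧ ((t : ℂ) - ((bNum G p 3 : ℂ) - 1)) • u = 0 ∧
      v - (a • layerOnes G x 2 + up G x u) ∈ eigenspaceU G x t := by
  have hc := hG.connected
  obtain ⟨hv1, hv2⟩ := (mem_localEigenspace hc).1 hv
  have hb1 : (bNum G p 1 : ℂ) ≠ 0 := by exact_mod_cast (bNum_pos hG (by omega)).ne'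
  have hb2 : (bNum G p 2 : ℂ) ≠ 0 := by exact_mod_cast (bNum_pos hG (by omega)).ne'
  have hk' : (p 0 1 1 : ℂ) ≠ 0 := by exact_mod_cast hk.ne'
  set T := ∑ y, down G x v y with hT
  -- `u` and `a` are chosen so that subtracting the two pieces cancels `down G x v`: its mean is
  -- matched through `b_1` and its sum-zero part through `b_2`.
  set u : X → ℂ := (bNum G p 2 : ℂ)⁻¹ • (down G x v - (T / p 0 1 1) • layerOnes G x 1) with hu
  set a : ℂ := T / p 0 1 1 / bNum G p 1 with ha
  have hu1 : ∀ y, G.dist x y ≠ 1 → u y = 0 := fun y hy => by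
    simp [hu, layerOnes_eq_zero hy, down_apply, hy]
  have hu2 : ∑ y, u y = 0 := by
    have : ∑ y, (T / p 0 1 1) * layerOnes G x 1 y = T := by
      rw [← Finset.mul_sum, sum_layerOnes_one hG hD, div_mul_cancel₀ _ hk']
    simp only [hu, Pi.smul_apply, Pi.sub_apply, smul_eq_mul]
    rw [← Finset.mul_sum, Finset.sum_sub_distrib, this, ← hT, sub_self, mul_zero]
  have huK : u ∈ sumZero G x := (mem_sumZero hc).2 ⟨hu1, hu2⟩
  set r := v - (a • layerOnes G x 2 + up G x u) with hr
  have hr1 : ∀ y, G.dist x y ≠ 2 → r y = 0 := fun y hy => by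
    simp [hr, hv1 y hy, layerOnes_eq_zero hy, up_eq_zero u hy]
  have hr2 : down G x r = 0 := by
    rw [hr, map_sub, map_add, map_smul, down_layerOnes hG hD, down_up hG hbip hD hu1, hu2, mul_zero,
      zero_smul, add_zero, hu, smul_smul, smul_smul, mul_inv_cancel₀ hb2, one_smul, ha,
      div_mul_cancel₀ _ hb1]
    abel
  have hprim : IsPrimitive G x r := isPrimitive_iff_down.2 ⟨hr1, hr2⟩
  have hSr : localMatrix G x *ᵥ r = (t : ℂ) • r + ((a * (t - p 2 2 2)) • layerOnes G x 2 +
      up G x (((t : ℂ) - ((bNum G p 3 : ℂ) - 1)) • u)) := by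
    rw [hr, mulVec_sub, mulVec_add, mulVec_smul, hv2, localMatrix_layerOnes hG hD,
      localMatrix_up hG hbip hD hu1, hu2, mul_zero, zero_smul, add_zero,
      map_smul (up G x) ((t : ℂ) - ((bNum G p 3 : ℂ) - 1)) u]
    ext y
    simp only [Pi.sub_apply, Pi.add_apply, Pi.smul_apply, smul_eq_mul]
    ring
  -- `E*_1 A` kills `r`, and by `down_localMatrix` also its image under the local matrix, hence the
  -- remainder in `hSr`; `eq_zero_of_down_eq_zero` then removes both of its terms.
  have hzero : down G x ((a * (t - p 2 2 2)) • layerOnes G x 2 +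
      up G x (((t : ℂ) - ((bNum G p 3 : ℂ) - 1)) • u)) = 0 := by
    have h := down_localMatrix hG hbip hD hr1
    rw [hSr, map_add, map_smul, hr2, hprim.sum_eq_zero hG (by omega), smul_zero, smul_zero,
      mul_zero, zero_smul, zero_add, zero_add] at h
    exact h
  obtain ⟨h1, h2⟩ := eq_zero_of_down_eq_zero hG hbip hD hk (Submodule.smul_mem _ _ huK) hzero
  refine ⟨a, u, huK, h1, h2, (mem_eigenspaceU_iff hG hbip (by omega)).2 ⟨hprim, ?_⟩⟩
  rw [hSr, h1, h2, map_zero, zero_smul, add_zero, add_zero]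

lemma layerOnes_mem_localEigenspace (hG : IsDistanceRegularWith G p) (hD : 3 ≤ G.diam) {t : ℝ}
    (ht : t = p 2 2 2) : layerOnes G x 2 ∈ localEigenspace G x t := by
  refine (mem_localEigenspace hG.connected).2 ⟨fun y hy => layerOnes_eq_zero hy, ?_⟩
  rw [localMatrix_layerOnes hG hD, ht]
  simp

lemma up_mem_localEigenspace (hG : IsDistanceRegularWith G p) (hbip : G.IsBipartite)
    (hD : 3 ≤ G.diam) {t : ℝ} (ht : t = (bNum G p 3 : ℝ) - 1) {u : X → ℂ} (hu : u ∈ sumZero G x) :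
    up G x u ∈ localEigenspace G x t := by
  obtain ⟨hu1, hu2⟩ := (mem_sumZero hG.connected).1 hu
  refine (mem_localEigenspace hG.connected).2 ⟨fun y hy => up_eq_zero u hy, ?_⟩
  rw [localMatrix_up hG hbip hD hu1, hu2, ht]
  simp

/-- The multiplicity of each eigenvalue of the second layer is made up of the contributions of the
all-ones vector, of the vectors `E*_2 A u` with `u` in the first layer, and of `U`. -/
lemma finrank_localEigenspace (hG : IsDistanceRegularWith G p) (hbip : G.IsBipartite)
    (hD : 3 ≤ G.diam) (hk : 0 < p 0 1 1) (t : ℝ) :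
    Module.finrank ℂ (localEigenspace G x t) = (if t = p 2 2 2 then 1 else 0) +
      (if t = (bNum G p 3 : ℝ) - 1 then p 0 1 1 - 1 else 0) +
        Module.finrank ℂ (eigenspaceU G x t) := by
  have hc := hG.connected
  -- `P` and `Q` are switched on independently, so the count stays correct when `p^2_22 = b_3 - 1`.
  set P : Submodule ℂ (X → ℂ) := if t = p 2 2 2 then ℂ ∙ layerOnes G x 2 else ⊥ with hP
  set Q : Submodule ℂ (X → ℂ) :=
    if t = (bNum G p 3 : ℝ) - 1 then (sumZero G x).map (up G x) else ⊥ with hQ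
  have hPmem : ∀ w ∈ P, ∃ a : ℂ, a • layerOnes G x 2 = w := by
    intro w hw
    rw [hP] at hw
    split_ifs at hw
    · exact Submodule.mem_span_singleton.1 hw
    · exact ⟨0, by rw [zero_smul, (Submodule.mem_bot ℂ).1 hw]⟩
  have hQmem : ∀ w ∈ Q, ∃ u ∈ sumZero G x, up G x u = w := by
    intro w hw
    rw [hQ] at hw
    split_ifs at hw
    · exact hw
    · exact ⟨0, zero_mem _, by rw [map_zero, (Submodule.mem_bot ℂ).1 hw]⟩
  have hdown : ∀ w ∈ eigenspaceU G x t, down G x w = 0 := fun w hw =>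
    (isPrimitive_iff_down.1 ((mem_eigenspaceU_iff hG hbip (by omega)).1 hw).1).2
  have hPr : Module.finrank ℂ P = if t = p 2 2 2 then 1 else 0 := by
    by_cases ht : t = p 2 2 2
    · rw [if_pos ht, show P = ℂ ∙ layerOnes G x 2 from if_pos ht]
      refine finrank_span_singleton fun h => one_ne_zero (α := ℂ) ?_
      refine (eq_zero_of_down_eq_zero hG hbip hD hk (a := 1) (zero_mem (sumZero G x)) ?_).1
      rw [h, smul_zero, map_zero, add_zero, map_zero]
    · rw [if_neg ht, show P = ⊥ from if_neg ht, finrank_bot]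
  have hinj : Set.InjOn (up G x) (sumZero G x) := by
    intro u hu w hw h
    refine sub_eq_zero.1 (eq_zero_of_down_eq_zero hG hbip hD hk (a := 0) (sub_mem hu hw) ?_).2
    rw [map_sub, h, sub_self, zero_smul, add_zero, map_zero]
  have hQr : Module.finrank ℂ Q = if t = (bNum G p 3 : ℝ) - 1 then p 0 1 1 - 1 else 0 := by
    by_cases ht : t = (bNum G p 3 : ℝ) - 1
    · rw [if_pos ht, show Q = (sumZero G x).map (up G x) from if_pos ht,
        ← finrank_sumZero hG hD hk (x := x), ← LinearMap.range_domRestrict]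
      exact LinearMap.finrank_range_of_inj fun u w h => Subtype.ext (hinj u.2 w.2 h)
    · rw [if_neg ht, show Q = ⊥ from if_neg ht, finrank_bot]
  have hPQ : P ⊓ Q = ⊥ := by
    rw [eq_bot_iff]
    rintro w ⟨hw1, hw2⟩
    obtain ⟨a, rfl⟩ := hPmem w hw1
    obtain ⟨u, hu, h⟩ := hQmem _ hw2
    rw [Submodule.mem_bot]
    rw [(eq_zero_of_down_eq_zero hG hbip hD hk (a := a) (neg_mem hu) ?_).1, zero_smul]
    rw [map_neg, h, add_neg_cancel, map_zero]
  have hPQU : (P ⊔ Q) ⊓ eigenspaceU G x t = ⊥ := by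
    rw [eq_bot_iff]
    rintro w ⟨hw1, hw2⟩
    obtain ⟨w1, h1, w2, h2, rfl⟩ := Submodule.mem_sup.1 hw1
    obtain ⟨a, rfl⟩ := hPmem w1 h1
    obtain ⟨u, hu, rfl⟩ := hQmem w2 h2
    obtain ⟨rfl, rfl⟩ := eq_zero_of_down_eq_zero hG hbip hD hk hu (hdown _ hw2)
    simp
  have htop : localEigenspace G x t = P ⊔ Q ⊔ eigenspaceU G x t := by
    apply le_antisymm
    · intro v hv
      obtain ⟨a, u, hu, ha, hu0, hmem⟩ := exists_decomposition hG hbip hD hk hv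
      have haP : a • layerOnes G x 2 ∈ P := by
        rw [hP]
        split_ifs with h
        · exact Submodule.smul_mem _ _ (Submodule.mem_span_singleton_self _)
        · have : (t : ℂ) - p 2 2 2 ≠ 0 := sub_ne_zero.2 (by exact_mod_cast h)
          rw [(mul_eq_zero.1 ha).resolve_right this, zero_smul]
          exact zero_mem _
      have huQ : up G x u ∈ Q := by
        rw [hQ]
        split_ifs with h
        · exact Submodule.mem_map_of_mem hu
        · have : (t : ℂ) - ((bNum G p 3 : ℂ) - 1) ≠ 0 := sub_ne_zero.2 (by exact_mod_cast h)
          rw [(smul_eq_zero.1 hu0).resolve_left this, map_zero]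
          exact zero_mem _
      rw [← add_sub_cancel (a • layerOnes G x 2 + up G x u) v]
      exact Submodule.add_mem_sup (Submodule.add_mem_sup haP huQ) hmem
    · refine sup_le (sup_le ?_ ?_) fun v hv => ?_
      · rw [hP]
        split_ifs with h
        · exact (Submodule.span_singleton_le_iff_mem _ _).2 (layerOnes_mem_localEigenspace hG hD h)
        · exact bot_le
      · rw [hQ]
        split_ifs with h
        · exact Submodule.map_le_iff_le_comap.2 fun u hu => up_mem_localEigenspace hG hbip hD h hu
        · exact bot_le
      · obtain ⟨h1, h2⟩ := (mem_eigenspaceU_iff hG hbip (by omega)).1 hv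
        exact (mem_localEigenspace hc).2 ⟨h1.supp, h2⟩
  have e1 := Submodule.finrank_sup_add_finrank_inf_eq P Q
  have e2 := Submodule.finrank_sup_add_finrank_inf_eq (P ⊔ Q) (eigenspaceU G x t)
  rw [hPQ, finrank_bot, hPr, hQr] at e1
  rw [hPQU, finrank_bot] at e2
  rw [htop]
  omega

/-! ### The local eigenvalues -/

lemma card_localSpectrum (hG : IsDistanceRegularWith G p) (hD : 2 ≤ G.diam) :
    (localSpectrum G x).card = p 0 2 2 := by
  classical
  have hN : ((localGraph G x).adjMatrix ℝ).IsHermitian := SimpleGraph.isHermitian_adjMatrix ..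
  rw [localSpectrum, ← hN.splits_charpoly.natDegree_eq_card_roots, charpoly_natDegree_eq_dim,
    ← card_dist_eq hG hD x, Fintype.card_subtype]

/-- Every multiset containing `l` can be listed so that the list starts with `l`. -/
lemma exists_map_Icc_eq {l : List ℝ} {s : Multiset ℝ} (h : (l : Multiset ℝ) ≤ s) :
    ∃ e : ℕ → ℝ, (Finset.Icc 1 s.card).val.map e = s ∧
      ∀ i (hi : i < l.length), e (i + 1) = l[i] := by
  obtain ⟨r, rfl⟩ := Multiset.le_iff_exists_add.1 h
  obtain ⟨r, rfl⟩ := Quot.exists_rep r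
  refine ⟨fun i => (l ++ r).getD (i - 1) 0, ?_, fun i hi => ?_⟩
  · have h1 : (Finset.Icc 1 (l ++ r).length).val =
        (Multiset.range (l ++ r).length).map (· + 1) := by
      have : Finset.Icc 1 (l ++ r).length =
          (Finset.range (l ++ r).length).map ⟨(· + 1), add_left_injective 1⟩ := by
        ext i
        simp only [Finset.mem_Icc, Finset.mem_map, Finset.mem_range, Function.Embedding.coeFn_mk]
        constructor
        · rintro ⟨h1, h2⟩
          exact ⟨i - 1, by omega, by omega⟩
        · rintro ⟨j, hj, rfl⟩
          omega
      rw [this]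
      rfl
    change (Finset.Icc 1 (Multiset.card ((l ++ r : List ℝ) : Multiset ℝ))).val.map _ =
      ((l ++ r : List ℝ) : Multiset ℝ)
    rw [Multiset.coe_card, h1, Multiset.map_map, ← Multiset.coe_range, Multiset.map_coe]
    congr 1
    refine List.ext_getElem (by simp) fun i h1 h2 => ?_
    simp [List.getElem?_eq_getElem h2]
  · have h2 : i < (l ++ r).length := by
      rw [List.length_append]
      omega
    simp only [Nat.add_sub_cancel]
    rw [List.getD_eq_getElem _ _ h2, List.getElem_append_left hi]

lemma count_map_Icc (e : ℕ → ℝ) (t : ℝ) (m : ℕ) :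
    ((Finset.Icc 1 m).val.map e).count t = ((Finset.Icc 1 m).filter fun i => e i = t).card := by
  rw [Multiset.count_map, Finset.card_def, Finset.filter_val]
  exact congrArg _ (Multiset.filter_congr fun i _ => eq_comm)

/-- The number of times that `η` appears among `η_{k+1}, …, η_{k₂}` is `dim U_η`. -/
lemma isMult_finrank (hG : IsDistanceRegularWith G p) (hbip : G.IsBipartite)
    (hD : 4 ≤ G.diam) (hk : 0 < p 0 1 1) (η : ℝ) :
    IsMult G x p η (Module.finrank ℂ (eigenspaceU G x η)) := by
  have hb3 : bNum G p 3 = p 3 1 4 := if_pos (by omega)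
  have hcount : ∀ t : ℝ, (localSpectrum G x).count t = (if t = p 2 2 2 then 1 else 0) +
      (if t = (p 3 1 4 : ℝ) - 1 then p 0 1 1 - 1 else 0) +
        Module.finrank ℂ (eigenspaceU G x t) := fun t => by
    rw [count_localSpectrum hG.connected, finrank_localEigenspace hG hbip (by omega) hk, hb3]
  have hcard := card_localSpectrum (x := x) hG (by omega)
  set l : List ℝ := (p 2 2 2 : ℝ) :: List.replicate (p 0 1 1 - 1) ((p 3 1 4 : ℝ) - 1) with hl
  have hlen : l.length = p 0 1 1 := by
    rw [hl, List.length_cons, List.length_replicate]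
    omega
  -- `hcount` dominates the count of each real in `l`, so an ordering with the prescribed first `k`
  -- entries exists.
  have hle : (l : Multiset ℝ) ≤ localSpectrum G x := by
    refine Multiset.le_iff_count.2 fun t => ?_
    rw [hcount, Multiset.coe_count, hl, List.count_cons, List.count_replicate]
    simp only [beq_iff_eq, eq_comm (b := t)]
    omega
  have hk2 : p 0 1 1 ≤ p 0 2 2 := by
    rw [← hlen, ← hcard]
    exact Multiset.card_le_card hle
  refine ⟨?_, fun e he => ?_⟩
  · obtain ⟨e, he, hel⟩ := exists_map_Icc_eq hle
    rw [hcard] at he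
    refine ⟨e, he, hel 0 (by omega), fun i h2 hi => ?_⟩
    obtain ⟨j, rfl⟩ : ∃ j, i = j + 1 + 1 := ⟨i - 2, by omega⟩
    rw [hel (j + 1) (by omega)]
    simp [hl]
  · have h1 := hcount η
    rw [← he.eigenvalues, count_map_Icc] at h1
    -- The first two blocks contribute to the count of `η` exactly the two conditional terms of
    -- `hcount`; the last block is left with `dim U_η`.
    have hsplit : Finset.Icc 1 (p 0 2 2) = ({1} ∪ Finset.Icc 2 (p 0 1 1)) ∪
        Finset.Icc (p 0 1 1 + 1) (p 0 2 2) := by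
      ext i
      simp only [Finset.mem_union, Finset.mem_Icc, Finset.mem_singleton]
      omega
    have hd1 : Disjoint ({1} ∪ Finset.Icc 2 (p 0 1 1)) (Finset.Icc (p 0 1 1 + 1) (p 0 2 2)) := by
      rw [Finset.disjoint_left]
      intro i
      simp only [Finset.mem_union, Finset.mem_Icc, Finset.mem_singleton]
      omega
    have hd2 : Disjoint ({1} : Finset ℕ) (Finset.Icc 2 (p 0 1 1)) := by simp
    rw [hsplit, Finset.filter_union, Finset.filter_union,
      Finset.card_union_of_disjoint, Finset.card_union_of_disjoint] at h1
    · have h2 : (({1} : Finset ℕ).filter fun i => e i = η).card = if η = p 2 2 2 then 1 else 0 := by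
        rw [Finset.filter_singleton, he.first]
        simp only [eq_comm (b := η)]
        split_ifs <;> rfl
      have h3 : ((Finset.Icc 2 (p 0 1 1)).filter fun i => e i = η).card =
          if η = (p 3 1 4 : ℝ) - 1 then p 0 1 1 - 1 else 0 := by
        rw [Finset.filter_congr fun i hi =>
          (by rw [he.second i (Finset.mem_Icc.1 hi).1 (Finset.mem_Icc.1 hi).2, eq_comm] :
            e i = η ↔ η = (p 3 1 4 : ℝ) - 1)]
        split_ifs with h
        · simp [h]
        · simp [h]
      omega
    · exact Finset.disjoint_filter_filter hd2
    · rw [← Finset.filter_union]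
      exact Finset.disjoint_filter_filter hd1

end Subconstituent

end

/-! ### The main theorem. -/

open Subconstituent in
theorem mainTheorem12 {X : Type*} [Fintype X] [DecidableEq X] (G : SimpleGraph X)
    (p : ℕ → ℕ → ℕ → ℕ) (hG : IsDistanceRegularWith G p) (hbip : G.IsBipartite)
    (hD : 4 ≤ G.diam) (hk : 3 ≤ p 0 1 1) (x : X)
    (n : ℕ) (hn : n = 1 ∨ (Odd G.diam ∧ n = G.diam / 2))
    (η : ℝ) (hη : η = tilde p (eigenvalue G n)) :
    ∃ μ m : ℕ, IsMu G x η μ ∧ IsMult G x p η m ∧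
      μ = Module.finrank ℂ (eigenspaceU G x η) ∧
      Module.finrank ℂ (eigenspaceU G x η) = m := by
  subst hη
  obtain ⟨u, hu, hne, hid⟩ := exists_extremal_cosine hG hbip hD hn
  refine ⟨_, _, isMu_finrank hG hbip (by omega) fun v hv => ?_,
    isMult_finrank hG hbip hD (by omega) _, rfl, rfl⟩
  obtain ⟨h1, h2⟩ := (mem_eigenspaceU_iff hG hbip (by omega)).1 hv
  exact h1.isLadder hG hbip (by omega) hu hne hid h2
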